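/- **Setting.** Let $m,n\ge 1$; write $B_r(x)\subset\mathbb R^m$ for open disks and $\mathrm{Vol}^m$ for the $m$-dimensional Hausdorff measure on $\mathbb R^{m+n}$ (normalized to agree with Lebesgue measure on $\mathbb R^m$); $\mathrm{gr}(u,F)=\{(x,u(x)):x\in F\}$. Fix $c_0>0$. For Lipschitz $u:B_1\to\mathbb R^n$ the graph $\mathrm{gr}(u)=\mathrm{gr}(u,B_1)$ is *area minimizing* if for every $A\in SO(m+n)$ with Hilbert–Schmidt norm $|A-\mathrm{Id}|\le c_0$ the following holds: if in the coordinates $(x',y')=A(x,y)$ the set $\mathrm{gr}(u)$ is the graph of a Lipschitz map $u':\Omega'\to\mathbb R^n$, then $\mathrm{Vol}^m(\mathrm{gr}(w,\Omega'))\ge \mathrm{Vol}^m(\mathrm{gr}(u',\Omega'))$ for every Lipschitz $w:\Omega'\to\mathbb R^n$ with $\{w\ne u'\}\subset\subset\Omega'$. Put $E:=\mathrm{Vol}^m(\mathrm{gr}(u,B_1))-|B_1|$. *Excess.* $\vec T_q\mathrm{gr}(u)$ is the unit $m$-vector orienting the tangent plane at $q=(x,u(x))$, i.e. the normalization of $(e_1+du|_x(e_1))\wedge\dots\wedge(e_m+du|_x(e_m))$,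 with the norm on $m$-vectors induced by $\langle v_1\wedge\dots\wedge v_m,w_1\wedge\dots\wedge w_m\rangle=\det\langle v_j,w_k\rangle$. For an oriented $m$-plane $\pi$ with orienting unit $m$-vector $\vec\pi$ let $B_r(p,\pi)=\{q\in p+\pi:|q-p|<r\}$, $\mathbf C_r(p,\pi)=B_r(p,\pi)+\pi^\perp$ and $$\mathbf E(\mathrm{gr}(u),\mathbf C_r(p,\pi)):=\tfrac12\int_{\mathrm{gr}(u)\cap \mathbf C_r(p,\pi)}|\vec T_q\mathrm{gr}(u)-\vec\pi|^2\,d\mathrm{Vol}^m(q).$$ *Cubes.* Let $\sigma=(2\sqrt m)^{-1}$ and let $\mathscr C_k$ be the $2^{mk}$ closed cubes of the regular grid subdividing $[-\sigma,\sigma]^m$; $\ell(L)$ and $x_L$ are the sidelength and the center of $L\in\mathscr C_k$, and $p_L=(x_L,u(x_L))$. Fix $M_0\ge 1$ and $N_0\in\mathbb N$ such that $B_{32M_0\ell(L)}(x_L)\subset B_1$ for all $L\in\mathscr C_k$, $k\ge N_0$. Fix a mollifier: $\varphi\in C_c^\infty(B_1)$ radial with $\int\varphi=1$, and $\varphi_r(x)=r^{-m}\varphi(x/r)$.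 *Lipschitz approximation.* Fix $\gamma>0$ and $\Lambda\ge1$. Given $\bar E\ge 0$ and $v:B_r(p,\pi)\to\pi^\perp$ with $\mathrm{Lip}(v)\le 2$, put $\rho=r(1-\bar E^\gamma)$. A map $\bar f:B_\rho(p,\pi)\to\pi^\perp$ is called an $\bar E^\gamma$-Lipschitz approximation of $v$ if $\mathrm{Lip}(\bar f)\le\Lambda \bar E^\gamma$ and $\bar f=v$ on some $K\subset B_\rho(p,\pi)$ with $|B_\rho(p,\pi)\setminus K|\le r^m\bar E^{1+\gamma}$ and $\mathrm{Lip}(v|_K)\le\bar E^\gamma$. **Proposition 5.1.** There is $\delta_0>0$, depending on $m,n,c_0,\gamma$, such that for every $\delta\in(0,\delta_0)$ there is $\beta>0$, depending on $m,n,c_0,\gamma,\delta$, with the following property. For all $\varphi,\Lambda,M_0,N_0$ as above and every $C_0>0$ there are $\varepsilon_0>0$ and constants $C$ and $C(j)$, $j\in\mathbb N$, depending only on these data ($m,n,c_0,\gamma,\delta,\varphi,\Lambda,M_0,N_0,C_0$), such that the following holds. Let $u:B_1\to\mathbb R^n$ be Lipschitz with $\mathrm{Lip}(u)\le1$, with area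 minimizing graph and with $E<\varepsilon_0$. Let $L\in\mathscr C_k$ with $k\ge N_0$, and let $\pi$ be an oriented $m$-plane with $$\bar E:=\ell(L)^{-m}\,\mathbf E(\mathrm{gr}(u),\mathbf C_{16M_0\ell(L)}(p_L,\pi))\le C_0E\,\ell(L)^{2-2\delta}.$$ Let $v:B_{16M_0\ell(L)}(p_L,\pi)\to\pi^\perp$, $\mathrm{Lip}(v)\le2$, be the map whose graph is $\mathrm{gr}(u)\cap\mathbf C_{16M_0\ell(L)}(p_L,\pi)$, let $\bar f$ be an $\bar E^\gamma$-Lipschitz approximation of $v$ (with $r=16M_0\ell(L)$), and let $\bar z:=\bar f*\varphi_{\ell(L)}$. Then $\bar z$ is smooth on $B_{4M_0\ell(L)}(p_L,\pi)$, $\bar z-\bar f$ is integrable there, and $$\|\bar z-\bar f\|_{L^1(B_{4M_0\ell(L)}(p_L,\pi))}\le C\,E\,\ell(L)^{m+3+2\beta},$$ $$\|\Delta D^j\bar z\|_{C^0(B_{4M_0\ell(L)}(p_L,\pi))}\le C(j)\,E\,\ell(L)^{1-j+2\beta}\qquad\text{for all }j\in\mathbb N.$$ -/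

import Mathlib

open MeasureTheory Metric Set
open scoped ContDiff

noncomputable section

namespace CenterManifold

/-- `ℝ^m` with its Euclidean norm. -/
abbrev E (m : ℕ) : Type := EuclideanSpace ℝ (Fin m)

/-- `ℝ^{m+n} = ℝ^m × ℝ^n` with its Euclidean norm; the indices `Sum.inl` are the first `m`
coordinates, the indices `Sum.inr` the last `n` ones. -/
abbrev Amb (m n : ℕ) : Type := EuclideanSpace ℝ (Fin m ⊕ Fin n)

variable {m n : ℕ}

/-- The point `(x, y)`. -/
def pt (x : E m) (y : E n) : Amb m n := WithLp.toLp 2 (Sum.elim (fun i => x i) (fun j => y j))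

/-- The first component `x` of `(x, y)`. -/
def hor (q : Amb m n) : E m := WithLp.toLp 2 (fun i => q (Sum.inl i))

/-- The graph of `u` over `F`. -/
def graph (u : E m → E n) (F : Set (E m)) : Set (Amb m n) := (fun x => pt x (u x)) '' F

/-- The `m`-dimensional volume in `ℝ^{m+n}`: the Hausdorff measure, normalized so that it agrees
with Lebesgue measure on `ℝ^m`. -/
def vol (m n : ℕ) : Measure (Amb m n) := Measure.euclideanHausdorffMeasure m

/-- `m + n` by `m + n` matrices. -/
abbrev Mat (m n : ℕ) : Type := Matrix (Fin m ⊕ Fin n) (Fin m ⊕ Fin n) ℝ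

/-- `SO(m+n)`. -/
def SO (m n : ℕ) : Set (Mat m n) :=
  {A | A ∈ Matrix.specialOrthogonalGroup (Fin m ⊕ Fin n) ℝ}

/-- The Hilbert-Schmidt norm. -/
def hsNorm (B : Mat m n) : ℝ := Real.sqrt (∑ i, ∑ j, B i j ^ 2)

/-- The change of coordinates `(x', y') = A (x, y)`. -/
def rot (A : Mat m n) (q : Amb m n) : Amb m n := WithLp.toLp 2 (A.mulVec (fun i => q i))

/-- The graph of `u` over `Ω` is area minimizing: in every system of coordinates `A` with
`|A - Id| ≤ c₀`, in which it is the graph of the Lipschitz function `u'` over `Ω'`, it has no more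
volume than the graph of any Lipschitz `v` on `Ω'` with `{v ≠ u'} ⊂⊂ Ω'`. -/
def AreaMinimizing (c₀ : ℝ) (u : E m → E n) (Ω : Set (E m)) : Prop :=
  ∀ A ∈ SO m n, hsNorm (A - 1) ≤ c₀ →
    ∀ (Ω' : Set (E m)) (u' : E m → E n), (∃ k, LipschitzOnWith k u' Ω') →
      rot A '' graph u Ω = graph u' Ω' →
      ∀ v : E m → E n, (∃ k, LipschitzOnWith k v Ω') →
        IsCompact (closure {x ∈ Ω' | v x ≠ u' x}) → closure {x ∈ Ω' | v x ≠ u' x} ⊆ Ω' →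
        vol m n (graph u' Ω') ≤ vol m n (graph v Ω')

/-- `E = Vol^m (gr (u, B_1)) - ω_m`. -/
def totalExcess (u : E m → E n) : ℝ :=
  (vol m n (graph u (ball 0 1))).toReal - (volume (ball (0 : E m) 1)).toReal

/-- The unit simple `m`-vector `v_1 ∧ … ∧ v_m / |v_1 ∧ … ∧ v_m|`; the norm is the one induced by
`⟨v_1 ∧ … ∧ v_m, w_1 ∧ … ∧ w_m⟩ = det ⟨v_j, w_k⟩`. -/
def unitMVec (a : Fin m → Amb m n) : ⋀[ℝ]^m (Amb m n) :=
  ‖exteriorPower.ιMulti ℝ m a‖⁻¹ • exteriorPower.ιMulti ℝ m a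

/-- The orienting `m`-vector of the tangent space to the graph of `u` at `(x, u x)`, that is, the
normalization of `(e_1 + du (e_1)) ∧ … ∧ (e_m + du (e_m))`. -/
def tangentMVec (u : E m → E n) (x : E m) : ⋀[ℝ]^m (Amb m n) :=
  unitMVec fun j => pt (EuclideanSpace.single j 1) (fderiv ℝ u x (EuclideanSpace.single j 1))

/-- The orienting `m`-vector of the plane `π = A⁻¹ (ℝ^m × {0})`, that is
`A⁻¹ e_1 ∧ … ∧ A⁻¹ e_m`, where `A⁻¹ = Aᵀ`. Every oriented `m`-dimensional plane arises so from
some `A` in `SO(m+n)`, if `n ≥ 1`. -/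
def planeMVec (A : Mat m n) : ⋀[ℝ]^m (Amb m n) :=
  unitMVec fun j => rot A.transpose (pt (EuclideanSpace.single j 1) 0)

/-- The cylinder `C_r (p, π) = B_r (p, π) + π^⊥` over the plane `π = A⁻¹ (ℝ^m × {0})`: the points
whose orthogonal projection on `π` has distance less than `r` from that of `p`. -/
def cyl (A : Mat m n) (p : Amb m n) (r : ℝ) : Set (Amb m n) :=
  {q | dist (hor (rot A q)) (hor (rot A p)) < r}

/-- The cylindrical excess, with respect to the oriented plane `π = A⁻¹ (ℝ^m × {0})`, of the graph
of `u : B_1 → ℝ^n` in the cylinder `C_r (p, π)`. -/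
def cylExcess (u : E m → E n) (A : Mat m n) (p : Amb m n) (r : ℝ) : ℝ :=
  (1 / 2) * ∫ q in graph u (ball 0 1) ∩ cyl A p r,
    ‖tangentMVec u (hor q) - planeMVec A‖ ^ 2 ∂(vol m n)

/-- `f` is an `e^γ`-Lipschitz approximation of `v : B_r (x) → ℝ^n`: with `ρ = r (1 - e^γ)`, it is an
extension to `B_ρ (x)` of the restriction of `v` to a set `K ⊆ B_ρ (x)` with
`|B_ρ (x) ∖ K| ≤ r^m e^{1+γ}` and `Lip (v|_K) ≤ e^γ`, and `Lip (f) ≤ Λ e^γ`, where `Λ` is the factor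
that is allowed to be lost in the extension. -/
def IsLipApprox (γ Λ e : ℝ) (v : E m → E n) (x : E m) (r : ℝ) (f : E m → E n) : Prop :=
  ∃ K ⊆ ball x (r * (1 - e ^ γ)),
    volume (ball x (r * (1 - e ^ γ)) \ K) ≤ ENNReal.ofReal (r ^ m * e ^ (1 + γ)) ∧
    LipschitzOnWith (Real.toNNReal (e ^ γ)) v K ∧
    EqOn f v K ∧
    LipschitzOnWith (Real.toNNReal (Λ * e ^ γ)) f (ball x (r * (1 - e ^ γ)))

/-- A standard mollifier: smooth, radial, supported in the open unit disk, of integral one. -/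
structure IsMollifier (φ : E m → ℝ) : Prop where
  smooth : ContDiff ℝ ∞ φ
  tsupport_subset : tsupport φ ⊆ ball 0 1
  radial : ∀ x y, ‖x‖ = ‖y‖ → φ x = φ y
  integral_eq_one : ∫ x, φ x = 1

/-- `φ_r (x) = r^{-m} φ (x / r)`. -/
def scaled (φ : E m → ℝ) (r : ℝ) (x : E m) : ℝ := (r ^ m)⁻¹ * φ (r⁻¹ • x)

/-- The mollification `f ∗ φ_r`. -/
def mollify (φ : E m → ℝ) (r : ℝ) (f : E m → E n) : E m → E n :=
  convolution (scaled φ r) f (ContinuousLinearMap.lsmul ℝ ℝ) volume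

/-- `σ = (2 √m)⁻¹`. -/
def sigma (m : ℕ) : ℝ := (2 * Real.sqrt m)⁻¹

/-- The sidelength of the `2^{mk}` cubes of the regular grid that subdivides `[-σ, σ]^m`. -/
def side (m k : ℕ) : ℝ := 2 * sigma m / 2 ^ k

/-- The center `x_L` of the cube `L` of the `k`-th grid with index `i`. -/
def cubeCenter (k : ℕ) (i : Fin m → Fin (2 ^ k)) : E m :=
  WithLp.toLp 2 fun j => -sigma m + (((i j : ℕ) : ℝ) + 1 / 2) * side m k

/-- The parameters `M₀` and `N₀` are admissible: for all cubes `L` of the grids with `k ≥ N₀`, the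
ball of radius `32 M₀ ℓ(L)` centered at `(x_L, u (x_L))` is contained in the cylinder over `B_1`. -/
def Admissible (m : ℕ) (M₀ : ℝ) (N₀ : ℕ) : Prop :=
  1 ≤ M₀ ∧ ∀ k ≥ N₀, ∀ i : Fin m → Fin (2 ^ k),
    ball (cubeCenter k i) (32 * M₀ * side m k) ⊆ ball 0 1

end CenterManifold

end

open scoped NNReal ENNReal Topology RealInnerProductSpace

noncomputable section

namespace CenterManifold

variable {m n : ℕ}

/-! ### The area integrand -/

/-! Over the plane π the surface is the graph of `v`, which minimizes area among small vertical
perturbations. The integrand √det(1 + PᵀP) equals 1 + |P|²/2 up to O(|P|⁴), so the first variation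
makes `v` harmonic up to a cubic error: |∫⟨Dv, Dκ⟩| ≤ C ∫ |Dv|³ |Dκ| for every test map κ
(`VerticallyMinimizing.abs_integral_hsInner_le`). A competitor that is vertical over π is not
vertical over ℝ^m, but for a small parameter it is still a graph over the unit ball
(`exists_graph_deformation`). Minimality in the original coordinates is therefore enough, whatever
the tilt of π (`AreaMinimizing.vol_graph_tilted_le`).

The excess e controls ∫ |Dv|² (`exists_integral_norm_fderiv_sq_le`). On the set where the
approximation `f` agrees with `v`, the gradient is at most e^γ, so the cubic error is at most e^γ
|Dv|². On the rest everything is bounded, and the rest has measure at most r^m e^(1+γ). Hence `f` is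
weakly harmonic up to a density g (`harmonicDefect`) with ∫ g ≤ C e^(1+γ) ℓ^m. This superlinear gain
drives the result: the assumed bound of e by E ℓ^(2-2δ) gives e^(1+γ) ≤ C E ℓ^(2+2β) with β = γ -
δ(1+γ), which is positive when δ < γ/(1+γ).

Two linear estimates turn ∫ g into the conclusions. In Δ D^j (f ∗ φ_ℓ) all derivatives fall on the
kernel; j of them make a test function, and weak harmonicity bounds the result by sup |D^(j+1) φ_ℓ|
∫ g, of order ℓ^(-m-j-1) ∫ g (`norm_laplacian_iteratedFDeriv_convolution_le`). For the L¹ bound, f ∗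
φ_r is differentiated in the scale r. Since φ is radial, φ(x) x is the gradient of a compactly
supported θ (`IsMollifier.exists_potential`), so the derivative in r is again a pairing of Df with
the gradient of a test function, a rescaled θ. Integrating over 0 < r < ℓ and over y gives ℓ ∫ g ∫
|Dθ| (`WeaklyHarmonicUpTo.lintegral_mollify_sub_le`). -/

/-- The `i`-th vector of the standard basis. -/
abbrev basisVec (i : Fin m) : E m := EuclideanSpace.single i (1 : ℝ)

lemma norm_basisVec (i : Fin m) : ‖basisVec i‖ = 1 := by simp [basisVec]

lemma sum_smul_basisVec (x : E m) : ∑ i, x i • basisVec i = x := by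
  ext j
  simp [basisVec, Finset.sum_apply, Pi.single_apply]

lemma norm_apply_basisVec_le (P : E m →L[ℝ] E n) (i : Fin m) : ‖P (basisVec i)‖ ≤ ‖P‖ := by
  simpa [norm_basisVec] using P.le_opNorm (basisVec i)

/-- The area integrand `√det (1 + Pᵀ P)`. -/
def jac (P : E m →L[ℝ] E n) : ℝ :=
  Real.sqrt (Matrix.det (1 + Matrix.gram ℝ fun i => P (basisVec i)))

/-- The Hilbert-Schmidt inner product of two linear maps. -/
def hsInner (P Q : E m →L[ℝ] E n) : ℝ := ∑ i, ⟪P (basisVec i), Q (basisVec i)⟫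

lemma abs_hsInner_le (P Q : E m →L[ℝ] E n) : |hsInner P Q| ≤ m * (‖P‖ * ‖Q‖) := by
  unfold hsInner
  refine (Finset.abs_sum_le_sum_abs _ _).trans ?_
  have : ∀ i ∈ Finset.univ, |⟪P (basisVec i), Q (basisVec i)⟫| ≤ ‖P‖ * ‖Q‖ := fun i _ =>
    (abs_real_inner_le_norm _ _).trans
      (mul_le_mul (norm_apply_basisVec_le P i) (norm_apply_basisVec_le Q i) (norm_nonneg _)
        (norm_nonneg _))
  simpa using Finset.sum_le_sum this

lemma hsInner_self_nonneg (P : E m →L[ℝ] E n) : 0 ≤ hsInner P P :=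
  Finset.sum_nonneg fun _ _ => real_inner_self_nonneg

lemma norm_sq_le_hsInner_self (P : E m →L[ℝ] E n) : ‖P‖ ^ 2 ≤ hsInner P P := by
  have h : ‖P‖ ≤ Real.sqrt (hsInner P P) := by
    refine P.opNorm_le_bound (Real.sqrt_nonneg _) fun x => ?_
    have h1 : P x = ∑ i, x i • P (basisVec i) := by
      conv_lhs => rw [← sum_smul_basisVec x]
      simp
    rw [h1]
    refine (norm_sum_le _ _).trans ?_
    simp_rw [norm_smul]
    refine (Real.sum_mul_le_sqrt_mul_sqrt _ _ _).trans ?_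
    rw [mul_comm, EuclideanSpace.norm_eq x]
    simp [hsInner]
  calc ‖P‖ ^ 2 ≤ Real.sqrt (hsInner P P) ^ 2 := by gcongr
    _ = _ := Real.sq_sqrt (hsInner_self_nonneg P)

/-! ### Determinants near the identity -/

lemma one_add_sum_le_prod_one_add {ι : Type*} (s : Finset ι) (a : ι → ℝ) (ha : ∀ i ∈ s, 0 ≤ a i) :
    1 + ∑ i ∈ s, a i ≤ ∏ i ∈ s, (1 + a i) := by
  classical
  induction s using Finset.induction_on with
  | empty => simp
  | insert i s hi ih =>
    rw [Finset.sum_insert hi, Finset.prod_insert hi]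
    have h1 := ih fun j hj => ha j (Finset.mem_insert_of_mem hj)
    have h2 := ha i (Finset.mem_insert_self _ _)
    have h3 : 0 ≤ ∑ j ∈ s, a j := Finset.sum_nonneg fun j hj => ha j (Finset.mem_insert_of_mem hj)
    nlinarith

/-- In terms of the eigenvalues λᵢ ≥ 0 this is 1 + ∑ λᵢ ≤ ∏ (1 + λᵢ). It yields coercivity of the
area integrand, |P|² ≤ jac(P)² - 1. -/
lemma one_add_trace_le_det_one_add {ι : Type*} [Fintype ι] [DecidableEq ι] {M : Matrix ι ι ℝ}
    (hM : M.PosSemidef) : 1 + M.trace ≤ (1 + M).det := by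
  have hH := hM.1
  have key : (1 + M).det = ∏ i, (1 + hH.eigenvalues i) := by
    -- Up to the sign (-1)^card, det(1 + M) is the characteristic polynomial at -1.
    have h1 := congrArg (Polynomial.eval (-1 : ℝ)) hH.charpoly_eq
    have h2 := Matrix.eval_charpoly M (-1)
    rw [h2] at h1
    have h3 : (Matrix.scalar ι (-1 : ℝ) - M) = -(1 + M) := by
      rw [map_neg, map_one]; abel
    rw [h3, Matrix.det_neg, Polynomial.eval_prod] at h1
    have h4 : ∏ i, Polynomial.eval (-1 : ℝ) (Polynomial.X - Polynomial.C ((hH.eigenvalues i : ℝ)))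
        = (-1) ^ Fintype.card ι * ∏ i, (1 + hH.eigenvalues i) := by
      rw [← Finset.card_univ, ← Finset.prod_const, ← Finset.prod_mul_distrib]
      refine Finset.prod_congr rfl fun i _ => ?_
      simp; ring
    simp only [RCLike.ofReal_real_eq_id, id_eq] at h1
    rw [h4] at h1
    exact mul_left_cancel₀ (pow_ne_zero _ (by norm_num)) h1
  have htr : M.trace = ∑ i, hH.eigenvalues i := by
    simpa using hH.trace_eq_sum_eigenvalues
  rw [key, htr]
  exact one_add_sum_le_prod_one_add _ _ fun i _ => hM.eigenvalues_nonneg i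

lemma one_add_hsInner_le_det (P : E m →L[ℝ] E n) :
    1 + hsInner P P ≤ Matrix.det (1 + Matrix.gram ℝ fun i => P (basisVec i)) := by
  have := one_add_trace_le_det_one_add (Matrix.posSemidef_gram ℝ fun i => P (basisVec i))
  simpa [hsInner, Matrix.trace, Matrix.gram] using this

lemma jac_sq (P : E m →L[ℝ] E n) :
    jac P ^ 2 = Matrix.det (1 + Matrix.gram ℝ fun i => P (basisVec i)) :=
  Real.sq_sqrt (by linarith [one_add_hsInner_le_det P, hsInner_self_nonneg P])

lemma one_add_hsInner_le_jac_sq (P : E m →L[ℝ] E n) : 1 + hsInner P P ≤ jac P ^ 2 := by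
  rw [jac_sq]; exact one_add_hsInner_le_det P

lemma one_le_jac (P : E m →L[ℝ] E n) : 1 ≤ jac P := by
  have h0 : 0 ≤ jac P := Real.sqrt_nonneg _
  nlinarith [one_add_hsInner_le_jac_sq P, hsInner_self_nonneg P]

lemma continuous_jac : Continuous (jac : (E m →L[ℝ] E n) → ℝ) := by
  unfold jac
  refine Real.continuous_sqrt.comp (Continuous.matrix_det ?_)
  refine continuous_const.add (continuous_matrix fun i j => ?_)
  simp only [Matrix.gram_apply]
  fun_prop

/-- The remainder of the expansion of `det (1 + S)` to first order at `S = 0`. -/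
def detRem (m : ℕ) (S : Fin m → Fin m → ℝ) : ℝ :=
  Matrix.det (1 + Matrix.of S) - 1 - ∑ i, S i i

lemma contDiff_detRem (m : ℕ) : ContDiff ℝ ∞ (detRem m) := by
  unfold detRem
  simp only [Matrix.det_apply, Matrix.add_apply, Matrix.of_apply]
  have : ∀ i j : Fin m, ContDiff ℝ ∞ fun S : Fin m → Fin m → ℝ => S i j := fun i j =>
    contDiff_apply_apply ℝ ℝ i j
  refine ((ContDiff.sum fun σ _ => ?_).sub contDiff_const).sub (ContDiff.sum fun i _ => this i i)
  refine ContDiff.const_smul _ (contDiff_prod fun i _ => contDiff_const.add (this _ _))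

/-- Along each line t ↦ t S the remainder is t² times a polynomial in t. -/
lemma fderiv_detRem_zero (m : ℕ) : fderiv ℝ (detRem m) 0 = 0 := by
  ext S
  have hd : HasFDerivAt (detRem m) (fderiv ℝ (detRem m) 0) ((0 : ℝ) • S) := by
    rw [zero_smul]
    exact ((contDiff_detRem m).differentiable (by simp) 0).hasFDerivAt
  have h1 : HasDerivAt (fun t : ℝ => detRem m (t • S)) (fderiv ℝ (detRem m) 0 S) 0 := by
    have := hd.comp_hasDerivAt (0 : ℝ) ((hasDerivAt_id (0 : ℝ)).smul_const S)
    simpa only [Function.comp_def, id, one_smul] using this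
  have h2 : (fun t : ℝ => detRem m (t • S)) = fun t =>
      Polynomial.eval t (1 + (Polynomial.X : Polynomial ℝ) •
        (Matrix.of S).map Polynomial.C).det.divX.divX * t ^ 2 := by
    funext t
    have h := Matrix.det_one_add_smul t (Matrix.of S)
    have h3 : Matrix.of (t • S) = t • Matrix.of S := rfl
    simp only [detRem, h3, h, Matrix.trace, Matrix.diag, Matrix.of_apply, Pi.smul_apply,
      smul_eq_mul, ← Finset.mul_sum]
    ring
  rw [h2] at h1
  have h4 := ((Polynomial.differentiable (1 + (Polynomial.X : Polynomial ℝ) •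
        (Matrix.of S).map Polynomial.C).det.divX.divX) 0).hasDerivAt.mul
          (hasDerivAt_pow 2 (0 : ℝ))
  have := h1.unique h4
  simpa using this

/-- The derivative is Lipschitz on bounded sets and vanishes at 0, so it is O(ρ) on the ball of
radius ρ. With Gram entries of size |P|², this extra factor ρ is what makes the error in the first
variation cubic. -/
lemma exists_detRem_sub_le (m : ℕ) (R : ℝ) : ∃ C : ℝ, 0 ≤ C ∧ ∀ (ρ : ℝ) (S T : Fin m → Fin m → ℝ),
    ρ ≤ R → ‖S‖ ≤ ρ → ‖T‖ ≤ ρ → |detRem m S - detRem m T| ≤ C * ρ * ‖S - T‖ := by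
  have h1 : ContDiff ℝ 1 (fderiv ℝ (detRem m)) := 
    (contDiff_detRem m).fderiv_right (m := 1) (by norm_num; exact WithTop.coe_le_coe.2 le_top)
  obtain ⟨K, hK⟩ := h1.contDiffOn.exists_lipschitzOnWith (by simp)
    (convex_closedBall (0 : Fin m → Fin m → ℝ) R) (isCompact_closedBall _ _)
  refine ⟨K, K.2, fun ρ S T hρ hS hT => ?_⟩
  have h0 : 0 ≤ ρ := (norm_nonneg _).trans hS
  have := Convex.norm_image_sub_le_of_norm_fderiv_le (𝕜 := ℝ) (f := detRem m) (C := K * ρ)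
    (s := closedBall 0 ρ) (x := T) (y := S)
    (fun x _ => (contDiff_detRem m).differentiable (by simp) x) (fun x hx => ?_)
    (convex_closedBall _ _) (by simpa using hT) (by simpa using hS)
  · simpa using this
  · have hx' : ‖x‖ ≤ ρ := by simpa using hx
    have := hK.norm_sub_le (show x ∈ closedBall 0 R by simpa using hx'.trans hρ)
      (show (0 : Fin m → Fin m → ℝ) ∈ closedBall 0 R by simpa using h0.trans hρ)
    rw [fderiv_detRem_zero, sub_zero, sub_zero] at this
    exact this.trans (by gcongr)

/-- The entries of the Gram matrix of a linear map. -/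
def gramEntries (P : E m →L[ℝ] E n) : Fin m → Fin m → ℝ :=
  fun i j => ⟪P (basisVec i), P (basisVec j)⟫

lemma jac_sq_eq (P : E m →L[ℝ] E n) :
    jac P ^ 2 = 1 + hsInner P P + detRem m (gramEntries P) := by
  rw [jac_sq]
  have : Matrix.of (gramEntries P) = Matrix.gram ℝ fun i => P (basisVec i) := by
    ext i j; simp [gramEntries, Matrix.gram]
  simp only [detRem, this, hsInner, gramEntries]
  ring

lemma norm_gramEntries_le (P : E m →L[ℝ] E n) : ‖gramEntries P‖ ≤ ‖P‖ ^ 2 := by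
  refine (pi_norm_le_iff_of_nonneg (by positivity)).2 fun i =>
    (pi_norm_le_iff_of_nonneg (by positivity)).2 fun j => ?_
  rw [sq]
  exact (norm_inner_le_norm _ _).trans
    (mul_le_mul (norm_apply_basisVec_le P i) (norm_apply_basisVec_le P j) (norm_nonneg _)
      (norm_nonneg _))

lemma norm_gramEntries_sub_le (P Q : E m →L[ℝ] E n) :
    ‖gramEntries (P + Q) - gramEntries P‖ ≤ 2 * (‖P‖ * ‖Q‖) + ‖Q‖ ^ 2 := by
  refine (pi_norm_le_iff_of_nonneg (by positivity)).2 fun i =>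
    (pi_norm_le_iff_of_nonneg (by positivity)).2 fun j => ?_
  have key : ∀ (A B : E m →L[ℝ] E n) (i j : Fin m),
      |⟪A (basisVec i), B (basisVec j)⟫| ≤ ‖A‖ * ‖B‖ := fun A B i j =>
    (abs_real_inner_le_norm _ _).trans
      (mul_le_mul (norm_apply_basisVec_le A i) (norm_apply_basisVec_le B j) (norm_nonneg _)
        (norm_nonneg _))
  have h : (gramEntries (P + Q) - gramEntries P) i j = ⟪P (basisVec i), Q (basisVec j)⟫ +
      ⟪Q (basisVec i), P (basisVec j)⟫ + ⟪Q (basisVec i), Q (basisVec j)⟫ := by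
    simp only [gramEntries, Pi.sub_apply, add_apply, inner_add_left,
      inner_add_right]
    ring
  rw [h, Real.norm_eq_abs]
  have h1 := key P Q i j
  have h2 := key Q P i j
  have h3 := key Q Q i j
  rw [abs_le] at *
  constructor <;> nlinarith

lemma hsInner_add_self (P Q : E m →L[ℝ] E n) :
    hsInner (P + Q) (P + Q) = hsInner P P + 2 * hsInner P Q + hsInner Q Q := by
  simp only [hsInner, add_apply, inner_add_left, inner_add_right,
    Finset.mul_sum, ← Finset.sum_add_distrib]
  refine Finset.sum_congr rfl fun i _ => ?_
  rw [real_inner_comm (P (basisVec i)) (Q (basisVec i))]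
  ring

/-- Quadratic upper bound for `jac P - 1`. -/
lemma exists_jac_sub_one_le (m n : ℕ) : ∃ C : ℝ, 0 ≤ C ∧ ∀ P : E m →L[ℝ] E n, ‖P‖ ≤ 3 →
    jac P - 1 ≤ C * ‖P‖ ^ 2 := by
  obtain ⟨C, hC, h⟩ := exists_detRem_sub_le m 9
  refine ⟨m + 9 * C, by positivity, fun P hP => ?_⟩
  have h1 := h 9 (gramEntries P) 0 le_rfl
    ((norm_gramEntries_le P).trans (by nlinarith [norm_nonneg P])) (by simp)
  have h0 : detRem m 0 = 0 := by
    have : Matrix.of (0 : Fin m → Fin m → ℝ) = 0 := rfl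
    simp [detRem, this]
  rw [h0, sub_zero, sub_zero] at h1
  have h2 := (le_abs_self _).trans (abs_hsInner_le P P)
  have h3 := jac_sq_eq P
  have h4 := one_le_jac P
  have h5 : C * 9 * ‖gramEntries P‖ ≤ C * 9 * ‖P‖ ^ 2 := by
    gcongr; exact norm_gramEntries_le P
  nlinarith [le_abs_self (detRem m (gramEntries P))]

/-- With p = ‖P‖ and q = ‖Q‖, these are the products that arise when the area integrand is expanded.
Only p³q, the cubic error, and q², negligible as the variation parameter tends to 0, may remain. -/
lemma sq_add_mul_mul_le {p q : ℝ} (hp0 : 0 ≤ p) (hq0 : 0 ≤ q) (hp : p ≤ 2) (hq : q ≤ 1) :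
    (p + q) ^ 2 * (p * q) ≤ 4 * (p ^ 3 * q + q ^ 2) := by
  have h1 : p * q ≤ 2 := by nlinarith
  have h2 : p * q * q ^ 2 ≤ 2 * q ^ 2 := by gcongr
  have h3 : 0 ≤ p * q * (p - q) ^ 2 := by positivity
  have h4 : 0 ≤ p ^ 3 * q := by positivity
  have h5 : (p + q) ^ 2 * (p * q) = 2 * (p ^ 3 * q) + 2 * (p * q * q ^ 2) -
      p * q * (p - q) ^ 2 := by ring
  rw [h5]
  linarith [sq_nonneg q]

lemma sq_add_mul_sq_le {p q : ℝ} (hp0 : 0 ≤ p) (hq0 : 0 ≤ q) (hp : p ≤ 2) (hq : q ≤ 1) :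
    (p + q) ^ 2 * q ^ 2 ≤ 9 * (p ^ 3 * q + q ^ 2) := by
  have h1 : (p + q) ^ 2 ≤ 9 := by nlinarith
  have h2 : (p + q) ^ 2 * q ^ 2 ≤ 9 * q ^ 2 := by gcongr
  have h4 : 0 ≤ p ^ 3 * q := by positivity
  linarith

/-- The area integrand agrees with the Dirichlet integrand to third order. -/
lemma exists_jac_add_sub_le (m n : ℕ) : ∃ C : ℝ, 0 ≤ C ∧ ∀ P Q : E m →L[ℝ] E n, ‖P‖ ≤ 2 → ‖Q‖ ≤ 1 →
    jac (P + Q) - jac P ≤ hsInner P Q + C * (‖P‖ ^ 3 * ‖Q‖ + ‖Q‖ ^ 2) := by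
  obtain ⟨C, hC, h⟩ := exists_detRem_sub_le m 9
  obtain ⟨D, hD, h'⟩ := exists_jac_sub_one_le m n
  refine ⟨m + 27 * C + 9 * D * m, by positivity, fun P Q hP hQ => ?_⟩
  have hp0 := norm_nonneg P
  have hq0 := norm_nonneg Q
  have hPQ : ‖P + Q‖ ≤ ‖P‖ + ‖Q‖ := norm_add_le P Q
  set p := ‖P‖
  set q := ‖Q‖
  have e1 := h ((p + q) ^ 2) (gramEntries (P + Q)) (gramEntries P) (by nlinarith)
    ((norm_gramEntries_le _).trans (by gcongr)) ((norm_gramEntries_le _).trans (by gcongr; linarith))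
  have e2 : C * (p + q) ^ 2 * ‖gramEntries (P + Q) - gramEntries P‖ ≤
      C * (p + q) ^ 2 * (2 * (p * q) + q ^ 2) := by
    gcongr; exact norm_gramEntries_sub_le P Q
  have e3 := (le_abs_self _).trans (e1.trans e2)
  have j1 := one_le_jac P
  have j2 := one_le_jac (P + Q)
  have k1 := h' P (by linarith)
  have k2 : jac (P + Q) - 1 ≤ D * (p + q) ^ 2 :=
    (h' (P + Q) (by linarith)).trans (by gcongr)
  have hB := abs_hsInner_le P Q
  have hq := (le_abs_self _).trans (abs_hsInner_le Q Q)
  have s1 := jac_sq_eq P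
  have s2 := jac_sq_eq (P + Q)
  rw [hsInner_add_self] at s2
  set B := hsInner P Q
  set j := jac P
  set j' := jac (P + Q)
  -- The square root is removed by multiplying with j + j': j'² - j² = 2B + (errors), and replacing
  -- 2B by B (j + j') costs B ((j - 1) + (j' - 1)), where both brackets are quadratic in p + q.
  have main : (j' - j - B) * (j + j') ≤
      m * (q * q) + C * (p + q) ^ 2 * (2 * (p * q) + q ^ 2) +
        m * (p * q) * (2 * (D * (p + q) ^ 2)) := by
    have t1 : -B * (j - 1 + (j' - 1)) ≤ m * (p * q) * (2 * (D * (p + q) ^ 2)) := by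
      have u1 : -B * (j - 1 + (j' - 1)) ≤ |B| * (j - 1 + (j' - 1)) :=
        mul_le_mul_of_nonneg_right (neg_le_abs B) (by linarith)
      have u2 : |B| * (j - 1 + (j' - 1)) ≤ m * (p * q) * (2 * (D * (p + q) ^ 2)) := by
        refine mul_le_mul hB ?_ (by linarith) (by positivity)
        have : D * p ^ 2 ≤ D * (p + q) ^ 2 := by gcongr; linarith
        linarith
      exact u1.trans u2
    have t2 : (j' - j - B) * (j + j') = hsInner Q Q +
        (detRem m (gramEntries (P + Q)) - detRem m (gramEntries P)) + -B * (j - 1 + (j' - 1)) := by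
      linear_combination s2 - s1
    rw [t2]
    linarith
  have a1 := sq_add_mul_mul_le hp0 hq0 hP hQ
  have a2 := sq_add_mul_sq_le hp0 hq0 hP hQ
  have a3 : q * q ≤ p ^ 3 * q + q ^ 2 := by nlinarith [mul_nonneg (pow_nonneg hp0 3) hq0]
  have fin : (j' - j - B) * (j + j') ≤
      (m + 17 * C + 8 * D * m) * (p ^ 3 * q + q ^ 2) := by
    refine main.trans ?_
    calc m * (q * q) + C * (p + q) ^ 2 * (2 * (p * q) + q ^ 2) +
          m * (p * q) * (2 * (D * (p + q) ^ 2))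
        = m * (q * q) + 2 * (C * ((p + q) ^ 2 * (p * q))) + C * ((p + q) ^ 2 * q ^ 2) +
          2 * (D * m * ((p + q) ^ 2 * (p * q))) := by ring
      _ ≤ m * (p ^ 3 * q + q ^ 2) + 2 * (C * (4 * (p ^ 3 * q + q ^ 2))) +
          C * (9 * (p ^ 3 * q + q ^ 2)) + 2 * (D * m * (4 * (p ^ 3 * q + q ^ 2))) := by gcongr
      _ = _ := by ring
  have hX : 0 ≤ p ^ 3 * q + q ^ 2 := by positivity
  -- Dividing by j + j' ≥ 1 is harmless for a positive left side; a nonpositive one needs no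
  -- argument.
  have hfin : (j' - j - B) ≤ (m + 17 * C + 8 * D * m) * (p ^ 3 * q + q ^ 2) := by
    by_cases hneg : j' - j - B ≤ 0
    · exact hneg.trans (by positivity)
    · push Not at hneg
      exact (le_mul_of_one_le_right hneg.le (by linarith)).trans fin
  have : (m + 17 * C + 8 * D * m) * (p ^ 3 * q + q ^ 2) ≤
      (m + 27 * C + 9 * D * m) * (p ^ 3 * q + q ^ 2) := by
    gcongr <;> norm_num
  linarith

/-! ### The splitting of the ambient space -/

/-- The second component `y` of `(x, y)`. -/
def vert (q : Amb m n) : E n := WithLp.toLp 2 (fun j => q (Sum.inr j))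

@[simp] lemma hor_pt (x : E m) (y : E n) : hor (pt x y) = x := by ext i; simp [hor, pt]

@[simp] lemma vert_pt (x : E m) (y : E n) : vert (pt x y) = y := by ext i; simp [vert, pt]

@[simp] lemma pt_hor_vert (q : Amb m n) : pt (hor q) (vert q) = q := by
  ext i; rcases i with i | i <;> simp [pt, hor, vert]

lemma pt_add (x x' : E m) (y y' : E n) : pt (x + x') (y + y') = pt x y + pt x' y' := by
  ext i; rcases i with i | i <;> simp [pt]

lemma pt_sub (x x' : E m) (y y' : E n) : pt (x - x') (y - y') = pt x y - pt x' y' := by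
  ext i; rcases i with i | i <;> simp [pt]

lemma pt_smul (c : ℝ) (x : E m) (y : E n) : pt (c • x) (c • y) = c • pt x y := by
  ext i; rcases i with i | i <;> simp [pt]

lemma hor_add (p q : Amb m n) : hor (p + q) = hor p + hor q := by ext i; simp [hor]

lemma hor_sub (p q : Amb m n) : hor (p - q) = hor p - hor q := by ext i; simp [hor]

lemma hor_smul (c : ℝ) (p : Amb m n) : hor (c • p) = c • hor p := by ext i; simp [hor]

lemma vert_add (p q : Amb m n) : vert (p + q) = vert p + vert q := by ext i; simp [vert]

lemma vert_sub (p q : Amb m n) : vert (p - q) = vert p - vert q := by ext i; simp [vert]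

lemma vert_smul (c : ℝ) (p : Amb m n) : vert (c • p) = c • vert p := by ext i; simp [vert]

lemma inner_pt (x x' : E m) (y y' : E n) : ⟪pt x y, pt x' y'⟫ = ⟪x, x'⟫ + ⟪y, y'⟫ := by
  simp [PiLp.inner_apply, pt, Fintype.sum_sum_type]

lemma norm_sq_eq (q : Amb m n) : ‖q‖ ^ 2 = ‖hor q‖ ^ 2 + ‖vert q‖ ^ 2 := by
  conv_lhs => rw [← pt_hor_vert q]
  rw [← real_inner_self_eq_norm_sq, inner_pt, real_inner_self_eq_norm_sq,
    real_inner_self_eq_norm_sq]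

lemma norm_hor_le (q : Amb m n) : ‖hor q‖ ≤ ‖q‖ := by
  have := norm_sq_eq q
  exact le_of_sq_le_sq (by nlinarith [sq_nonneg ‖vert q‖]) (norm_nonneg _)

lemma norm_vert_le (q : Amb m n) : ‖vert q‖ ≤ ‖q‖ := by
  have := norm_sq_eq q
  exact le_of_sq_le_sq (by nlinarith [sq_nonneg ‖hor q‖]) (norm_nonneg _)

lemma norm_pt_le (x : E m) (y : E n) : ‖pt x y‖ ≤ ‖x‖ + ‖y‖ := by
  have := norm_sq_eq (pt x y)
  simp only [hor_pt, vert_pt] at this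
  nlinarith [norm_nonneg x, norm_nonneg y, norm_nonneg (pt x y)]

lemma norm_pt_zero_left (y : E n) : ‖pt (0 : E m) y‖ = ‖y‖ := by
  have := norm_sq_eq (pt (0 : E m) y)
  simp only [hor_pt, vert_pt, norm_zero] at this
  nlinarith [norm_nonneg y, norm_nonneg (pt (0 : E m) y)]

lemma lipschitzWith_hor : LipschitzWith 1 (hor : Amb m n → E m) :=
  LipschitzWith.of_dist_le_mul fun p q => by
    rw [dist_eq_norm, dist_eq_norm, ← hor_sub]; simpa using norm_hor_le (p - q)

/-- The linear map `x ↦ (x, P x)`. -/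
def graphMap (P : E m →L[ℝ] E n) : E m →L[ℝ] Amb m n :=
  LinearMap.toContinuousLinearMap
    { toFun := fun x => pt x (P x)
      map_add' := fun x y => by rw [map_add, pt_add]
      map_smul' := fun c x => by rw [map_smul, pt_smul]; rfl }

@[simp] lemma graphMap_apply (P : E m →L[ℝ] E n) (x : E m) : graphMap P x = pt x (P x) := rfl

lemma graphMap_injective (P : E m →L[ℝ] E n) : Function.Injective (graphMap P) := fun x y h => by
  simpa using congrArg hor h

/-! ### The area formula for graphs -/

lemma vol_image_le {K : ℝ≥0} {f : Amb m n → Amb m n} {s : Set (Amb m n)}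
    (hf : LipschitzOnWith K f s) : vol m n (f '' s) ≤ (K : ℝ≥0∞) ^ m * vol m n s := by
  simp only [vol, Measure.euclideanHausdorffMeasure_def, Measure.smul_apply]
  have := hf.hausdorffMeasure_image_le (d := m) (by positivity)
  rw [ENNReal.rpow_natCast] at this
  rw [ENNReal.smul_def, ENNReal.smul_def, smul_eq_mul, smul_eq_mul, mul_left_comm]
  gcongr

/-- The Lebesgue measure of the projection on the first `m` coordinates is at most the volume. -/
lemma volume_image_hor_le (s : Set (Amb m n)) : volume (hor '' s) ≤ vol m n s := by
  rw [← EuclideanSpace.euclideanHausdorffMeasure_eq_volume]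
  simp only [vol, Measure.euclideanHausdorffMeasure_def, Measure.smul_apply]
  have := (lipschitzWith_hor.lipschitzOnWith (s := s)).hausdorffMeasure_image_le (d := m)
    (by positivity)
  rw [ENNReal.smul_def, ENNReal.smul_def, smul_eq_mul, smul_eq_mul]
  gcongr
  simpa using this

lemma inner_basisVec (i j : Fin m) : ⟪basisVec i, basisVec j⟫ = if i = j then (1 : ℝ) else 0 := by
  simp only [basisVec, EuclideanSpace.inner_single_left]
  simp

lemma abs_det_eq_sqrt_det_gram (S : E m →ₗ[ℝ] E m) :
    |LinearMap.det S| = Real.sqrt (Matrix.det (Matrix.gram ℝ fun i => S (basisVec i))) := by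
  set M := LinearMap.toMatrix (EuclideanSpace.basisFun (Fin m) ℝ).toBasis
    (EuclideanSpace.basisFun (Fin m) ℝ).toBasis S with hMdef
  have hent : ∀ k i, M k i = S (basisVec i) k := fun k i => by
    simp [hMdef, LinearMap.toMatrix_apply, basisVec]
  have hM : M.transpose * M = Matrix.gram ℝ fun i => S (basisVec i) := by
    ext i j
    rw [Matrix.gram_apply, Matrix.mul_apply, PiLp.inner_apply]
    refine Finset.sum_congr rfl fun k _ => ?_
    rw [Matrix.transpose_apply, hent, hent, real_inner_eq_re_inner, mul_comm]
    rfl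
  rw [← hM, Matrix.det_mul, Matrix.det_transpose, ← sq, Real.sqrt_sq_eq_abs,
    LinearMap.det_toMatrix]

/-- The range of `g` is isometric to ℝ^m. Through that isometry `g` becomes an endomorphism whose
Gram matrix is unchanged and whose determinant, up to sign, is the root of the Gram determinant. -/
lemma vol_image_linear (g : E m →L[ℝ] Amb m n) (hg : Function.Injective g) (s : Set (E m)) :
    vol m n (g '' s) =
      ENNReal.ofReal (Real.sqrt (Matrix.det (Matrix.gram ℝ fun i => g (basisVec i)))) *
        volume s := by
  set V := LinearMap.range g.toLinearMap
  have hV : Module.finrank ℝ V = m := by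
    rw [LinearMap.finrank_range_of_inj hg]; simp
  let e : V ≃ₗᵢ[ℝ] E m := ((stdOrthonormalBasis ℝ V).reindex (finCongr hV)).repr
  let S : E m →ₗ[ℝ] E m := e.toLinearEquiv.toLinearMap ∘ₗ g.toLinearMap.rangeRestrict
  have hS : ∀ x, ((e.symm (S x) : V) : Amb m n) = g x := fun x => by simp [S]
  have hiso : Isometry fun y : E m => ((e.symm y : V) : Amb m n) :=
    V.subtypeₗᵢ.isometry.comp e.symm.isometry
  have himg : g '' s = (fun y : E m => ((e.symm y : V) : Amb m n)) '' (S '' s) := by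
    rw [image_image]; exact image_congr fun x _ => (hS x).symm
  rw [himg, vol, hiso.euclideanHausdorffMeasure_image,
    EuclideanSpace.euclideanHausdorffMeasure_eq_volume]
  have hdet : |LinearMap.det S| =
      Real.sqrt (Matrix.det (Matrix.gram ℝ fun i => g (basisVec i))) := by
    rw [abs_det_eq_sqrt_det_gram]
    congr 2
    ext i j
    rw [Matrix.gram_apply, Matrix.gram_apply, ← hS, ← hS, ← Submodule.coe_inner,
      LinearIsometryEquiv.inner_map_map]
  rw [Measure.addHaar_image_linearMap, hdet]

lemma vol_graph_linear (P : E m →L[ℝ] E n) (s : Set (E m)) :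
    vol m n (graph P s) = ENNReal.ofReal (jac P) * volume s := by
  have h := vol_image_linear (graphMap P) (graphMap_injective P) s
  have h2 : (Matrix.gram ℝ fun i => graphMap P (basisVec i)) =
      1 + Matrix.gram ℝ fun i => P (basisVec i) := by
    ext i j
    simp only [Matrix.gram_apply, graphMap_apply, inner_pt, Matrix.add_apply, Matrix.one_apply,
      inner_basisVec]
  rw [h2] at h
  exact h

/-- The map (x, w x) ↦ (x, v x) adds to each increment a vector of length at most δ |x - y|, which
is at most δ times the increment on the graph of `w`. So it is (1 + δ)-Lipschitz there. -/
lemma vol_graph_le_mul {δ : ℝ≥0} {v w : E m → E n} {s : Set (E m)}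
    (h : ∀ x ∈ s, ∀ y ∈ s, ‖(v x - v y) - (w x - w y)‖ ≤ δ * ‖x - y‖) :
    vol m n (graph v s) ≤ ((1 + δ : ℝ≥0) : ℝ≥0∞) ^ m * vol m n (graph w s) := by
  have himg : graph v s = (fun q => pt (hor q) (v (hor q))) '' graph w s := by
    simp [graph, image_image]
  rw [himg]
  refine vol_image_le (LipschitzOnWith.of_dist_le_mul ?_)
  rintro _ ⟨x, hx, rfl⟩ _ ⟨y, hy, rfl⟩
  simp only [hor_pt, dist_eq_norm]
  have h1 : pt x (v x) - pt y (v y) = (pt x (w x) - pt y (w y)) +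
      pt 0 ((v x - v y) - (w x - w y)) := by
    rw [← pt_sub, ← pt_sub, ← pt_add]; simp
  have h2 : ‖x - y‖ ≤ ‖pt x (w x) - pt y (w y)‖ := by
    simpa [hor_sub] using norm_hor_le (pt x (w x) - pt y (w y))
  calc _ ≤ ‖pt x (w x) - pt y (w y)‖ + δ * ‖x - y‖ := by
        rw [h1]
        refine (norm_add_le _ _).trans ?_
        rw [norm_pt_zero_left]
        gcongr
        exact h x hx y hy
    _ ≤ ‖pt x (w x) - pt y (w y)‖ + δ * ‖pt x (w x) - pt y (w y)‖ := by gcongr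
    _ = _ := by push_cast; ring

/-- The comparison of determinants is read off from the volumes of the two linear graphs over the
unit ball. -/
lemma jac_le_mul {δ : ℝ≥0} {P Q : E m →L[ℝ] E n} (h : ‖P - Q‖ ≤ δ) :
    ENNReal.ofReal (jac P) ≤ ((1 + δ : ℝ≥0) : ℝ≥0∞) ^ m * ENNReal.ofReal (jac Q) := by
  have h1 := vol_graph_le_mul (δ := δ) (v := P) (w := Q) (s := ball 0 1) fun x _ y _ => by
    have : (P x - P y) - (Q x - Q y) = (P - Q) (x - y) := by simp
    rw [this]
    exact ((P - Q).le_opNorm _).trans (by gcongr)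
  rw [vol_graph_linear, vol_graph_linear, ← mul_assoc] at h1
  exact (ENNReal.mul_le_mul_iff_left (measure_ball_pos volume _ one_pos).ne'
    measure_ball_lt_top.ne).1 h1

open Filter Pointwise in
/-- If a differentiable function `f` is approximated by a linear map `A` on a set `s`, up to `δ`,
then at almost every `x` in `s` one has `‖f' x - A‖ ≤ δ`. The version in Mathlib is restricted to
maps from a space to itself. -/
theorem ae_norm_fderiv_sub_le {s : Set (E m)} {f : E m → E n} {A : E m →L[ℝ] E n} {δ : ℝ≥0}
    (hf : ApproximatesLinearOn f A s δ) (hs : MeasurableSet s) (f' : E m → E m →L[ℝ] E n)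
    (hf' : ∀ x ∈ s, HasFDerivWithinAt f (f' x) s x) :
    ∀ᵐ x ∂volume.restrict s, ‖f' x - A‖₊ ≤ δ := by
  filter_upwards [Besicovitch.ae_tendsto_measure_inter_div volume s, ae_restrict_mem hs]
  intro x hx xs
  apply ContinuousLinearMap.opNorm_le_bound _ δ.2 fun z => ?_
  suffices H : ∀ ε, 0 < ε → ‖(f' x - A) z‖ ≤ (δ + ε) * (‖z‖ + ε) + ‖f' x - A‖ * ε by
    have :
      Tendsto (fun ε : ℝ => ((δ : ℝ) + ε) * (‖z‖ + ε) + ‖f' x - A‖ * ε) (𝓝[>] 0)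
        (𝓝 ((δ + 0) * (‖z‖ + 0) + ‖f' x - A‖ * 0)) :=
      Tendsto.mono_left (Continuous.tendsto (by fun_prop) 0) nhdsWithin_le_nhds
    simp only [add_zero, mul_zero] at this
    apply le_of_tendsto_of_tendsto tendsto_const_nhds this
    filter_upwards [self_mem_nhdsWithin]
    exact H
  intro ε εpos
  -- At a density point x of s, almost every direction is realized in s: at small scales s meets x +
  -- r • (closed ball about z), so increments within s determine the derivative in the direction z
  -- up to ε.
  have B₁ : ∀ᶠ r in 𝓝[>] (0 : ℝ), (s ∩ ({x} + r • closedBall z ε)).Nonempty :=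
    Measure.eventually_nonempty_inter_smul_of_density_one volume s x hx _ measurableSet_closedBall
      (measure_closedBall_pos volume z εpos).ne'
  obtain ⟨ρ, ρpos, hρ⟩ :
    ∃ ρ > 0, ball x ρ ∩ s ⊆ {y : E m | ‖f y - f x - (f' x) (y - x)‖ ≤ ε * ‖y - x‖} :=
    mem_nhdsWithin_iff.1 ((hf' x xs).isLittleO.def εpos)
  have B₂ : ∀ᶠ r in 𝓝[>] (0 : ℝ), {x} + r • closedBall z ε ⊆ ball x ρ := by
    apply nhdsWithin_le_nhds
    exact eventually_singleton_add_smul_subset isBounded_closedBall (ball_mem_nhds x ρpos)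
  obtain ⟨r, ⟨y, ⟨ys, hy⟩⟩, rρ, rpos⟩ :
    ∃ r : ℝ,
      (s ∩ ({x} + r • closedBall z ε)).Nonempty ∧ {x} + r • closedBall z ε ⊆ ball x ρ ∧ 0 < r :=
    (B₁.and (B₂.and self_mem_nhdsWithin)).exists
  obtain ⟨a, az, ya⟩ : ∃ a, a ∈ closedBall z ε ∧ y = x + r • a := by
    simp only [mem_smul_set, image_add_left, mem_preimage, singleton_add] at hy
    rcases hy with ⟨a, az, ha⟩
    exact ⟨a, az, by simp only [ha, add_neg_cancel_left]⟩
  have norm_a : ‖a‖ ≤ ‖z‖ + ε :=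
    calc
      ‖a‖ = ‖z + (a - z)‖ := by simp only [add_sub_cancel]
      _ ≤ ‖z‖ + ‖a - z‖ := norm_add_le _ _
      _ ≤ ‖z‖ + ε := by grw [mem_closedBall_iff_norm.1 az]
  have I : r * ‖(f' x - A) a‖ ≤ r * (δ + ε) * (‖z‖ + ε) :=
    calc
      r * ‖(f' x - A) a‖ = ‖(f' x - A) (r • a)‖ := by
        simp only [map_smul, norm_smul, Real.norm_eq_abs, abs_of_nonneg rpos.le]
      _ = ‖f y - f x - A (y - x) - (f y - f x - (f' x) (y - x))‖ := by
        simp only [ya, add_sub_cancel_left, sub_sub_sub_cancel_left, FunLike.coe_sub,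
          Pi.sub_apply, map_smul, smul_sub]
      _ ≤ ‖f y - f x - A (y - x)‖ + ‖f y - f x - (f' x) (y - x)‖ := norm_sub_le _ _
      _ ≤ δ * ‖y - x‖ + ε * ‖y - x‖ := (add_le_add (hf _ ys _ xs) (hρ ⟨rρ hy, ys⟩))
      _ = r * (δ + ε) * ‖a‖ := by
        simp only [ya, add_sub_cancel_left, norm_smul, Real.norm_eq_abs, abs_of_nonneg rpos.le]
        ring
      _ ≤ r * (δ + ε) * (‖z‖ + ε) := by gcongr
  calc
    ‖(f' x - A) z‖ = ‖(f' x - A) a + (f' x - A) (z - a)‖ := by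
      congr 1
      simp only [FunLike.coe_sub, map_sub, Pi.sub_apply]
      abel
    _ ≤ ‖(f' x - A) a‖ + ‖(f' x - A) (z - a)‖ := norm_add_le _ _
    _ ≤ (δ + ε) * (‖z‖ + ε) + ‖f' x - A‖ * ‖z - a‖ := by
      apply add_le_add
      · rw [mul_assoc] at I; exact (mul_le_mul_iff_right₀ rpos).1 I
      · apply ContinuousLinearMap.le_opNorm
    _ ≤ (δ + ε) * (‖z‖ + ε) + ‖f' x - A‖ * ε := by
      rw [mem_closedBall_iff_norm'] at az
      gcongr

open Filter in
-- The set splits into countably many pieces on which `v` is linear up to a δ-Lipschitz error. On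
-- each piece both sides agree with those of the linear map up to (1 + δ)^m, so they agree with each
-- other up to (1 + δ)^(2m); then δ → 0.
lemma vol_graph_of_hasFDerivWithinAt {s : Set (E m)} (hs : MeasurableSet s) {v : E m → E n}
    {v' : E m → E m →L[ℝ] E n} (hv : ∀ x ∈ s, HasFDerivWithinAt v (v' x) s x) :
    vol m n (graph v s) = ∫⁻ x in s, ENNReal.ofReal (jac (v' x)) := by
  have key : ∀ δ : ℝ≥0, 0 < δ →
      vol m n (graph v s) ≤
        ((1 + δ : ℝ≥0) : ℝ≥0∞) ^ (2 * m) * ∫⁻ x in s, ENNReal.ofReal (jac (v' x)) ∧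
      ∫⁻ x in s, ENNReal.ofReal (jac (v' x)) ≤
        ((1 + δ : ℝ≥0) : ℝ≥0∞) ^ (2 * m) * vol m n (graph v s) := by
    intro δ hδ
    obtain ⟨t, A, hdisj, hmeas, hcov, happ, -⟩ :=
      exists_partition_approximatesLinearOn_of_hasFDerivWithinAt v s v' hv (fun _ => δ)
        fun _ => hδ.ne'
    have hst : s = ⋃ k, s ∩ t k := by rw [← inter_iUnion]; exact (inter_eq_left.2 hcov).symm
    have hint : ∫⁻ x in s, ENNReal.ofReal (jac (v' x)) =
        ∑' k, ∫⁻ x in s ∩ t k, ENNReal.ofReal (jac (v' x)) := by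
      conv_lhs => rw [hst]
      exact lintegral_iUnion (fun k => hs.inter (hmeas k))
        (fun i j hij => (hdisj hij).mono inter_subset_right inter_subset_right) _
    -- The graph is cut by the cylinders over the pieces. These are measurable, so additivity does
    -- not require the graph itself to be measurable.
    have hgr : vol m n (graph v s) = ∑' k, vol m n (graph v (s ∩ t k)) := by
      have h1 : graph v s ⊆ ⋃ k, hor ⁻¹' t k := by
        rintro _ ⟨x, hx, rfl⟩
        obtain ⟨k, hk⟩ := mem_iUnion.1 (hcov hx)
        exact mem_iUnion.2 ⟨k, by simpa using hk⟩
      have h2 : ∀ k, MeasurableSet (hor ⁻¹' t k : Set (Amb m n)) := fun k =>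
        lipschitzWith_hor.continuous.measurable (hmeas k)
      have h3 : ∀ k, graph v (s ∩ t k) = hor ⁻¹' t k ∩ graph v s := fun k => by
        ext q
        constructor
        · rintro ⟨x, hx, rfl⟩
          exact ⟨by simpa using hx.2, x, hx.1, rfl⟩
        · rintro ⟨hq, x, hx, rfl⟩
          exact ⟨x, ⟨hx, by simpa using hq⟩, rfl⟩
      simp_rw [h3]
      rw [← inter_eq_right.2 h1, ← Measure.restrict_apply (MeasurableSet.iUnion h2),
        measure_iUnion (fun i j hij => (hdisj hij).preimage _) h2]
      refine tsum_congr fun k => ?_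
      rw [Measure.restrict_apply (h2 k), inter_eq_right.2 h1]
    have hae : ∀ k, ∀ᵐ x ∂volume.restrict (s ∩ t k), ‖v' x - A k‖ ≤ δ := fun k =>
      ae_norm_fderiv_sub_le (happ k) (hs.inter (hmeas k)) v' fun x hx =>
        (hv x hx.1).mono inter_subset_left
    have hlin : ∀ k, ∀ x ∈ s ∩ t k, ∀ y ∈ s ∩ t k,
        ‖(v x - v y) - (A k x - A k y)‖ ≤ δ * ‖x - y‖ := fun k x hx y hy => by
      rw [← map_sub]; exact happ k x hx y hy
    have hmono : ∀ k (c d : ℝ≥0∞), d ≠ ⊤ → (∀ᵐ x ∂volume.restrict (s ∩ t k),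
        c ≤ d * ENNReal.ofReal (jac (v' x))) →
        c * volume (s ∩ t k) ≤ d * ∫⁻ x in s ∩ t k, ENNReal.ofReal (jac (v' x)) :=
      fun k c d hd h => by
      rw [← setLIntegral_const]
      refine (lintegral_mono_ae h).trans ?_
      exact (lintegral_const_mul' _ _ hd).le
    rw [hint, hgr]
    constructor
    · rw [← ENNReal.tsum_mul_left]
      refine ENNReal.tsum_le_tsum fun k => ?_
      refine (vol_graph_le_mul (hlin k)).trans ?_
      rw [vol_graph_linear, ← mul_assoc]
      refine hmono k _ _ (ENNReal.pow_ne_top ENNReal.coe_ne_top) ?_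
      filter_upwards [hae k] with x hx
      rw [two_mul, pow_add, mul_assoc]
      gcongr
      exact jac_le_mul (by rwa [norm_sub_rev])
    · rw [← ENNReal.tsum_mul_left]
      refine ENNReal.tsum_le_tsum fun k => ?_
      calc ∫⁻ x in s ∩ t k, ENNReal.ofReal (jac (v' x))
          ≤ ∫⁻ x in s ∩ t k, ((1 + δ : ℝ≥0) : ℝ≥0∞) ^ m * ENNReal.ofReal (jac (A k)) :=
            lintegral_mono_ae ((hae k).mono fun x hx => jac_le_mul hx)
        _ = ((1 + δ : ℝ≥0) : ℝ≥0∞) ^ m * vol m n (graph (A k) (s ∩ t k)) := by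
            rw [setLIntegral_const, vol_graph_linear, mul_assoc]
        _ ≤ ((1 + δ : ℝ≥0) : ℝ≥0∞) ^ m * (((1 + δ : ℝ≥0) : ℝ≥0∞) ^ m *
              vol m n (graph v (s ∩ t k))) := by
            gcongr
            refine vol_graph_le_mul fun x hx y hy => ?_
            rw [← norm_neg, neg_sub]
            exact hlin k x hx y hy
        _ = _ := by rw [← mul_assoc, two_mul, pow_add]
  have hlim : ∀ y : ℝ≥0∞, Tendsto (fun δ : ℝ≥0 => ((1 + δ : ℝ≥0) : ℝ≥0∞) ^ (2 * m) * y)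
      (𝓝[>] 0) (𝓝 y) := fun y => by
    have h1 : Tendsto (fun δ : ℝ≥0 => (((1 + δ) ^ (2 * m) : ℝ≥0) : ℝ≥0∞)) (𝓝[>] 0) (𝓝 1) := by
      have : Continuous fun δ : ℝ≥0 => (((1 + δ) ^ (2 * m) : ℝ≥0) : ℝ≥0∞) := by fun_prop
      simpa using (this.tendsto 0).mono_left nhdsWithin_le_nhds
    have := ENNReal.Tendsto.mul_const (b := y) h1 (Or.inl one_ne_zero)
    simpa using this
  refine le_antisymm (ge_of_tendsto (hlim _) ?_) (ge_of_tendsto (hlim _) ?_)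
  · filter_upwards [self_mem_nhdsWithin] with δ hδ using (key δ hδ).1
  · filter_upwards [self_mem_nhdsWithin] with δ hδ using (key δ hδ).2

lemma jac_zero : jac (0 : E m →L[ℝ] E n) = 1 := by
  have : (Matrix.gram ℝ fun i => (0 : E m →L[ℝ] E n) (basisVec i)) = 0 := by
    ext i j; simp [Matrix.gram]
  rw [jac, this]; simp

lemma vol_graph_le_of_lipschitzOn {k : ℝ≥0} {v : E m → E n} {s : Set (E m)}
    (hv : LipschitzOnWith k v s) :
    vol m n (graph v s) ≤ ((1 + k : ℝ≥0) : ℝ≥0∞) ^ m * volume s := by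
  have h := vol_graph_le_mul (δ := k) (v := v) (w := (0 : E m →L[ℝ] E n)) (s := s)
    fun x hx y hy => by simpa using hv.norm_sub_le hx hy
  rwa [vol_graph_linear, jac_zero, ENNReal.ofReal_one, one_mul] at h

/-- The area formula for the graph of a Lipschitz map. -/
theorem vol_graph_eq_lintegral {k : ℝ≥0} {v : E m → E n} {s : Set (E m)} (hs : IsOpen s)
    (hv : LipschitzOnWith k v s) :
    vol m n (graph v s) = ∫⁻ x in s, ENNReal.ofReal (jac (fderiv ℝ v x)) := by
  set d : Set (E m) := {x | DifferentiableAt ℝ v x}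
  have hd : MeasurableSet d := measurableSet_of_differentiableAt ℝ v
  have h0 : volume (s \ d) = 0 := by
    have := hv.ae_differentiableWithinAt_of_mem (μ := volume)
    refine measure_mono_null (fun x hx => ?_) (ae_iff.1 this)
    exact fun h => hx.2 ((h hx.1).differentiableAt (hs.mem_nhds hx.1))
  have h1 := vol_graph_of_hasFDerivWithinAt (hs.measurableSet.inter hd) (v := v)
    (v' := fderiv ℝ v) fun x hx => hx.2.hasFDerivAt.hasFDerivWithinAt
  have h2 : vol m n (graph v (s \ d)) = 0 := by
    have := vol_graph_le_of_lipschitzOn (hv.mono (sdiff_subset (t := d)))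
    rw [h0, mul_zero] at this
    exact le_antisymm this bot_le
  have h3 : ∫⁻ x in s ∩ d, ENNReal.ofReal (jac (fderiv ℝ v x)) =
      ∫⁻ x in s, ENNReal.ofReal (jac (fderiv ℝ v x)) := by
    refine setLIntegral_congr (ae_eq_set.2 ⟨?_, ?_⟩)
    · rw [sdiff_eq_empty.2 inter_subset_left]; simp
    · rwa [sdiff_self_inter]
  rw [← h3, ← h1]
  refine le_antisymm ?_ (measure_mono (image_mono inter_subset_left))
  calc vol m n (graph v s) = vol m n (graph v (s ∩ d) ∪ graph v (s \ d)) := by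
        rw [graph, graph, graph, ← image_union, inter_union_sdiff]
    _ ≤ _ := (measure_union_le _ _).trans (by rw [h2, add_zero])

/-! ### Rotations -/

lemma rot_add (A : Mat m n) (p q : Amb m n) : rot A (p + q) = rot A p + rot A q := by
  ext i
  have := congrFun (A.mulVec_add (fun i => p i) (fun i => q i)) i
  exact this

lemma rot_smul (A : Mat m n) (c : ℝ) (p : Amb m n) : rot A (c • p) = c • rot A p := by
  ext i
  have := congrFun (A.mulVec_smul c (fun i => p i)) i
  exact this

lemma rot_sub (A : Mat m n) (p q : Amb m n) : rot A (p - q) = rot A p - rot A q := by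
  have : p - q = p + (-1 : ℝ) • q := by simp [sub_eq_add_neg]
  rw [this, rot_add, rot_smul]; simp [sub_eq_add_neg]

lemma rot_rot (A B : Mat m n) (q : Amb m n) : rot A (rot B q) = rot (A * B) q := by
  ext i
  simp only [rot]
  rw [← Matrix.mulVec_mulVec]

lemma rot_one (q : Amb m n) : rot 1 q = q := by
  ext i; simp [rot]

lemma rot_transpose_rot {A : Mat m n} (hA : A ∈ SO m n) (q : Amb m n) :
    rot A.transpose (rot A q) = q := by
  have h := (Matrix.mem_orthogonalGroup_iff' _ _).1 (Matrix.mem_specialOrthogonalGroup_iff.1 hA).1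
  rw [rot_rot]
  have h' : A.transpose * A = 1 := h
  rw [h', rot_one]

lemma rot_rot_transpose {A : Mat m n} (hA : A ∈ SO m n) (q : Amb m n) :
    rot A (rot A.transpose q) = q := by
  have h := (Matrix.mem_orthogonalGroup_iff _ _).1 (Matrix.mem_specialOrthogonalGroup_iff.1 hA).1
  rw [rot_rot]
  have h' : A * A.transpose = 1 := h
  rw [h', rot_one]

lemma inner_rot_left (A : Mat m n) (p q : Amb m n) : ⟪rot A p, q⟫ = ⟪p, rot A.transpose q⟫ := by
  have h := Matrix.dotProduct_mulVec (fun i => q i) A (fun i => p i)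
  rw [← Matrix.mulVec_transpose] at h
  simp only [PiLp.inner_apply, rot, real_inner_eq_re_inner]
  simpa [dotProduct, mul_comm] using h

lemma inner_rot_rot {A : Mat m n} (hA : A ∈ SO m n) (p q : Amb m n) :
    ⟪rot A p, rot A q⟫ = ⟪p, q⟫ := by
  rw [inner_rot_left, rot_transpose_rot hA]

lemma norm_rot {A : Mat m n} (hA : A ∈ SO m n) (q : Amb m n) : ‖rot A q‖ = ‖q‖ := by
  rw [@norm_eq_sqrt_real_inner _ _ _ (rot A q), inner_rot_rot hA, ← norm_eq_sqrt_real_inner]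

lemma norm_rot_transpose {A : Mat m n} (hA : A ∈ SO m n) (q : Amb m n) :
    ‖rot A.transpose q‖ = ‖q‖ := by
  rw [← norm_rot hA, rot_rot_transpose hA]

lemma isometry_rot {A : Mat m n} (hA : A ∈ SO m n) : Isometry (rot A) :=
  Isometry.of_dist_eq fun p q => by rw [dist_eq_norm, ← rot_sub, norm_rot hA, dist_eq_norm]

lemma isometry_rot_transpose {A : Mat m n} (hA : A ∈ SO m n) : Isometry (rot A.transpose) :=
  Isometry.of_dist_eq fun p q => by
    rw [dist_eq_norm, ← rot_sub, norm_rot_transpose hA, dist_eq_norm]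

lemma vol_rot_image {A : Mat m n} (hA : A ∈ SO m n) (s : Set (Amb m n)) :
    vol m n (rot A '' s) = vol m n s :=
  (isometry_rot hA).euclideanHausdorffMeasure_image s

lemma isOpen_cyl {A : Mat m n} (hA : A ∈ SO m n) (p : Amb m n) (r : ℝ) : IsOpen (cyl A p r) :=
  isOpen_lt ((lipschitzWith_hor.continuous.comp (isometry_rot hA).continuous).dist
    continuous_const) continuous_const

lemma one_mem_SO : (1 : Mat m n) ∈ SO m n := one_mem (Matrix.specialOrthogonalGroup _ ℝ)

/-- The coordinate system A = Id suffices: tilted competitors are rewritten as graphs over the unit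
ball. -/
lemma AreaMinimizing.vol_graph_le {c₀ : ℝ} (hc₀ : 0 < c₀) {u : E m → E n} {Ω : Set (E m)}
    (h : AreaMinimizing c₀ u Ω) (hu : ∃ k, LipschitzOnWith k u Ω) {w : E m → E n}
    (hw : ∃ k, LipschitzOnWith k w Ω) {S : Set (E m)} (hS : IsCompact S) (hSΩ : S ⊆ Ω)
    (hwS : ∀ x ∈ Ω, x ∉ S → w x = u x) : vol m n (graph u Ω) ≤ vol m n (graph w Ω) := by
  have hsub : closure {x ∈ Ω | w x ≠ u x} ⊆ S :=
    closure_minimal (fun x hx => by_contra fun hxS => hx.2 (hwS x hx.1 hxS)) hS.isClosed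
  refine h 1 one_mem_SO ?_ Ω u hu ?_ w hw (hS.of_isClosed_subset isClosed_closure hsub)
    (hsub.trans hSΩ)
  · simp [hsNorm, hc₀.le]
  · ext q; simp [rot_one]

/-! ### Deformations in a tilted direction -/

/-- A Lipschitz vector field along the graph over the unit ball, supported over a compact subset:
the deformed graph is the graph of a Lipschitz map. -/
lemma exists_graph_deformation {u : E m → E n} (hu : LipschitzOnWith 1 u (ball 0 1))
    {X : E m → Amb m n} {K : ℝ≥0} (hX : LipschitzOnWith K X (ball 0 1)) {M : ℝ}
    (hM : ∀ z, ‖X z‖ ≤ M) {S : Set (E m)} (hS : IsCompact S) (hSB : S ⊆ ball 0 1)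
    (hXS : ∀ z ∉ S, X z = 0) :
    ∃ t₀ > 0, ∀ t : ℝ, 0 < t → t < t₀ → ∃ (w : E m → E n) (S' : Set (E m)),
      (∃ k, LipschitzOnWith k w (ball 0 1)) ∧ IsCompact S' ∧ S' ⊆ ball 0 1 ∧
      (∀ z ∈ ball (0 : E m) 1, z ∉ S' → w z = u z) ∧
      graph w (ball 0 1) = (fun z => pt z (u z) + t • X z) '' ball 0 1 := by
  have hM0 : 0 ≤ M := (norm_nonneg _).trans (hM 0)
  obtain ⟨s, hs1, hs⟩ := exists_lt_subset_ball hS.isClosed hSB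
  -- A Lipschitz constant for X on all of ℝ^m. A point of S and a point outside the unit ball are at
  -- distance at least 1 - s, and X changes between them by at most M.
  set L : ℝ := K + M / (1 - s) with hL
  have hs0 : 0 < 1 - s := by linarith
  have hML : 0 ≤ M / (1 - s) := by positivity
  have hL0 : 0 ≤ L := by positivity
  have hout : ∀ z w, z ∈ ball (0 : E m) 1 → w ∉ ball (0 : E m) 1 → ‖X z - X w‖ ≤ L * ‖z - w‖ := by
    intro z w _ hw
    rw [hXS w fun h => hw (hSB h), sub_zero]
    by_cases hzS : z ∈ S
    · have h1 : ‖z‖ < s := by simpa using hs hzS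
      have h2 : 1 ≤ ‖w‖ := by simpa using hw
      have h3 : 1 - s ≤ ‖z - w‖ := by
        have := norm_sub_norm_le w z
        rw [norm_sub_rev] at this
        linarith
      calc ‖X z‖ ≤ M := hM z
        _ = M / (1 - s) * (1 - s) := by field_simp
        _ ≤ L * ‖z - w‖ := by
          refine mul_le_mul ?_ h3 hs0.le hL0
          have := K.2
          linarith [NNReal.coe_nonneg K]
    · rw [hXS z hzS, norm_zero]; positivity
  have hXL : ∀ z w, ‖X z - X w‖ ≤ L * ‖z - w‖ := by
    intro z w
    by_cases hz : z ∈ ball (0 : E m) 1 <;> by_cases hw : w ∈ ball (0 : E m) 1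
    · refine (hX.norm_sub_le hz hw).trans ?_
      gcongr
      linarith
    · exact hout z w hz hw
    · rw [norm_sub_rev, norm_sub_rev z w]; exact hout w z hw hz
    · rw [hXS z fun h => hz (hSB h), hXS w fun h => hw (hSB h), sub_zero, norm_zero]; positivity
  -- This threshold makes t L ≤ 1/2, so the horizontal displacement `Ψ` below is the identity plus a
  -- 1/2-Lipschitz map, hence a homeomorphism with 2-Lipschitz inverse.
  refine ⟨1 / (2 * (L + 1)), by positivity, fun t ht0 ht => ?_⟩
  have htL : t * L ≤ 1 / 2 := by
    rw [lt_div_iff₀ (by positivity)] at ht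
    nlinarith
  set Ψ : E m → E m := fun z => z + t • hor (X z) with hΨ
  have hΨsub : ∀ z w, ‖Ψ z - Ψ w - (z - w)‖ ≤ 1 / 2 * ‖z - w‖ := by
    intro z w
    have h1 : Ψ z - Ψ w - (z - w) = t • hor (X z - X w) := by
      rw [hor_sub, smul_sub]; simp only [hΨ]; abel
    rw [h1, norm_smul, Real.norm_of_nonneg ht0.le]
    calc t * ‖hor (X z - X w)‖ ≤ t * (L * ‖z - w‖) := by
          gcongr; exact (norm_hor_le _).trans (hXL z w)
      _ = t * L * ‖z - w‖ := by ring
      _ ≤ _ := by gcongr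
  have happ : ApproximatesLinearOn Ψ (ContinuousLinearEquiv.refl ℝ (E m) : E m →L[ℝ] E m) univ
      (1 / 2) := fun z _ w _ => by simpa using hΨsub z w
  have hcond : Subsingleton (E m) ∨ (1 / 2 : ℝ≥0) <
      ‖((ContinuousLinearEquiv.refl ℝ (E m)).symm : E m →L[ℝ] E m)‖₊⁻¹ := by
    rcases subsingleton_or_nontrivial (E m) with h | h
    · exact Or.inl h
    · right
      have h1 : ‖((ContinuousLinearEquiv.refl ℝ (E m)).symm : E m →L[ℝ] E m)‖₊ = 1 := by
        have : ‖ContinuousLinearMap.id ℝ (E m)‖₊ = 1 := by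
          rw [← NNReal.coe_inj]; simp
        exact this
      rw [h1, inv_one]
      exact NNReal.half_lt_self one_ne_zero
  let Φ : E m ≃ₜ E m := happ.toHomeomorph Ψ hcond
  have hΦ : ∀ z, Φ z = Ψ z := fun z => rfl
  have hfix : ∀ z ∉ S, Ψ z = z := fun z hz => by
    simp only [hΨ, hXS z hz]; simp [show hor (0 : Amb m n) = 0 by ext; simp [hor]]
  have hmaps : ∀ z, Ψ z ∈ ball (0 : E m) 1 ↔ z ∈ ball (0 : E m) 1 := by
    intro z
    constructor
    · intro h
      by_contra hz
      rw [hfix z fun h => hz (hSB h)] at h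
      exact hz h
    · intro h
      by_contra hz
      have h1 := hfix (Ψ z) fun h => hz (hSB h)
      have h2 : Ψ z = z := Φ.injective h1
      rw [h2] at hz
      exact hz h
  have hsymm : ∀ z, Ψ (Φ.symm z) = z := fun z => Φ.apply_symm_apply z
  have hsymmB : ∀ z ∈ ball (0 : E m) 1, Φ.symm z ∈ ball (0 : E m) 1 := fun z hz => by
    rw [← hmaps, hsymm]; exact hz
  have hsymmL : ∀ z w, ‖Φ.symm z - Φ.symm w‖ ≤ 2 * ‖z - w‖ := by
    intro z w
    have h1 := hΨsub (Φ.symm z) (Φ.symm w)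
    rw [hsymm, hsymm] at h1
    have h2 := norm_sub_norm_le (Φ.symm z - Φ.symm w) (z - w)
    rw [norm_sub_rev] at h1
    linarith
  -- The deformed surface has height u + t vert X above Ψ(z), so it is the graph of this height
  -- composed with Ψ⁻¹.
  refine ⟨fun z => u (Φ.symm z) + t • vert (X (Φ.symm z)), Ψ '' S, ?_, ?_, ?_, ?_, ?_⟩
  · refine ⟨Real.toNNReal (2 + t * (L * 2)), LipschitzOnWith.of_dist_le_mul fun z hz w hw => ?_⟩
    rw [Real.coe_toNNReal _ (by positivity), dist_eq_norm, dist_eq_norm]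
    have h1 := hu.norm_sub_le (hsymmB z hz) (hsymmB w hw)
    have h2 : ‖t • vert (X (Φ.symm z) - X (Φ.symm w))‖ ≤ t * (L * (2 * ‖z - w‖)) := by
      rw [norm_smul, Real.norm_of_nonneg ht0.le]
      gcongr
      refine (norm_vert_le _).trans ((hXL _ _).trans ?_)
      gcongr
      exact hsymmL z w
    have h3 : u (Φ.symm z) + t • vert (X (Φ.symm z)) - (u (Φ.symm w) + t • vert (X (Φ.symm w))) =
        (u (Φ.symm z) - u (Φ.symm w)) + t • vert (X (Φ.symm z) - X (Φ.symm w)) := by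
      rw [vert_sub, smul_sub]; abel
    rw [h3]
    refine (norm_add_le _ _).trans ?_
    have h4 := hsymmL z w
    simp only [NNReal.coe_one, one_mul] at h1
    nlinarith
  · exact hS.image Φ.continuous
  · rintro _ ⟨z, hz, rfl⟩
    exact (hmaps z).2 (hSB hz)
  · intro z _ hzS
    have h1 : Φ.symm z ∉ S := fun h => hzS ⟨_, h, hsymm z⟩
    have h2 : Φ.symm z = z := by rw [← hfix _ h1, hsymm]
    rw [h2] at h1
    simp only [h2]
    rw [hXS z h1]
    simp [show vert (0 : Amb m n) = 0 by ext; simp [vert]]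
  · have hpt : ∀ z, pt (Ψ z) (u z + t • vert (X z)) = pt z (u z) + t • X z := fun z => by
      rw [pt_add, pt_smul, pt_hor_vert]
    ext q
    constructor
    · rintro ⟨z, hz, rfl⟩
      refine ⟨Φ.symm z, hsymmB z hz, ?_⟩
      simp only
      rw [← hpt, hsymm]
    · rintro ⟨z, hz, rfl⟩
      refine ⟨Ψ z, (hmaps z).2 hz, ?_⟩
      have h1 : Φ.symm (Ψ z) = z := Φ.symm_apply_apply z
      simp only [h1, hpt]

/-- An area minimizing graph does not lose volume under small deformations in the direction normal
to a plane over which a part of it is a graph. -/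
theorem AreaMinimizing.vol_graph_tilted_le {c₀ : ℝ} (hc₀ : 0 < c₀) {u : E m → E n}
    (hu : LipschitzOnWith 1 u (ball 0 1)) (hmin : AreaMinimizing c₀ u (ball 0 1)) {A : Mat m n}
    (hA : A ∈ SO m n) {p : Amb m n} {r : ℝ} {v : E m → E n}
    {k : ℝ≥0} (hv : LipschitzOnWith k v (ball (hor (rot A p)) r))
    (hgr : rot A '' (graph u (ball 0 1) ∩ cyl A p r) = graph v (ball (hor (rot A p)) r))
    {κ : E m → E n} {K : ℝ≥0} (hκ : LipschitzWith K κ) (hcpt : HasCompactSupport κ)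
    (hsupp : tsupport κ ⊆ ball (hor (rot A p)) r) :
    ∃ t₀ > 0, ∀ t : ℝ, 0 < t → t < t₀ →
      vol m n (graph v (ball (hor (rot A p)) r)) ≤
        vol m n (graph (fun y => v y + t • κ y) (ball (hor (rot A p)) r)) := by
  classical
  set B := ball (hor (rot A p)) r
  -- The vertical field κ over the plane, carried back to the original coordinates and extended
  -- constantly along π^⊥.
  set G : Amb m n → Amb m n := fun q => rot A.transpose (pt 0 (κ (hor (rot A q)))) with hG
  have hrotG : ∀ q, rot A (G q) = pt 0 (κ (hor (rot A q))) := fun q => rot_rot_transpose hA _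
  have hGnorm : ∀ q, ‖G q‖ = ‖κ (hor (rot A q))‖ := fun q => by
    rw [hG, norm_rot_transpose hA, norm_pt_zero_left]
  have hGlip : ∀ q q', ‖G q - G q'‖ ≤ K * ‖q - q'‖ := fun q q' => by
    simp only [hG]
    rw [← rot_sub, norm_rot_transpose hA, ← pt_sub, sub_zero, norm_pt_zero_left]
    refine (hκ.norm_sub_le _ _).trans ?_
    gcongr
    rw [← hor_sub, ← rot_sub]
    exact (norm_hor_le _).trans (norm_rot hA _).le
  -- The part of the graph over the support of κ, projected on ℝ^m: a compact subset of the unit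
  -- ball, outside of which the deformation does nothing.
  set S : Set (E m) := (fun y => hor (rot A.transpose (pt y (v y)))) '' tsupport κ with hSdef
  have hvc : ContinuousOn v (tsupport κ) := hv.continuousOn.mono hsupp
  have hptc : Continuous fun z : E m × E n => pt z.1 z.2 := by
    refine LipschitzWith.continuous (K := 2) (LipschitzWith.of_dist_le_mul fun a b => ?_)
    rw [dist_eq_norm, ← pt_sub, dist_eq_norm]
    refine (norm_pt_le _ _).trans ?_
    have h1 := norm_fst_le (a - b)
    have h2 := norm_snd_le (a - b)
    simp only [Prod.fst_sub, Prod.snd_sub] at h1 h2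
    push_cast
    linarith
  have hScpt : IsCompact S := by
    refine IsCompact.image_of_continuousOn hcpt ?_
    exact (lipschitzWith_hor.continuous.comp (isometry_rot_transpose hA).continuous).comp_continuousOn
      (hptc.comp_continuousOn (continuousOn_id.prodMk hvc))
  have hback : ∀ y ∈ B, ∃ z ∈ ball (0 : E m) 1, pt z (u z) ∈ cyl A p r ∧
      rot A (pt z (u z)) = pt y (v y) := fun y hy => by
    have h1 : pt y (v y) ∈ graph v B := ⟨y, hy, rfl⟩
    rw [← hgr] at h1
    obtain ⟨_, ⟨⟨z, hz, rfl⟩, hc⟩, hq⟩ := h1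
    exact ⟨z, hz, hc, hq⟩
  have hforth : ∀ z ∈ ball (0 : E m) 1, hor (rot A (pt z (u z))) ∈ B →
      rot A (pt z (u z)) = pt (hor (rot A (pt z (u z)))) (v (hor (rot A (pt z (u z))))) := by
    intro z hz hB
    have h1 : rot A (pt z (u z)) ∈ graph v B := by
      rw [← hgr]; exact ⟨_, ⟨⟨z, hz, rfl⟩, hB⟩, rfl⟩
    obtain ⟨y, _, hy⟩ := h1
    simp only [← hy, hor_pt]
  have hSB : S ⊆ ball 0 1 := by
    rintro _ ⟨y, hy, rfl⟩
    obtain ⟨z, hz, -, hzy⟩ := hback y (hsupp hy)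
    simp only [← hzy, rot_transpose_rot hA, hor_pt]
    exact hz
  have hzero : ∀ z ∈ ball (0 : E m) 1, z ∉ S → G (pt z (u z)) = 0 := by
    intro z hz hzS
    rw [← norm_eq_zero, hGnorm, norm_eq_zero]
    by_contra hne
    have h1 : hor (rot A (pt z (u z))) ∈ tsupport κ := subset_tsupport _ hne
    refine hzS ⟨_, h1, ?_⟩
    simp only
    rw [← hforth z hz (hsupp h1), rot_transpose_rot hA, hor_pt]
  set X : E m → Amb m n := fun z => if z ∈ ball (0 : E m) 1 then G (pt z (u z)) else 0 with hX
  have hXin : ∀ z ∈ ball (0 : E m) 1, X z = G (pt z (u z)) := fun z hz => if_pos hz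
  obtain ⟨M, hM⟩ := hcpt.exists_bound_of_continuous hκ.continuous
  have hXlip : LipschitzOnWith (K * 2) X (ball 0 1) := LipschitzOnWith.of_dist_le_mul
    fun z hz w hw => by
      rw [dist_eq_norm, hXin z hz, hXin w hw, dist_eq_norm]
      refine (hGlip _ _).trans ?_
      rw [NNReal.coe_mul, mul_assoc]
      gcongr
      rw [← pt_sub]
      refine (norm_pt_le _ _).trans ?_
      have := hu.norm_sub_le hz hw
      simp only [NNReal.coe_one, one_mul] at this
      push_cast
      linarith
  have hXM : ∀ z, ‖X z‖ ≤ M := fun z => by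
    by_cases hz : z ∈ ball (0 : E m) 1
    · rw [hXin z hz, hGnorm]; exact hM _
    · simp only [hX, if_neg hz, norm_zero]; exact (norm_nonneg _).trans (hM 0)
  have hXS : ∀ z ∉ S, X z = 0 := fun z hzS => by
    by_cases hz : z ∈ ball (0 : E m) 1
    · rw [hXin z hz]; exact hzero z hz hzS
    · exact if_neg hz
  obtain ⟨t₀, ht₀, H⟩ := exists_graph_deformation hu hXlip hXM hScpt hSB hXS
  refine ⟨t₀, ht₀, fun t ht0 ht => ?_⟩
  obtain ⟨w, S', hwlip, hS', hS'B, hwS', hgw⟩ := H t ht0 ht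
  have hle := hmin.vol_graph_le hc₀ ⟨1, hu⟩ hwlip hS' hS'B hwS'
  have hrotP : ∀ z ∈ ball (0 : E m) 1, rot A (pt z (u z) + t • X z) =
      rot A (pt z (u z)) + t • pt 0 (κ (hor (rot A (pt z (u z))))) := fun z hz => by
    rw [rot_add, rot_smul, hXin z hz, hrotG]
  have hhorP : ∀ z ∈ ball (0 : E m) 1, hor (rot A (pt z (u z) + t • X z)) =
      hor (rot A (pt z (u z))) := fun z hz => by
    rw [hrotP z hz, hor_add, hor_smul, hor_pt, smul_zero, add_zero]
  have hcylP : ∀ z ∈ ball (0 : E m) 1, (pt z (u z) + t • X z ∈ cyl A p r ↔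
      pt z (u z) ∈ cyl A p r) := fun z hz => by
    simp only [cyl, mem_ofPred_eq, hhorP z hz]
  have hdiff : graph w (ball 0 1) \ cyl A p r = graph u (ball 0 1) \ cyl A p r := by
    have hP : ∀ z ∈ ball (0 : E m) 1, pt z (u z) ∉ cyl A p r →
        pt z (u z) + t • X z = pt z (u z) := fun z hz hc => by
      have : κ (hor (rot A (pt z (u z)))) = 0 :=
        image_eq_zero_of_notMem_tsupport fun h => hc (hsupp h)
      have h0 : G (pt z (u z)) = 0 := by rw [← norm_eq_zero, hGnorm, this, norm_zero]
      rw [hXin z hz, h0, smul_zero, add_zero]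
    rw [hgw]
    ext q
    constructor
    · rintro ⟨⟨z, hz, rfl⟩, hc⟩
      have hc' : pt z (u z) ∉ cyl A p r := fun h => hc ((hcylP z hz).2 h)
      simp only [hP z hz hc']
      exact ⟨⟨z, hz, rfl⟩, hc'⟩
    · rintro ⟨⟨z, hz, rfl⟩, hc⟩
      exact ⟨⟨z, hz, hP z hz hc⟩, hc⟩
  have hinter : rot A '' (graph w (ball 0 1) ∩ cyl A p r) = graph (fun y => v y + t • κ y) B := by
    have hpt : ∀ y, pt y (v y + t • κ y) = pt y (v y) + t • pt 0 (κ y) := fun y => by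
      rw [← pt_smul, smul_zero, ← pt_add, add_zero]
    rw [hgw]
    ext q
    constructor
    · rintro ⟨_, ⟨⟨z, hz, rfl⟩, hc⟩, rfl⟩
      have hc' : hor (rot A (pt z (u z))) ∈ B := (hcylP z hz).1 hc
      refine ⟨_, hc', ?_⟩
      simp only
      rw [hrotP z hz, hpt, ← hforth z hz hc']
    · rintro ⟨y, hy, rfl⟩
      obtain ⟨z, hz, hc, hzy⟩ := hback y hy
      refine ⟨_, ⟨⟨z, hz, rfl⟩, (hcylP z hz).2 hc⟩, ?_⟩
      rw [hrotP z hz, hzy, hor_pt]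
      exact (hpt y).symm
  have hmeas := (isOpen_cyl hA p r).measurableSet
  -- The graphs of u and w coincide outside the cylinder, and this common part has finite volume.
  -- Cancelling it leaves the parts inside, which the rotation turns into the graphs of v and v + t
  -- κ.
  rw [← measure_inter_add_sdiff (graph u (ball 0 1)) hmeas,
    ← measure_inter_add_sdiff (graph w (ball 0 1)) hmeas, hdiff,
    ← vol_rot_image hA (graph u (ball 0 1) ∩ cyl A p r), hgr,
    ← vol_rot_image hA (graph w (ball 0 1) ∩ cyl A p r), hinter] at hle
  refine (ENNReal.add_le_add_iff_right (ne_top_of_le_ne_top ?_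
    (measure_mono (sdiff_subset (s := graph u (ball 0 1)) (t := cyl A p r))))).1 hle
  refine ne_top_of_le_ne_top ?_ (vol_graph_le_of_lipschitzOn hu)
  exact ENNReal.mul_ne_top (ENNReal.pow_ne_top ENNReal.coe_ne_top) measure_ball_lt_top.ne

/-! ### The first variation -/

lemma hsInner_smul_right (P Q : E m →L[ℝ] E n) (t : ℝ) : hsInner P (t • Q) = t * hsInner P Q := by
  simp [hsInner, inner_smul_right, Finset.mul_sum]

lemma measurable_hsInner {f g : E m → E m →L[ℝ] E n} (hf : Measurable f) (hg : Measurable g) :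
    Measurable fun y => hsInner (f y) (g y) := by
  unfold hsInner
  exact Finset.measurable_sum _ fun i _ =>
    (hf.apply_continuousLinearMap (basisVec i)).inner (hg.apply_continuousLinearMap (basisVec i))

lemma integrableOn_of_bound {B : Set (E m)} (hB : volume B ≠ ⊤) (hBm : MeasurableSet B)
    {g : E m → ℝ} (hg : Measurable g) {M : ℝ} (hM : ∀ y ∈ B, |g y| ≤ M) : IntegrableOn g B :=
  Measure.integrableOn_of_bounded hB hg.aestronglyMeasurable
    ((ae_restrict_iff' hBm).2 (Filter.Eventually.of_forall hM))

lemma norm_fderiv_le_of_lipschitzOn_isOpen {k : ℝ≥0} {v : E m → E n} {B : Set (E m)}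
    (hB : IsOpen B) (hv : LipschitzOnWith k v B) {y : E m} (hy : y ∈ B) : ‖fderiv ℝ v y‖ ≤ k :=
  norm_fderiv_le_of_lipschitzOn ℝ (hB.mem_nhds hy) hv

lemma exists_abs_jac_le (m n : ℕ) (R : ℝ) : ∃ M : ℝ, ∀ P : E m →L[ℝ] E n, ‖P‖ ≤ R →
    |jac P| ≤ M := by
  obtain ⟨M, hM⟩ := (isCompact_closedBall (0 : E m →L[ℝ] E n) R).exists_bound_of_continuousOn
    continuous_jac.continuousOn
  exact ⟨M, fun P hP => hM P (by simpa using hP)⟩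

/-- The constant of `exists_jac_add_sub_le`. -/
def variationConst (m n : ℕ) : ℝ := (exists_jac_add_sub_le m n).choose

lemma variationConst_nonneg (m n : ℕ) : 0 ≤ variationConst m n :=
  (exists_jac_add_sub_le m n).choose_spec.1

lemma jac_add_sub_le {P Q : E m →L[ℝ] E n} (hP : ‖P‖ ≤ 2) (hQ : ‖Q‖ ≤ 1) :
    jac (P + Q) - jac P ≤ hsInner P Q + variationConst m n * (‖P‖ ^ 3 * ‖Q‖ + ‖Q‖ ^ 2) :=
  (exists_jac_add_sub_le m n).choose_spec.2 P Q hP hQ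

/-- The graph of `v` over `B` does not lose volume under small smooth vertical deformations. -/
def VerticallyMinimizing (v : E m → E n) (B : Set (E m)) : Prop :=
  ∀ κ : E m → E n, ContDiff ℝ 1 κ → HasCompactSupport κ → tsupport κ ⊆ B →
    ∃ t₀ > 0, ∀ t : ℝ, 0 < t → t < t₀ →
      vol m n (graph v B) ≤ vol m n (graph (fun y => v y + t • κ y) B)

lemma integral_jac_le_of_vol_le {B : Set (E m)} (hB : IsOpen B) (hBf : volume B ≠ ⊤)
    {v w : E m → E n} {k l : ℝ≥0} (hv : LipschitzOnWith k v B) (hw : LipschitzOnWith l w B)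
    (h : vol m n (graph v B) ≤ vol m n (graph w B)) :
    ∫ y in B, jac (fderiv ℝ v y) ≤ ∫ y in B, jac (fderiv ℝ w y) := by
  have key : ∀ {k : ℝ≥0} {v : E m → E n}, LipschitzOnWith k v B →
      IntegrableOn (fun y => jac (fderiv ℝ v y)) B := fun {k v} hv => by
    obtain ⟨M, hM⟩ := exists_abs_jac_le m n k
    exact integrableOn_of_bound hBf hB.measurableSet
      (continuous_jac.measurable.comp (measurable_fderiv ℝ v))
      fun y hy => hM _ (norm_fderiv_le_of_lipschitzOn_isOpen hB hv hy)
  have hpos : ∀ v : E m → E n, 0 ≤ᵐ[volume.restrict B] fun y => jac (fderiv ℝ v y) := fun v =>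
    Filter.Eventually.of_forall fun y => zero_le_one.trans (one_le_jac _)
  rw [vol_graph_eq_lintegral hB hv, vol_graph_eq_lintegral hB hw,
    ← ofReal_integral_eq_lintegral_ofReal (key hv) (hpos v),
    ← ofReal_integral_eq_lintegral_ofReal (key hw) (hpos w)] at h
  exact (ENNReal.ofReal_le_ofReal_iff (integral_nonneg_of_ae (hpos w))).1 h

/-- Minimality gives 0 ≤ ∫ (jac(Dv + t Dκ) - jac(Dv)), and the expansion of the integrand bounds
this by t times the linear and cubic terms plus O(t²). Dividing by t and letting t → 0 leaves one
half of the first variation estimate. -/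
lemma VerticallyMinimizing.neg_integral_hsInner_le {B : Set (E m)} (hB : IsOpen B)
    (hBf : volume B ≠ ⊤) {v : E m → E n} (hv : LipschitzOnWith 2 v B)
    (hmin : VerticallyMinimizing v B) {κ : E m → E n} (hκ : ContDiff ℝ 1 κ)
    (hcpt : HasCompactSupport κ) (hsupp : tsupport κ ⊆ B) :
    -∫ y in B, hsInner (fderiv ℝ v y) (fderiv ℝ κ y) ≤
      variationConst m n * ∫ y in B, ‖fderiv ℝ v y‖ ^ 3 * ‖fderiv ℝ κ y‖ := by
  obtain ⟨K, hK⟩ := hκ.lipschitzWith_of_hasCompactSupport hcpt one_ne_zero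
  have hDκ : ∀ y, ‖fderiv ℝ κ y‖ ≤ K := fun y => norm_fderiv_le_of_lipschitz ℝ hK
  have hDv : ∀ y ∈ B, ‖fderiv ℝ v y‖ ≤ 2 := fun y hy => by
    simpa using norm_fderiv_le_of_lipschitzOn_isOpen hB hv hy
  have hmv : Measurable (fderiv ℝ v) := measurable_fderiv ℝ v
  have hmκ : Measurable (fderiv ℝ κ) := measurable_fderiv ℝ κ
  set C := variationConst m n
  have hC : 0 ≤ C := variationConst_nonneg m n
  have i1 : IntegrableOn (fun y => hsInner (fderiv ℝ v y) (fderiv ℝ κ y)) B :=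
    integrableOn_of_bound hBf hB.measurableSet (measurable_hsInner hmv hmκ)
      (M := m * (2 * K)) fun y hy => (abs_hsInner_le _ _).trans (by
        gcongr
        exacts [hDv y hy, hDκ y])
  have i2 : IntegrableOn (fun y => ‖fderiv ℝ v y‖ ^ 3 * ‖fderiv ℝ κ y‖) B :=
    integrableOn_of_bound hBf hB.measurableSet ((hmv.norm.pow_const 3).mul hmκ.norm)
      (M := 2 ^ 3 * K) fun y hy => by
        rw [abs_of_nonneg (by positivity)]
        gcongr
        exacts [hDv y hy, hDκ y]
  have i3 : IntegrableOn (fun y => ‖fderiv ℝ κ y‖ ^ 2) B :=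
    integrableOn_of_bound hBf hB.measurableSet (hmκ.norm.pow_const 2)
      (M := K ^ 2) fun y hy => by
        rw [abs_of_nonneg (by positivity)]
        gcongr
        exact hDκ y
  set I := ∫ y in B, hsInner (fderiv ℝ v y) (fderiv ℝ κ y)
  set J := ∫ y in B, ‖fderiv ℝ v y‖ ^ 3 * ‖fderiv ℝ κ y‖
  set Q := ∫ y in B, ‖fderiv ℝ κ y‖ ^ 2
  have hQ : 0 ≤ Q := integral_nonneg fun y => by positivity
  obtain ⟨t₀, ht₀, hvol⟩ := hmin κ hκ hcpt hsupp
  -- The bound t < 1/(K + 1) ensures ‖t Dκ‖ ≤ 1, as the expansion of the integrand requires.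
  have key : ∀ t : ℝ, 0 < t → t < min t₀ (1 / (K + 1)) → 0 ≤ I + C * J + t * (C * Q) := by
    intro t ht0 ht
    have htK : t * K ≤ 1 := by
      have h1 := ht.trans_le (min_le_right _ _)
      rw [lt_div_iff₀ (by positivity)] at h1
      nlinarith
    have hlip : LipschitzOnWith (2 + Real.toNNReal t * K) (fun y => v y + t • κ y) B :=
      LipschitzOnWith.of_dist_le_mul fun y hy z hz => by
        have h1 := hv.norm_sub_le hy hz
        have h2 := hK.norm_sub_le y z
        rw [dist_eq_norm, dist_eq_norm, add_sub_add_comm, ← smul_sub]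
        refine (norm_add_le _ _).trans ?_
        rw [norm_smul, Real.norm_of_nonneg ht0.le]
        rw [NNReal.coe_add, NNReal.coe_mul, Real.coe_toNNReal t ht0.le, add_mul, mul_assoc]
        gcongr
    have h1 := integral_jac_le_of_vol_le hB hBf hv hlip
      (hvol t ht0 (ht.trans_le (min_le_left _ _)))
    have hae : ∀ᵐ y ∂volume.restrict B, fderiv ℝ (fun y => v y + t • κ y) y =
        fderiv ℝ v y + t • fderiv ℝ κ y := by
      filter_upwards [hv.ae_differentiableWithinAt hB.measurableSet,
        ae_restrict_mem hB.measurableSet] with y hy hyB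
      have hd := hy.differentiableAt (hB.mem_nhds hyB)
      have hdκ : DifferentiableAt ℝ κ y := hκ.differentiable one_ne_zero y
      rw [fderiv_fun_add hd (hdκ.fun_const_smul t), fderiv_fun_const_smul hdκ]
    rw [integral_congr_ae (hae.mono fun y hy => congrArg jac hy)] at h1
    have hmt : Measurable fun y => fderiv ℝ v y + t • fderiv ℝ κ y := hmv.add (hmκ.const_smul t)
    obtain ⟨M, hM⟩ := exists_abs_jac_le m n 3
    have j1 : IntegrableOn (fun y => jac (fderiv ℝ v y)) B :=
      integrableOn_of_bound hBf hB.measurableSet (continuous_jac.measurable.comp hmv)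
        fun y hy => hM _ ((hDv y hy).trans (by norm_num))
    have hsmall : ∀ y, ‖t • fderiv ℝ κ y‖ ≤ 1 := fun y => by
      rw [norm_smul, Real.norm_of_nonneg ht0.le]
      exact (mul_le_mul_of_nonneg_left (hDκ y) ht0.le).trans htK
    have j2 : IntegrableOn (fun y => jac (fderiv ℝ v y + t • fderiv ℝ κ y)) B :=
      integrableOn_of_bound hBf hB.measurableSet (continuous_jac.measurable.comp hmt)
        fun y hy => hM _ ((norm_add_le _ _).trans (by linarith [hDv y hy, hsmall y]))
    have h2 : 0 ≤ ∫ y in B, (jac (fderiv ℝ v y + t • fderiv ℝ κ y) - jac (fderiv ℝ v y)) := by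
      rw [integral_sub j2 j1]; linarith
    have i4 : IntegrableOn (fun y => t * hsInner (fderiv ℝ v y) (fderiv ℝ κ y) +
        (t * C) * (‖fderiv ℝ v y‖ ^ 3 * ‖fderiv ℝ κ y‖)) B := (i1.const_mul _).add (i2.const_mul _)
    have h3 : ∫ y in B, (jac (fderiv ℝ v y + t • fderiv ℝ κ y) - jac (fderiv ℝ v y)) ≤
        ∫ y in B, (t * hsInner (fderiv ℝ v y) (fderiv ℝ κ y) +
          (t * C) * (‖fderiv ℝ v y‖ ^ 3 * ‖fderiv ℝ κ y‖) + (t ^ 2 * C) * ‖fderiv ℝ κ y‖ ^ 2) := by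
      refine setIntegral_mono_on (j2.sub j1)
        (i4.add (i3.const_mul _)) hB.measurableSet
        fun y hy => ?_
      refine (jac_add_sub_le (hDv y hy) (hsmall y)).trans (le_of_eq ?_)
      rw [hsInner_smul_right, norm_smul, Real.norm_of_nonneg ht0.le]
      ring
    rw [integral_add i4 (i3.const_mul _),
      integral_add (i1.const_mul _) (i2.const_mul _), integral_const_mul, integral_const_mul,
      integral_const_mul] at h3
    have h4 : 0 ≤ t * (I + C * J + t * (C * Q)) := by
      calc (0 : ℝ) ≤ _ := h2.trans h3
        _ = _ := by ring
    exact nonneg_of_mul_nonneg_right h4 ht0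
  have hlim : 0 ≤ I + C * J := by
    have hc : Filter.Tendsto (fun t : ℝ => I + C * J + t * (C * Q)) (𝓝[>] 0) (𝓝 (I + C * J)) := by
      have : Continuous fun t : ℝ => I + C * J + t * (C * Q) := by fun_prop
      simpa using (this.tendsto 0).mono_left nhdsWithin_le_nhds
    refine ge_of_tendsto hc ?_
    have hpos : (0 : ℝ) < min t₀ (1 / (K + 1)) := lt_min ht₀ (by positivity)
    filter_upwards [Ioo_mem_nhdsGT hpos] with t ht using key t ht.1 ht.2
  linarith

/-- The first variation formula: `v` is almost harmonic, up to a cubic error in its gradient. -/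
theorem VerticallyMinimizing.abs_integral_hsInner_le {B : Set (E m)} (hB : IsOpen B)
    (hBf : volume B ≠ ⊤) {v : E m → E n} (hv : LipschitzOnWith 2 v B)
    (hmin : VerticallyMinimizing v B) {κ : E m → E n} (hκ : ContDiff ℝ 1 κ)
    (hcpt : HasCompactSupport κ) (hsupp : tsupport κ ⊆ B) :
    |∫ y in B, hsInner (fderiv ℝ v y) (fderiv ℝ κ y)| ≤
      variationConst m n * ∫ y in B, ‖fderiv ℝ v y‖ ^ 3 * ‖fderiv ℝ κ y‖ := by
  have h1 := hmin.neg_integral_hsInner_le hB hBf hv hκ hcpt hsupp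
  -- Competitors are available only for t > 0; the opposite inequality comes from -κ.
  have h2 := hmin.neg_integral_hsInner_le hB hBf hv (κ := -κ) hκ.neg hcpt.neg
    (by rwa [tsupport, Function.support_neg])
  have h3 : ∀ y, fderiv ℝ (-κ) y = (-1 : ℝ) • fderiv ℝ κ y := fun y => by
    rw [fderiv_neg]; exact (neg_one_smul ℝ _).symm
  have h4 : ∀ y, ‖(-1 : ℝ) • fderiv ℝ κ y‖ = ‖fderiv ℝ κ y‖ := fun y => by
    rw [norm_smul]; simp
  simp_rw [h3, hsInner_smul_right, integral_const_mul, h4] at h2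
  rw [abs_le]
  constructor <;> linarith

lemma AreaMinimizing.verticallyMinimizing {c₀ : ℝ} (hc₀ : 0 < c₀) {u : E m → E n}
    (hu : LipschitzOnWith 1 u (ball 0 1)) (hmin : AreaMinimizing c₀ u (ball 0 1)) {A : Mat m n}
    (hA : A ∈ SO m n) {p : Amb m n} {r : ℝ} {v : E m → E n}
    {k : ℝ≥0} (hv : LipschitzOnWith k v (ball (hor (rot A p)) r))
    (hgr : rot A '' (graph u (ball 0 1) ∩ cyl A p r) = graph v (ball (hor (rot A p)) r)) :
    VerticallyMinimizing v (ball (hor (rot A p)) r) := fun κ hκ hcpt hsupp => by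
  obtain ⟨K, hK⟩ := hκ.lipschitzWith_of_hasCompactSupport hcpt one_ne_zero
  exact hmin.vol_graph_tilted_le hc₀ hu hA hv hgr hK hcpt hsupp

/-! ### The excess controls the Dirichlet energy -/

/-- `hor` as a continuous linear map. -/
def horL (m n : ℕ) : Amb m n →L[ℝ] E m :=
  LinearMap.toContinuousLinearMap
    { toFun := hor, map_add' := hor_add, map_smul' := hor_smul }

/-- `vert` as a continuous linear map. -/
def vertL (m n : ℕ) : Amb m n →L[ℝ] E n :=
  LinearMap.toContinuousLinearMap
    { toFun := vert, map_add' := vert_add, map_smul' := vert_smul }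

/-- `rot A` as a continuous linear map. -/
def rotL (A : Mat m n) : Amb m n →L[ℝ] Amb m n :=
  LinearMap.toContinuousLinearMap
    { toFun := rot A, map_add' := rot_add A, map_smul' := rot_smul A }

/-- `pt` as a continuous linear map. -/
def ptL (m n : ℕ) : E m × E n →L[ℝ] Amb m n :=
  LinearMap.toContinuousLinearMap
    { toFun := fun z => pt z.1 z.2
      map_add' := fun _ _ => pt_add _ _ _ _
      map_smul' := fun _ _ => pt_smul _ _ _ }

@[simp] lemma horL_apply (q : Amb m n) : horL m n q = hor q := rfl
@[simp] lemma vertL_apply (q : Amb m n) : vertL m n q = vert q := rfl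
@[simp] lemma rotL_apply (A : Mat m n) (q : Amb m n) : rotL A q = rot A q := rfl
@[simp] lemma ptL_apply (z : E m × E n) : ptL m n z = pt z.1 z.2 := rfl

/-! ### Excess in terms of determinants -/

lemma det_gram_comp (G : E m →L[ℝ] Amb m n) (L : E m →L[ℝ] E m) :
    (Matrix.gram ℝ fun i => G (L (basisVec i))).det =
      (Matrix.of fun i j => L (basisVec j) i).det ^ 2 *
        (Matrix.gram ℝ fun i => G (basisVec i)).det := by
  set M : Matrix (Fin m) (Fin m) ℝ := Matrix.of fun i j => L (basisVec j) i with hM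
  have hG : ∀ j, G (L (basisVec j)) = ∑ k, M k j • G (basisVec k) := fun j => by
    conv_lhs => rw [← sum_smul_basisVec (L (basisVec j)), map_sum]
    simp [hM]
  have h : (Matrix.gram ℝ fun i => G (L (basisVec i))) =
      M.transpose * (Matrix.gram ℝ fun i => G (basisVec i)) * M := by
    ext i j
    rw [Matrix.gram_apply, hG, hG, sum_inner]
    simp only [inner_sum, real_inner_smul_left, real_inner_smul_right, Matrix.mul_apply,
      Matrix.transpose_apply, Matrix.gram_apply, Finset.sum_mul]
    rw [Finset.sum_comm]
    refine Finset.sum_congr rfl fun k _ => Finset.sum_congr rfl fun l _ => ?_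
    ring
  rw [h, Matrix.det_mul, Matrix.det_mul, Matrix.det_transpose]
  ring

lemma gram_graphMap (P : E m →L[ℝ] E n) :
    (Matrix.gram ℝ fun i => graphMap P (basisVec i)) =
      1 + Matrix.gram ℝ fun i => P (basisVec i) := by
  ext i j
  simp only [Matrix.gram_apply, graphMap_apply, inner_pt, Matrix.add_apply, Matrix.one_apply,
    inner_basisVec]

lemma norm_ιMulti_graphMap (P : E m →L[ℝ] E n) :
    ‖exteriorPower.ιMulti ℝ m fun j => pt (basisVec j) (P (basisVec j))‖ = jac P := by
  rw [norm_eq_sqrt_real_inner, exteriorPower.inner_ιMulti_self, jac, ← gram_graphMap]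
  rfl

lemma norm_ιMulti_plane {A : Mat m n} (hA : A ∈ SO m n) :
    ‖exteriorPower.ιMulti ℝ m fun j => rot A.transpose (pt (basisVec j) (0 : E n))‖ = 1 := by
  rw [norm_eq_sqrt_real_inner, exteriorPower.inner_ιMulti_self]
  have : (Matrix.gram ℝ fun j => rot A.transpose (pt (basisVec j) (0 : E n))) = 1 := by
    ext i j
    rw [Matrix.gram_apply, ← inner_rot_rot hA, rot_rot_transpose hA, rot_rot_transpose hA,
      inner_pt, inner_basisVec, inner_zero_left, add_zero, Matrix.one_apply]
  rw [this, Matrix.det_one, Real.sqrt_one]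

/-- The determinant of the projection of the graph of the linear map `P` on the plane of `A`. -/
def projDet (A : Mat m n) (P : E m →L[ℝ] E n) : ℝ :=
  (Matrix.of fun i j => hor (rot A (pt (basisVec j) (P (basisVec j)))) i).det

/-- Both m-vectors have norm one, so only their inner product matters. It is a determinant of inner
products, namely that of the projection of the tangent frame on the plane, divided by the norm of
the unnormalized tangent m-vector. -/
lemma norm_tangentMVec_sub_sq {A : Mat m n} (hA : A ∈ SO m n) (u : E m → E n) (x : E m) :
    ‖tangentMVec u x - planeMVec A‖ ^ 2 =
      2 - 2 * (projDet A (fderiv ℝ u x) / jac (fderiv ℝ u x)) := by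
  set P := fderiv ℝ u x
  have hj : 0 < jac P := zero_lt_one.trans_le (one_le_jac P)
  have h1 : ‖tangentMVec u x‖ = 1 := by
    rw [tangentMVec, unitMVec, norm_smul, norm_inv, norm_norm]
    refine inv_mul_cancel₀ ?_
    rw [norm_ιMulti_graphMap P]
    exact hj.ne'
  have h2 : ‖planeMVec A‖ = 1 := by
    rw [planeMVec, unitMVec, norm_ιMulti_plane hA, inv_one, one_smul, norm_ιMulti_plane hA]
  have h3 : ⟪tangentMVec u x, planeMVec A⟫ = projDet A P / jac P := by
    rw [tangentMVec, planeMVec, unitMVec, unitMVec, norm_ιMulti_plane hA, inv_one, one_smul,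
      norm_ιMulti_graphMap P]
    refine (real_inner_smul_left (F := ⋀[ℝ]^m (Amb m n)) _ _ _).trans ?_
    rw [exteriorPower.inner_ιMulti_ιMulti, projDet, div_eq_inv_mul]
    congr 2
    ext i j
    simp only [Matrix.of_apply]
    rw [real_inner_comm, inner_rot_left, Matrix.transpose_transpose]
    conv_lhs => rw [← pt_hor_vert (rot A (pt (basisVec j) (P (basisVec j))))]
    rw [inner_pt, inner_zero_left, add_zero]
    simp [basisVec, EuclideanSpace.inner_single_left]
  rw [norm_sub_sq_real, h1, h2, h3]
  ring

/-- The projection L of the first graph on the plane satisfies graphMap Q ∘ L = rot A ∘ graphMap P.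
Comparing Gram determinants gives jac(P)² = (det L)² jac(Q)². Only an upper bound for det L is
needed, so its sign, that is the orientation, plays no role. -/
lemma projDet_eq {A : Mat m n} {P Q : E m →L[ℝ] E n}
    (h : ∀ ξ, vert (rot A (pt ξ (P ξ))) = Q (hor (rot A (pt ξ (P ξ)))))
    (hA : A ∈ SO m n) : projDet A P / jac P ≤ 1 / jac Q := by
  set L : E m →L[ℝ] E m := (horL m n).comp ((rotL A).comp (graphMap P))
  have hL : ∀ ξ, graphMap Q (L ξ) = rot A (pt ξ (P ξ)) := fun ξ => by
    conv_rhs => rw [← pt_hor_vert (rot A (pt ξ (P ξ))), h ξ]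
    rfl
  have h1 := det_gram_comp (graphMap Q) L
  have h2 : (Matrix.gram ℝ fun i => graphMap Q (L (basisVec i))) =
      Matrix.gram ℝ fun i => graphMap P (basisVec i) := by
    ext i j
    rw [Matrix.gram_apply, Matrix.gram_apply, hL, hL, inner_rot_rot hA]
    rfl
  have h3 : (Matrix.of fun i j => L (basisVec j) i).det = projDet A P := rfl
  rw [h2, gram_graphMap, gram_graphMap, ← jac_sq, ← jac_sq, h3] at h1
  have hP : 0 < jac P := zero_lt_one.trans_le (one_le_jac P)
  have hQ : 0 < jac Q := zero_lt_one.trans_le (one_le_jac Q)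
  rw [div_le_div_iff₀ hP hQ, one_mul]
  exact le_of_sq_le_sq (by rw [mul_pow]; exact h1.ge) hP.le

/-- Writing j = jac Q, one has 2 - 2/j = 2 (j² - 1) / (j (j + 1)), where j² - 1 ≥ ‖Q‖² by coercivity
and j is bounded since ‖Q‖ ≤ 2. -/
lemma exists_mul_norm_sq_le (m n : ℕ) : ∃ c : ℝ, 0 < c ∧ ∀ Q : E m →L[ℝ] E n, ‖Q‖ ≤ 2 →
    c * ‖Q‖ ^ 2 ≤ 2 - 2 * (1 / jac Q) := by
  obtain ⟨C, hC, h⟩ := exists_jac_sub_one_le m n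
  set J := 1 + 4 * C
  have hJ : 1 ≤ J := by simp [J, hC]
  refine ⟨2 / (J * (J + 1)), by positivity, fun Q hQ => ?_⟩
  have h1 := one_le_jac Q
  have h2 : jac Q ≤ J := by
    have h3 := h Q (by linarith)
    have h4 : ‖Q‖ ^ 2 ≤ 4 := by nlinarith [norm_nonneg Q]
    have := mul_le_mul_of_nonneg_left h4 hC
    simp only [J]; linarith
  have h3 : ‖Q‖ ^ 2 ≤ jac Q ^ 2 - 1 := by
    linarith [norm_sq_le_hsInner_self Q, one_add_hsInner_le_jac_sq Q]
  have h4 : 2 - 2 * (1 / jac Q) = 2 / (jac Q * (jac Q + 1)) * (jac Q ^ 2 - 1) := by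
    field_simp
    ring
  rw [h4]
  gcongr

/-! ### Transfer from the graph to the plane -/

variable {u v : E m → E n} {A : Mat m n} {p : Amb m n} {r : ℝ}

lemma exists_of_mem_graph
    (hgr : rot A '' (graph u (ball 0 1) ∩ cyl A p r) = graph v (ball (hor (rot A p)) r))
    {y : E m} (hy : y ∈ ball (hor (rot A p)) r) : ∃ z ∈ ball (0 : E m) 1,
      pt z (u z) ∈ cyl A p r ∧ rot A (pt z (u z)) = pt y (v y) := by
  have h1 : pt y (v y) ∈ graph v (ball (hor (rot A p)) r) := ⟨y, hy, rfl⟩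
  rw [← hgr] at h1
  obtain ⟨_, ⟨⟨z, hz, rfl⟩, hc⟩, hq⟩ := h1
  exact ⟨z, hz, hc, hq⟩

lemma rot_pt_eq_of_mem
    (hgr : rot A '' (graph u (ball 0 1) ∩ cyl A p r) = graph v (ball (hor (rot A p)) r))
    {z : E m} (hz : z ∈ ball (0 : E m) 1) (hB : pt z (u z) ∈ cyl A p r) :
    rot A (pt z (u z)) = pt (hor (rot A (pt z (u z)))) (v (hor (rot A (pt z (u z))))) := by
  have h1 : rot A (pt z (u z)) ∈ graph v (ball (hor (rot A p)) r) := by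
    rw [← hgr]; exact ⟨_, ⟨⟨z, hz, rfl⟩, hB⟩, rfl⟩
  obtain ⟨y, _, hy⟩ := h1
  simp only [← hy, hor_pt]

/-- Near z the rotated graph of u satisfies the equation of the graph of v; differentiating it shows
that the two parametrizations have the same tangent plane. -/
lemma vert_rot_fderiv (hA : A ∈ SO m n)
    (hgr : rot A '' (graph u (ball 0 1) ∩ cyl A p r) = graph v (ball (hor (rot A p)) r))
    {z : E m} (hz : z ∈ ball (0 : E m) 1) (hB : pt z (u z) ∈ cyl A p r)
    (hu : DifferentiableAt ℝ u z) (hv : DifferentiableAt ℝ v (hor (rot A (pt z (u z))))) (ξ : E m) :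
    vert (rot A (pt ξ (fderiv ℝ u z ξ))) =
      fderiv ℝ v (hor (rot A (pt z (u z)))) (hor (rot A (pt ξ (fderiv ℝ u z ξ)))) := by
  have h1 : HasFDerivAt (fun z => rot A (pt z (u z)))
      ((rotL A).comp ((ptL m n).comp ((ContinuousLinearMap.id ℝ (E m)).prod (fderiv ℝ u z)))) z :=
    (rotL A).hasFDerivAt.comp z ((ptL m n).hasFDerivAt.comp z
      ((hasFDerivAt_id z).prodMk hu.hasFDerivAt))
  have h2 := (vertL m n).hasFDerivAt.comp z h1
  have h3 := (horL m n).hasFDerivAt.comp z h1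
  have h4 := hv.hasFDerivAt.comp z h3
  have h5 : (fun z => vert (rot A (pt z (u z)))) =ᶠ[𝓝 z]
      fun z => v (hor (rot A (pt z (u z)))) := by
    have hc : ContinuousAt (fun z => pt z (u z)) z :=
      (ptL m n).continuous.continuousAt.comp (continuousAt_id.prodMk hu.continuousAt)
    filter_upwards [isOpen_ball.mem_nhds hz,
      hc.preimage_mem_nhds ((isOpen_cyl hA p r).mem_nhds hB)] with w hw hwB
    conv_lhs => rw [rot_pt_eq_of_mem hgr hw hwB]
    simp
  have h6 := (h2.congr_of_eventuallyEq h5.symm).unique h4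
  exact congrArg (fun T : E m →L[ℝ] E n => T ξ) h6

lemma measurable_norm_tangentMVec_sub_sq (hA : A ∈ SO m n) (u : E m → E n) :
    Measurable fun q : Amb m n => ‖tangentMVec u (hor q) - planeMVec A‖ ^ 2 := by
  simp_rw [norm_tangentMVec_sub_sq hA]
  have h1 : Measurable fun q : Amb m n => fderiv ℝ u (hor q) :=
    (measurable_fderiv ℝ u).comp lipschitzWith_hor.continuous.measurable
  have h2 : Continuous (projDet A) := by
    unfold projDet
    refine Continuous.matrix_det (continuous_matrix fun i j => ?_)
    have : Continuous fun P : E m →L[ℝ] E n =>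
        (horL m n) (rotL A (ptL m n (basisVec j, P (basisVec j)))) := by fun_prop
    exact (EuclideanSpace.proj (𝕜 := ℝ) i).continuous.comp this
  exact measurable_const.sub (measurable_const.mul
    ((h2.measurable.comp h1).div (continuous_jac.measurable.comp h1)))

lemma norm_tangentMVec_sub_sq_le (A : Mat m n) (u : E m → E n) (x : E m) :
    ‖tangentMVec u x - planeMVec A‖ ^ 2 ≤ 4 := by
  have h1 : ‖tangentMVec u x‖ ≤ 1 := by
    rw [tangentMVec, unitMVec, norm_smul, norm_inv, norm_norm]; exact inv_mul_le_one
  have h2 : ‖planeMVec A‖ ≤ 1 := by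
    rw [planeMVec, unitMVec, norm_smul, norm_inv, norm_norm]; exact inv_mul_le_one
  have h3 := (norm_sub_le (tangentMVec u x) (planeMVec A)).trans (add_le_add h1 h2)
  nlinarith [norm_nonneg (tangentMVec u x - planeMVec A)]

lemma ofReal_cylExcess (hA : A ∈ SO m n) (hu : LipschitzOnWith 1 u (ball 0 1)) :
    ENNReal.ofReal (2 * cylExcess u A p r) = ∫⁻ q in graph u (ball 0 1) ∩ cyl A p r,
      ENNReal.ofReal (‖tangentMVec u (hor q) - planeMVec A‖ ^ 2) ∂(vol m n) := by
  have hfin : vol m n (graph u (ball 0 1) ∩ cyl A p r) ≠ ⊤ := by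
    refine ne_top_of_le_ne_top ?_ ((measure_mono inter_subset_left).trans
      (vol_graph_le_of_lipschitzOn hu))
    exact ENNReal.mul_ne_top (ENNReal.pow_ne_top ENNReal.coe_ne_top) measure_ball_lt_top.ne
  rw [← ofReal_integral_eq_lintegral_ofReal]
  · rw [cylExcess]; congr 1; ring
  · refine Measure.integrableOn_of_bounded (M := 4) hfin
      (measurable_norm_tangentMVec_sub_sq hA u).aestronglyMeasurable
      (Filter.Eventually.of_forall fun q => ?_)
    rw [Real.norm_of_nonneg (by positivity)]
    exact norm_tangentMVec_sub_sq_le A u _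
  · exact Filter.Eventually.of_forall fun q => by positivity

/-- Orthogonal projection on the plane does not increase m-dimensional volume. For a lower bound of
the excess this inequality replaces the change of variables between the graph and the plane. -/
lemma volume_restrict_le_map (hA : A ∈ SO m n)
    (hgr : rot A '' (graph u (ball 0 1) ∩ cyl A p r) = graph v (ball (hor (rot A p)) r)) :
    volume.restrict (ball (hor (rot A p)) r) ≤
      ((vol m n).restrict (graph u (ball 0 1) ∩ cyl A p r)).map fun q => hor (rot A q) := by
  have hmeas : Measurable fun q : Amb m n => hor (rot A q) :=
    (lipschitzWith_hor.continuous.comp (isometry_rot hA).continuous).measurable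
  refine Measure.le_iff.2 fun s hs => ?_
  rw [Measure.map_apply hmeas hs, Measure.restrict_apply (hmeas hs), Measure.restrict_apply hs,
    ← vol_rot_image hA]
  refine (measure_mono ?_).trans (volume_image_hor_le _)
  rintro y ⟨hys, hy⟩
  obtain ⟨z, hz, hc, hzy⟩ := exists_of_mem_graph hgr hy
  refine ⟨_, ⟨_, ⟨?_, ⟨⟨z, hz, rfl⟩, hc⟩⟩, rfl⟩, by simp only [hzy, hor_pt]⟩
  simpa only [mem_preimage, hzy, hor_pt] using hys

/-- Rademacher's theorem, applied over each of the two base planes: a Lipschitz graph over a null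
set has zero volume. -/
lemma ae_differentiableAt_graph (hA : A ∈ SO m n) (hu : LipschitzOnWith 1 u (ball 0 1)) {k : ℝ≥0}
    (hv : LipschitzOnWith k v (ball (hor (rot A p)) r))
    (hgr : rot A '' (graph u (ball 0 1) ∩ cyl A p r) = graph v (ball (hor (rot A p)) r)) :
    ∀ᵐ q ∂(vol m n).restrict (graph u (ball 0 1) ∩ cyl A p r),
      DifferentiableAt ℝ u (hor q) ∧ DifferentiableAt ℝ v (hor (rot A q)) := by
  set B := ball (hor (rot A p)) r
  have null : ∀ {k : ℝ≥0} {w : E m → E n} {D : Set (E m)}, IsOpen D → LipschitzOnWith k w D →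
      vol m n (graph w {x ∈ D | ¬ DifferentiableAt ℝ w x}) = 0 := by
    intro k w D hD hw
    have h0 : volume {x ∈ D | ¬ DifferentiableAt ℝ w x} = 0 := by
      refine measure_mono_null (fun x hx => ?_)
        (ae_iff.1 (hw.ae_differentiableWithinAt_of_mem (μ := volume)))
      exact fun h => hx.2 ((h hx.1).differentiableAt (hD.mem_nhds hx.1))
    have h1 := vol_graph_le_of_lipschitzOn (hw.mono (fun x hx => hx.1 :
      {x ∈ D | ¬ DifferentiableAt ℝ w x} ⊆ D))
    rw [h0, mul_zero] at h1
    exact le_antisymm h1 bot_le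
  have hmu : MeasurableSet {q : Amb m n | DifferentiableAt ℝ u (hor q)} :=
    lipschitzWith_hor.continuous.measurable (measurableSet_of_differentiableAt ℝ u)
  have hmv : MeasurableSet {q : Amb m n | DifferentiableAt ℝ v (hor (rot A q))} :=
    (lipschitzWith_hor.continuous.comp (isometry_rot hA).continuous).measurable
      (measurableSet_of_differentiableAt ℝ v)
  refine Filter.Eventually.and ?_ ?_
  · rw [ae_restrict_iff hmu, ae_iff]
    refine measure_mono_null ?_ (null isOpen_ball hu)
    intro q hq
    simp only [mem_ofPred_eq, Classical.not_imp] at hq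
    obtain ⟨⟨⟨z, hz, rfl⟩, -⟩, hd⟩ := hq
    exact ⟨z, ⟨hz, by simpa using hd⟩, rfl⟩
  · rw [ae_restrict_iff hmv, ae_iff, ← vol_rot_image hA]
    refine measure_mono_null ?_ (null isOpen_ball hv)
    rintro _ ⟨q, hq, rfl⟩
    simp only [mem_ofPred_eq, Classical.not_imp] at hq
    obtain ⟨⟨⟨z, hz, rfl⟩, hc⟩, hd⟩ := hq
    exact ⟨_, ⟨hc, hd⟩, (rot_pt_eq_of_mem hgr hz hc).symm⟩

/-- The excess of a graph controls the Dirichlet energy of its parametrization over the plane. -/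
theorem exists_integral_norm_fderiv_sq_le (m n : ℕ) : ∃ C : ℝ, 0 ≤ C ∧
    ∀ (u v : E m → E n) (A : Mat m n) (p : Amb m n) (r : ℝ), A ∈ SO m n →
    LipschitzOnWith 1 u (ball 0 1) → LipschitzOnWith 2 v (ball (hor (rot A p)) r) →
    rot A '' (graph u (ball 0 1) ∩ cyl A p r) = graph v (ball (hor (rot A p)) r) →
    ∫ y in ball (hor (rot A p)) r, ‖fderiv ℝ v y‖ ^ 2 ≤ C * cylExcess u A p r := by
  obtain ⟨c, hc, hcQ⟩ := exists_mul_norm_sq_le m n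
  refine ⟨2 / c, by positivity, fun u v A p r hA hu hv hgr => ?_⟩
  set B := ball (hor (rot A p)) r
  have hπ : Measurable fun q : Amb m n => hor (rot A q) :=
    (lipschitzWith_hor.continuous.comp (isometry_rot hA).continuous).measurable
  have hmv : Measurable fun y => c * ‖fderiv ℝ v y‖ ^ 2 :=
    ((measurable_fderiv ℝ v).norm.pow_const 2).const_mul c
  -- The graph is measurable as a continuous injective image of a ball, so almost every point for
  -- the restricted measure lies on it.
  have hGm : ∀ᵐ q ∂(vol m n).restrict (graph u (ball 0 1) ∩ cyl A p r),
      q ∈ graph u (ball 0 1) ∩ cyl A p r := by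
    refine ae_restrict_mem₀ (MeasurableSet.nullMeasurableSet ?_)
    refine MeasurableSet.inter ?_ (isOpen_cyl hA p r).measurableSet
    refine measurableSet_ball.image_of_continuousOn_injOn
      ((ptL m n).continuous.comp_continuousOn (continuousOn_id.prodMk hu.continuousOn)) ?_
    exact fun x _ y _ h => by simpa using congrArg hor h
  have h1 : ∫⁻ y in B, ENNReal.ofReal (c * ‖fderiv ℝ v y‖ ^ 2) ≤
      ENNReal.ofReal (2 * cylExcess u A p r) := by
    calc ∫⁻ y in B, ENNReal.ofReal (c * ‖fderiv ℝ v y‖ ^ 2)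
        ≤ ∫⁻ y, ENNReal.ofReal (c * ‖fderiv ℝ v y‖ ^ 2)
            ∂((vol m n).restrict (graph u (ball 0 1) ∩ cyl A p r)).map fun q => hor (rot A q) :=
          lintegral_mono' (volume_restrict_le_map hA hgr) le_rfl
      _ = ∫⁻ q in graph u (ball 0 1) ∩ cyl A p r,
            ENNReal.ofReal (c * ‖fderiv ℝ v (hor (rot A q))‖ ^ 2) ∂(vol m n) :=
          lintegral_map hmv.ennreal_ofReal hπ
      _ ≤ ∫⁻ q in graph u (ball 0 1) ∩ cyl A p r,
            ENNReal.ofReal (‖tangentMVec u (hor q) - planeMVec A‖ ^ 2) ∂(vol m n) := by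
          refine lintegral_mono_ae ?_
          filter_upwards [ae_differentiableAt_graph hA hu hv hgr, hGm] with q hd hq
          obtain ⟨⟨z, hz, rfl⟩, hcyl⟩ := hq
          simp only [hor_pt] at hd ⊢
          refine ENNReal.ofReal_le_ofReal ?_
          rw [norm_tangentMVec_sub_sq hA]
          have hB : hor (rot A (pt z (u z))) ∈ B := hcyl
          have h2 := projDet_eq (vert_rot_fderiv hA hgr hz hcyl hd.1 hd.2) hA
          have h3 := hcQ (fderiv ℝ v (hor (rot A (pt z (u z)))))
            (by simpa using norm_fderiv_le_of_lipschitzOn_isOpen isOpen_ball hv hB)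
          linarith
      _ = _ := (ofReal_cylExcess hA hu).symm
  have h0 : 0 ≤ cylExcess u A p r := by
    rw [cylExcess]
    exact mul_nonneg (by norm_num) (integral_nonneg fun q => by positivity)
  rw [← ofReal_integral_eq_lintegral_ofReal, integral_const_mul,
    ENNReal.ofReal_le_ofReal_iff (by positivity)] at h1
  · rw [div_mul_eq_mul_div, le_div_iff₀ hc]
    linarith
  · refine integrableOn_of_bound measure_ball_lt_top.ne measurableSet_ball hmv (M := c * 2 ^ 2)
      fun y hy => ?_
    rw [abs_of_nonneg (by positivity)]
    gcongr
    simpa using norm_fderiv_le_of_lipschitzOn_isOpen isOpen_ball hv hy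
  · exact Filter.Eventually.of_forall fun y => by positivity

/-! ### Almost harmonicity of the Lipschitz approximation -/

/-- At almost every point of K, a density point, the full derivative is determined by the values on
K, where the better Lipschitz constant δ holds. -/
lemma ae_norm_fderiv_le_of_lipschitzOn {w : E m → E n} {B K : Set (E m)} {k δ : ℝ≥0}
    (hB : IsOpen B) (hw : LipschitzOnWith k w B) (hK : MeasurableSet K) (hKB : K ⊆ B)
    (h : LipschitzOnWith δ w K) : ∀ᵐ x ∂volume.restrict K, ‖fderiv ℝ w x‖ ≤ δ := by
  set d : Set (E m) := {x | DifferentiableAt ℝ w x}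
  have hd : MeasurableSet d := measurableSet_of_differentiableAt ℝ w
  have h1 := ae_norm_fderiv_sub_le (s := K ∩ d) (f := w) (A := 0) (δ := δ)
    (fun x hx y hy => by simpa using h.norm_sub_le hx.1 hy.1) (hK.inter hd) (fderiv ℝ w)
    fun x hx => hx.2.hasFDerivAt.hasFDerivWithinAt
  rw [ae_restrict_iff' (hK.inter hd)] at h1
  rw [ae_restrict_iff' hK]
  filter_upwards [h1, hw.ae_differentiableWithinAt_of_mem (μ := volume)] with x hx hdx hxK
  have hdiff := (hdx (hKB hxK)).differentiableAt (hB.mem_nhds (hKB hxK))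
  have := hx ⟨hxK, hdiff⟩
  rw [sub_zero] at this
  exact_mod_cast this

/-- The good set of a Lipschitz approximation need not be measurable. Its relative closure is, and
it inherits the Lipschitz bound by continuity. -/
lemma lipschitzOnWith_closure_inter {v : E m → E n} {B K : Set (E m)} {δ : ℝ≥0} (hB : IsOpen B)
    (hv : ContinuousOn v B) (h : LipschitzOnWith δ v K) :
    LipschitzOnWith δ v (closure K ∩ B) := by
  refine LipschitzOnWith.of_dist_le_mul fun x hx y hy => ?_
  obtain ⟨a, haK, ha⟩ := mem_closure_iff_seq_limit.1 hx.1
  obtain ⟨b, hbK, hb⟩ := mem_closure_iff_seq_limit.1 hy.1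
  have hva := (hv.continuousAt (hB.mem_nhds hx.2)).tendsto.comp ha
  have hvb := (hv.continuousAt (hB.mem_nhds hy.2)).tendsto.comp hb
  exact le_of_tendsto_of_tendsto' (hva.dist hvb) ((ha.dist hb).const_mul _)
    fun k => h.dist_le_mul _ (haK k) _ (hbK k)

lemma eqOn_closure_inter {v f : E m → E n} {B K : Set (E m)} (hB : IsOpen B)
    (hv : ContinuousOn v B) (hf : ContinuousOn f B) (h : EqOn f v K) :
    EqOn f v (closure K ∩ B) := by
  intro x hx
  obtain ⟨a, haK, ha⟩ := mem_closure_iff_seq_limit.1 hx.1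
  have hva := (hv.continuousAt (hB.mem_nhds hx.2)).tendsto.comp ha
  have hfa := (hf.continuousAt (hB.mem_nhds hx.2)).tendsto.comp ha
  refine tendsto_nhds_unique hfa (hva.congr fun k => (h (haK k)).symm)

/-- The density that controls the failure of `f` to be weakly harmonic in `D`, when `f` is an
approximation of the minimizing map `v`. -/
def harmonicDefect (v f : E m → E n) (D : Set (E m)) : E m → ℝ :=
  D.indicator fun y => variationConst m n * ‖fderiv ℝ v y‖ ^ 3 +
    m * ‖fderiv ℝ f y - fderiv ℝ v y‖

lemma harmonicDefect_nonneg (v f : E m → E n) (D : Set (E m)) (y : E m) :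
    0 ≤ harmonicDefect v f D y :=
  indicator_nonneg (fun y _ => add_nonneg
    (mul_nonneg (variationConst_nonneg m n) (by positivity)) (by positivity)) y

lemma measurable_harmonicDefect (v f : E m → E n) {D : Set (E m)} (hD : MeasurableSet D) :
    Measurable (harmonicDefect v f D) := by
  refine Measurable.indicator ?_ hD
  exact (((measurable_fderiv ℝ v).norm.pow_const 3).const_mul _).add
    (((measurable_fderiv ℝ f).sub (measurable_fderiv ℝ v)).norm.const_mul _)

lemma harmonicDefect_le {v f : E m → E n} {D : Set (E m)} {l : ℝ≥0} (hD : IsOpen D)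
    (hv : LipschitzOnWith 2 v D) (hf : LipschitzOnWith l f D) {y : E m} (hy : y ∈ D) :
    variationConst m n * ‖fderiv ℝ v y‖ ^ 3 + m * ‖fderiv ℝ f y - fderiv ℝ v y‖ ≤
      variationConst m n * 8 + m * (l + 2) := by
  have h1 := norm_fderiv_le_of_lipschitzOn_isOpen hD hv hy
  have h2 := norm_fderiv_le_of_lipschitzOn_isOpen hD hf hy
  have h3 := variationConst_nonneg m n
  have h4 : ‖fderiv ℝ v y‖ ^ 3 ≤ 8 := by
    have : ‖fderiv ℝ v y‖ ^ 3 ≤ 2 ^ 3 := by gcongr; simpa using h1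
    linarith
  gcongr
  refine (norm_sub_le _ _).trans ?_
  gcongr
  simpa using h1

lemma integrable_harmonicDefect {v f : E m → E n} {D : Set (E m)} {l : ℝ≥0} (hD : IsOpen D)
    (hDf : volume D ≠ ⊤) (hv : LipschitzOnWith 2 v D) (hf : LipschitzOnWith l f D) :
    Integrable (harmonicDefect v f D) := by
  rw [harmonicDefect, integrable_indicator_iff hD.measurableSet]
  refine integrableOn_of_bound hDf hD.measurableSet ((((measurable_fderiv ℝ v).norm.pow_const
    3).const_mul _).add (((measurable_fderiv ℝ f).sub (measurable_fderiv ℝ v)).norm.const_mul _))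
    (M := variationConst m n * 8 + m * (l + 2)) fun y hy => ?_
  rw [abs_of_nonneg (add_nonneg
    (mul_nonneg (variationConst_nonneg m n) (by positivity)) (by positivity))]
  exact harmonicDefect_le hD hv hf hy

lemma hsInner_add_left (P P' Q : E m →L[ℝ] E n) :
    hsInner (P + P') Q = hsInner P Q + hsInner P' Q := by
  simp [hsInner, inner_add_left, Finset.sum_add_distrib]

lemma hsInner_zero_right (P : E m →L[ℝ] E n) : hsInner P 0 = 0 := by simp [hsInner]

/-- In Df = Dv + (Df - Dv) the first term is handled by the first variation and the second by
Cauchy–Schwarz. This is the origin of the two summands of `harmonicDefect`. -/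
theorem VerticallyMinimizing.abs_integral_hsInner_approx_le {B D : Set (E m)} (hB : IsOpen B)
    (hBf : volume B ≠ ⊤) (hD : IsOpen D) (hDB : D ⊆ B) {v f : E m → E n}
    (hv : LipschitzOnWith 2 v B) (hmin : VerticallyMinimizing v B) {l : ℝ≥0}
    (hf : LipschitzOnWith l f D) {κ : E m → E n} (hκ : ContDiff ℝ 1 κ)
    (hcpt : HasCompactSupport κ) (hsupp : tsupport κ ⊆ D) :
    |∫ y, hsInner (fderiv ℝ f y) (fderiv ℝ κ y)| ≤
      ∫ y, harmonicDefect v f D y * ‖fderiv ℝ κ y‖ := by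
  have hDf : volume D ≠ ⊤ := ne_top_of_le_ne_top hBf (measure_mono hDB)
  have hzero : ∀ y ∉ D, fderiv ℝ κ y = 0 := fun y hy =>
    image_eq_zero_of_notMem_tsupport fun h => hy (hsupp (tsupport_fderiv_subset ℝ h))
  obtain ⟨K, hK⟩ := hκ.lipschitzWith_of_hasCompactSupport hcpt one_ne_zero
  have hDκ : ∀ y, ‖fderiv ℝ κ y‖ ≤ K := fun y => norm_fderiv_le_of_lipschitz ℝ hK
  have hmv : Measurable (fderiv ℝ v) := measurable_fderiv ℝ v
  have hmf : Measurable (fderiv ℝ f) := measurable_fderiv ℝ f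
  have hmκ : Measurable (fderiv ℝ κ) := measurable_fderiv ℝ κ
  have hvD : ∀ y ∈ D, ‖fderiv ℝ v y‖ ≤ 2 := fun y hy => by
    simpa using norm_fderiv_le_of_lipschitzOn_isOpen hB hv (hDB hy)
  have hfD : ∀ y ∈ D, ‖fderiv ℝ f y‖ ≤ l := fun y hy =>
    norm_fderiv_le_of_lipschitzOn_isOpen hD hf hy
  have e1 : ∫ y, hsInner (fderiv ℝ f y) (fderiv ℝ κ y) =
      ∫ y in D, hsInner (fderiv ℝ f y) (fderiv ℝ κ y) :=
    (setIntegral_eq_integral_of_forall_compl_eq_zero fun y hy => by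
      rw [hzero y hy, hsInner_zero_right]).symm
  have e2 : ∫ y in B, hsInner (fderiv ℝ v y) (fderiv ℝ κ y) =
      ∫ y in D, hsInner (fderiv ℝ v y) (fderiv ℝ κ y) :=
    setIntegral_eq_of_subset_of_forall_sdiff_eq_zero hB.measurableSet hDB fun y hy => by
      rw [hzero y hy.2, hsInner_zero_right]
  have e3 : ∫ y in B, ‖fderiv ℝ v y‖ ^ 3 * ‖fderiv ℝ κ y‖ =
      ∫ y in D, ‖fderiv ℝ v y‖ ^ 3 * ‖fderiv ℝ κ y‖ :=
    setIntegral_eq_of_subset_of_forall_sdiff_eq_zero hB.measurableSet hDB fun y hy => by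
      rw [hzero y hy.2, norm_zero, mul_zero]
  have e4 : ∫ y, harmonicDefect v f D y * ‖fderiv ℝ κ y‖ =
      ∫ y in D, (variationConst m n * (‖fderiv ℝ v y‖ ^ 3 * ‖fderiv ℝ κ y‖) +
        m * ‖fderiv ℝ f y - fderiv ℝ v y‖ * ‖fderiv ℝ κ y‖) := by
    rw [← setIntegral_eq_integral_of_forall_compl_eq_zero (s := D) fun y hy => by
      rw [hzero y hy, norm_zero, mul_zero]]
    refine setIntegral_congr_fun hD.measurableSet fun y hy => ?_
    simp only [harmonicDefect, indicator_of_mem hy]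
    ring
  have i1 : IntegrableOn (fun y => hsInner (fderiv ℝ f y - fderiv ℝ v y) (fderiv ℝ κ y)) D :=
    integrableOn_of_bound hDf hD.measurableSet (measurable_hsInner (hmf.sub hmv) hmκ)
      (M := m * ((l + 2) * K)) fun y hy => (abs_hsInner_le _ _).trans (by
        gcongr
        · exact (norm_sub_le _ _).trans (add_le_add (hfD y hy) (hvD y hy))
        · exact hDκ y)
  have i2 : IntegrableOn (fun y => hsInner (fderiv ℝ v y) (fderiv ℝ κ y)) D :=
    integrableOn_of_bound hDf hD.measurableSet (measurable_hsInner hmv hmκ)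
      (M := m * (2 * K)) fun y hy => (abs_hsInner_le _ _).trans (by
        gcongr
        exacts [hvD y hy, hDκ y])
  have i3 : IntegrableOn (fun y => ‖fderiv ℝ v y‖ ^ 3 * ‖fderiv ℝ κ y‖) D :=
    integrableOn_of_bound hDf hD.measurableSet ((hmv.norm.pow_const 3).mul hmκ.norm)
      (M := 2 ^ 3 * K) fun y hy => by
        rw [abs_of_nonneg (by positivity)]
        gcongr
        exacts [hvD y hy, hDκ y]
  have i4 : IntegrableOn (fun y => m * ‖fderiv ℝ f y - fderiv ℝ v y‖ * ‖fderiv ℝ κ y‖) D :=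
    integrableOn_of_bound hDf hD.measurableSet (((hmf.sub hmv).norm.const_mul _).mul hmκ.norm)
      (M := m * (l + 2) * K) fun y hy => by
        rw [abs_of_nonneg (by positivity)]
        gcongr
        · exact (norm_sub_le _ _).trans (add_le_add (hfD y hy) (hvD y hy))
        · exact hDκ y
  have e5 : ∫ y in D, hsInner (fderiv ℝ f y) (fderiv ℝ κ y) =
      (∫ y in D, hsInner (fderiv ℝ f y - fderiv ℝ v y) (fderiv ℝ κ y)) +
        ∫ y in D, hsInner (fderiv ℝ v y) (fderiv ℝ κ y) := by
    rw [← integral_add i1 i2]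
    refine integral_congr_ae (Filter.Eventually.of_forall fun y => ?_)
    simp only
    rw [← hsInner_add_left, sub_add_cancel]
  have h1 := hmin.abs_integral_hsInner_le hB hBf hv hκ hcpt (hsupp.trans hDB)
  have h2 : |∫ y in D, hsInner (fderiv ℝ f y - fderiv ℝ v y) (fderiv ℝ κ y)| ≤
      ∫ y in D, m * ‖fderiv ℝ f y - fderiv ℝ v y‖ * ‖fderiv ℝ κ y‖ :=
    abs_integral_le_integral_abs.trans (integral_mono i1.abs i4 fun y => by
      simp only
      rw [mul_assoc]
      exact abs_hsInner_le _ _)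
  rw [e1, e5, e4, integral_add (i3.const_mul _) i4, integral_const_mul, ← e3, ← e2]
  exact (abs_add_le _ _).trans (by linarith)

/-- The total harmonic defect of a Lipschitz approximation. -/
theorem integral_harmonicDefect_le {B D K : Set (E m)} (hB : IsOpen B) (hBf : volume B ≠ ⊤)
    (hD : IsOpen D) (hDB : D ⊆ B) {v f : E m → E n} (hv : LipschitzOnWith 2 v B) {l η : ℝ≥0}
    (hf : LipschitzOnWith l f D) (hKD : K ⊆ D) (hvK : LipschitzOnWith η v K) (hfv : EqOn f v K)
    {W V : ℝ} (hW : ∫ y in B, ‖fderiv ℝ v y‖ ^ 2 ≤ W) (hV0 : 0 ≤ V)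
    (hV : volume (D \ K) ≤ ENNReal.ofReal V) :
    ∫ y, harmonicDefect v f D y ≤
      variationConst m n * η * W + (variationConst m n * 8 + m * (l + 2)) * V := by
  set C := variationConst m n
  have hC : 0 ≤ C := variationConst_nonneg m n
  have hvD := hv.mono hDB
  set K₁ := closure K ∩ D
  have hK₁ : MeasurableSet K₁ := isClosed_closure.measurableSet.inter hD.measurableSet
  have hKK₁ : K ⊆ K₁ := fun x hx => ⟨subset_closure hx, hKD hx⟩
  have hK₁D : K₁ ⊆ D := inter_subset_right
  have hDf : volume D ≠ ⊤ := ne_top_of_le_ne_top hBf (measure_mono hDB)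
  have l1 := lipschitzOnWith_closure_inter hD hvD.continuousOn hvK
  have l2 := eqOn_closure_inter hD hvD.continuousOn hf.continuousOn hfv
  have a1 := ae_norm_fderiv_le_of_lipschitzOn hD hvD hK₁ hK₁D l1
  have hsub : LipschitzOnWith (l + 2) (fun y => f y - v y) D := hf.sub hvD
  -- On K₁ the map f - v vanishes, so it is 0-Lipschitz there and its derivative is zero at almost
  -- every point.
  have a2 := ae_norm_fderiv_le_of_lipschitzOn (δ := 0) hD hsub hK₁ hK₁D
    (LipschitzOnWith.of_dist_le_mul fun x hx y hy => by simp [l2 hx, l2 hy])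
  have a3 : ∀ᵐ y ∂volume.restrict K₁, fderiv ℝ f y - fderiv ℝ v y = 0 := by
    have d1 := ae_restrict_of_ae (s := K₁) (hf.ae_differentiableWithinAt_of_mem (μ := volume))
    have d2 := ae_restrict_of_ae (s := K₁) (hvD.ae_differentiableWithinAt_of_mem (μ := volume))
    filter_upwards [a2, d1, d2, ae_restrict_mem hK₁] with y hy h1 h2 hyK
    have hyD := hK₁D hyK
    rw [fderiv_fun_sub ((h1 hyD).differentiableAt (hD.mem_nhds hyD))
      ((h2 hyD).differentiableAt (hD.mem_nhds hyD))] at hy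
    exact norm_le_zero_iff.1 (by simpa using hy)
  have hint := integrable_harmonicDefect hD hDf hvD hf
  have i2 : IntegrableOn (fun y => ‖fderiv ℝ v y‖ ^ 2) B :=
    integrableOn_of_bound hBf hB.measurableSet ((measurable_fderiv ℝ v).norm.pow_const 2)
      (M := 2 ^ 2) fun y hy => by
        rw [abs_of_nonneg (by positivity)]
        gcongr
        simpa using norm_fderiv_le_of_lipschitzOn_isOpen hB hv hy
  have e1 : ∫ y, harmonicDefect v f D y =
      (∫ y in K₁, harmonicDefect v f D y) + ∫ y in D \ K₁, harmonicDefect v f D y := by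
    have e0 : ∫ y in D, harmonicDefect v f D y = ∫ y, harmonicDefect v f D y :=
      setIntegral_eq_integral_of_forall_compl_eq_zero fun y hy => indicator_of_notMem hy _
    rw [← e0, ← setIntegral_union disjoint_sdiff_right
      (hD.measurableSet.diff hK₁) hint.integrableOn hint.integrableOn, union_sdiff_cancel hK₁D]
  -- On K₁ only the cubic term survives, and one of its three factors is at most η.
  have b1 : ∫ y in K₁, harmonicDefect v f D y ≤ C * η * W := by
    calc ∫ y in K₁, harmonicDefect v f D y ≤ ∫ y in K₁, C * η * ‖fderiv ℝ v y‖ ^ 2 := by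
          refine integral_mono_ae hint.integrableOn
            ((i2.mono_set (hK₁D.trans hDB)).const_mul _) ?_
          filter_upwards [a1, a3, ae_restrict_mem hK₁] with y h1 h3 hy
          simp only [harmonicDefect, indicator_of_mem (hK₁D hy), h3, norm_zero, mul_zero, add_zero]
          have : ‖fderiv ℝ v y‖ ^ 3 ≤ η * ‖fderiv ℝ v y‖ ^ 2 := by
            rw [pow_succ']; gcongr
          rw [mul_assoc]
          gcongr
      _ = C * η * ∫ y in K₁, ‖fderiv ℝ v y‖ ^ 2 := integral_const_mul _ _
      _ ≤ C * η * W := by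
          gcongr
          refine le_trans ?_ hW
          exact setIntegral_mono_set i2 (Filter.Eventually.of_forall fun y => by positivity)
            (hK₁D.trans hDB).eventuallyLE
  -- Off K₁ smallness comes from the measure alone; the density is merely bounded.
  have b2 : ∫ y in D \ K₁, harmonicDefect v f D y ≤ (C * 8 + m * (l + 2)) * V := by
    have hvol : volume.real (D \ K₁) ≤ V := by
      refine ENNReal.toReal_le_of_le_ofReal hV0 ((measure_mono ?_).trans hV)
      exact sdiff_subset_sdiff_right hKK₁
    calc ∫ y in D \ K₁, harmonicDefect v f D y ≤ ∫ y in D \ K₁, (C * 8 + m * (l + 2)) := by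
          refine setIntegral_mono_on hint.integrableOn (integrableOn_const
            (ne_top_of_le_ne_top hDf (measure_mono sdiff_subset)))
            (hD.measurableSet.diff hK₁) fun y hy => ?_
          simp only [harmonicDefect, indicator_of_mem hy.1]
          exact harmonicDefect_le hD hvD hf hy.1
      _ = (C * 8 + m * (l + 2)) * volume.real (D \ K₁) := by
          rw [setIntegral_const, smul_eq_mul, mul_comm]
      _ ≤ _ := by gcongr
  rw [e1]
  exact add_le_add b1 b2

/-! ### Mollification of almost harmonic functions -/

/-- The distributional Laplacian of `h` in `D` is the divergence of a vector field that is bounded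
by `g`. -/
def WeaklyHarmonicUpTo (h g : E m → ℝ) (D : Set (E m)) : Prop :=
  ∀ η : E m → ℝ, ContDiff ℝ 1 η → HasCompactSupport η → tsupport η ⊆ D →
    |∫ y, ∑ i, fderiv ℝ h y (basisVec i) * fderiv ℝ η y (basisVec i)| ≤ ∫ y, g y * ‖fderiv ℝ η y‖

/-- Testing with κ = η e_a isolates the a-th coordinate without increasing the gradient of the test
map. -/
lemma weaklyHarmonicUpTo_coord {F : E m → E n} {g : E m → ℝ} {D : Set (E m)} {L : ℝ≥0}
    (hF : LipschitzWith L F) (hg : ∀ y, 0 ≤ g y) (hgi : Integrable g)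
    (h : ∀ κ : E m → E n, ContDiff ℝ 1 κ → HasCompactSupport κ → tsupport κ ⊆ D →
      |∫ y, hsInner (fderiv ℝ F y) (fderiv ℝ κ y)| ≤ ∫ y, g y * ‖fderiv ℝ κ y‖) (a : Fin n) :
    WeaklyHarmonicUpTo (fun y => F y a) g D := by
  intro η hη hcpt hsupp
  have hκ : ContDiff ℝ 1 fun y => η y • basisVec a := hη.smul contDiff_const
  have hκcpt : HasCompactSupport fun y => η y • basisVec a := hcpt.smul_right
  have hκsupp : tsupport (fun y => η y • basisVec a) ⊆ D :=
    (closure_mono (Function.support_smul_subset_left _ _)).trans hsupp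
  have hd : ∀ y ξ, fderiv ℝ (fun y => η y • basisVec a) y ξ = fderiv ℝ η y ξ • basisVec a :=
    fun y ξ => by
      rw [fderiv_smul_const (hη.differentiable one_ne_zero y)]
      rfl
  have hdn : ∀ y, ‖fderiv ℝ (fun y => η y • basisVec a) y‖ ≤ ‖fderiv ℝ η y‖ := fun y => by
    refine ContinuousLinearMap.opNorm_le_bound _ (norm_nonneg _) fun ξ => ?_
    rw [hd, norm_smul, norm_basisVec, mul_one]
    exact (fderiv ℝ η y).le_opNorm ξ
  have h1 := h _ hκ hκcpt hκsupp
  have h2 : ∫ y, hsInner (fderiv ℝ F y) (fderiv ℝ (fun y => η y • basisVec a) y) =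
      ∫ y, ∑ i, fderiv ℝ (fun y => F y a) y (basisVec i) * fderiv ℝ η y (basisVec i) := by
    refine integral_congr_ae ?_
    filter_upwards [hF.ae_differentiableAt (μ := volume)] with y hy
    have hFa : fderiv ℝ (fun y => F y a) y =
        (EuclideanSpace.proj (𝕜 := ℝ) a : E n →L[ℝ] ℝ).comp (fderiv ℝ F y) :=
      ((EuclideanSpace.proj (𝕜 := ℝ) a : E n →L[ℝ] ℝ).hasFDerivAt.comp y hy.hasFDerivAt).fderiv
    simp only [hsInner]
    refine Finset.sum_congr rfl fun i _ => ?_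
    rw [hd, real_inner_smul_right, hFa, basisVec, EuclideanSpace.inner_single_right]
    simp [mul_comm]
  have i1 : ∀ {V : Type} [NormedAddCommGroup V] [NormedSpace ℝ V] (κ : E m → V),
      ContDiff ℝ 1 κ → HasCompactSupport κ → Integrable fun y => g y * ‖fderiv ℝ κ y‖ := by
    intro V _ _ κ hκ hc
    obtain ⟨K, hK⟩ := (hc.fderiv ℝ).exists_bound_of_continuous (hκ.continuous_fderiv one_ne_zero)
    exact hgi.mul_bdd (c := K) (hκ.continuous_fderiv one_ne_zero).norm.aestronglyMeasurable
      (Filter.Eventually.of_forall fun y => by rw [norm_norm]; exact hK y)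
  rw [← h2]
  exact h1.trans (integral_mono (i1 _ hκ hκcpt) (i1 _ hη hcpt) fun y =>
    mul_le_mul_of_nonneg_left (hdn y) (hg y))

/-- One integration by parts in each coordinate, allowed for a Lipschitz h and a smooth compactly
supported η. -/
lemma WeaklyHarmonicUpTo.abs_integral_mul_laplacian_le {h g : E m → ℝ} {D : Set (E m)} {L : ℝ≥0}
    (hW : WeaklyHarmonicUpTo h g D) (hh : LipschitzWith L h) {η : E m → ℝ} (hη : ContDiff ℝ ∞ η)
    (hcpt : HasCompactSupport η) (hsupp : tsupport η ⊆ D) :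
    |∫ y, h y * ∑ i, fderiv ℝ (fun w => fderiv ℝ η w (basisVec i)) y (basisVec i)| ≤
      ∫ y, g y * ‖fderiv ℝ η y‖ := by
  refine le_trans (le_of_eq ?_) (hW η (hη.of_le (by exact_mod_cast le_top)) hcpt hsupp)
  have hη' : ∀ i : Fin m, ContDiff ℝ ∞ fun w => fderiv ℝ η w (basisVec i) := fun i =>
    (hη.fderiv_right (m := ∞) (by simp)).clm_apply contDiff_const
  have hc' : ∀ i : Fin m, HasCompactSupport fun w => fderiv ℝ η w (basisVec i) := fun i =>
    hcpt.fderiv_apply ℝ _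
  have hc'' : ∀ i : Fin m, HasCompactSupport
      fun y => fderiv ℝ (fun w => fderiv ℝ η w (basisVec i)) y (basisVec i) := fun i =>
    (hc' i).fderiv_apply ℝ _
  have hcont : ∀ i : Fin m, Continuous
      fun y => fderiv ℝ (fun w => fderiv ℝ η w (basisVec i)) y (basisVec i) := fun i =>
    ((hη' i).continuous_fderiv (by simp)).clm_apply continuous_const
  have key : ∀ i : Fin m, ∫ y, h y * fderiv ℝ (fun w => fderiv ℝ η w (basisVec i)) y (basisVec i) =
      -∫ y, fderiv ℝ h y (basisVec i) * fderiv ℝ η y (basisVec i) := fun i => by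
    obtain ⟨K, hK⟩ := (hη' i).lipschitzWith_of_hasCompactSupport (hc' i) (by simp)
    have h1 := hh.integral_lineDeriv_mul_eq (μ := volume) hK (hc' i) (basisVec i)
    have h2 : ∫ y, lineDeriv ℝ h y (basisVec i) * fderiv ℝ η y (basisVec i) =
        ∫ y, fderiv ℝ h y (basisVec i) * fderiv ℝ η y (basisVec i) := by
      refine integral_congr_ae ?_
      filter_upwards [hh.ae_differentiableAt (μ := volume)] with y hy
      rw [hy.lineDeriv_eq_fderiv]
    rw [← h2, h1, ← integral_neg]
    refine integral_congr_ae (Filter.Eventually.of_forall fun y => ?_)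
    simp only
    rw [((hη' i).differentiable (by simp) y).lineDeriv_eq_fderiv, map_neg]
    ring
  have i1 : ∀ i : Fin m, Integrable
      fun y => h y * fderiv ℝ (fun w => fderiv ℝ η w (basisVec i)) y (basisVec i) := fun i =>
    (hh.continuous.mul (hcont i)).integrable_of_hasCompactSupport (hc'' i).mul_left
  have i2 : ∀ i : Fin m, Integrable
      fun y => fderiv ℝ h y (basisVec i) * fderiv ℝ η y (basisVec i) := fun i => by
    refine Integrable.bdd_mul (c := L * 1)
      (((hη.continuous_fderiv (by simp)).clm_apply continuous_const).integrable_of_hasCompactSupport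
        (hcpt.fderiv_apply ℝ (basisVec i)))
      ((measurable_fderiv_apply_const ℝ h (basisVec i)).aestronglyMeasurable)
      (Filter.Eventually.of_forall fun y => ?_)
    refine ((fderiv ℝ h y).le_opNorm _).trans ?_
    rw [norm_basisVec]
    gcongr
    exact norm_fderiv_le_of_lipschitz ℝ hh
  simp_rw [Finset.mul_sum]
  rw [integral_finsetSum _ fun i _ => i1 i, integral_finsetSum _ fun i _ => i2 i]
  simp_rw [key]
  rw [Finset.sum_neg_distrib, abs_neg]

/-- For a radial `φ` the vector field `x ↦ φ(x) x` is a gradient. -/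
lemma IsMollifier.exists_potential (hm : 1 ≤ m) {φ : E m → ℝ} (hφ : IsMollifier φ) :
    ∃ θ : E m → ℝ, ContDiff ℝ 1 θ ∧ (∀ x, 1 ≤ ‖x‖ → θ x = 0) ∧
      ∀ x ξ, fderiv ℝ θ x ξ = φ x * ⟪x, ξ⟫ := by
  set e₀ : E m := basisVec ⟨0, hm⟩
  have he₀ : ‖e₀‖ = 1 := norm_basisVec _
  -- The profile of φ as a function of t = ‖x‖². The factor 1/2 cancels the 2 from the derivative of
  -- ‖x‖², and the use of ‖x‖² avoids a singularity of θ at the origin.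
  set q : ℝ → ℝ := fun t => φ (Real.sqrt t • e₀) / 2
  have hq : Continuous q := by
    have := hφ.smooth.continuous
    fun_prop
  have hqφ : ∀ x : E m, q (‖x‖ ^ 2) = φ x / 2 := fun x => by
    simp only [q, Real.sqrt_sq (norm_nonneg x)]
    rw [hφ.radial _ x (by rw [norm_smul, he₀, mul_one, norm_norm])]
  have hq0 : ∀ t, 1 ≤ t → q t = 0 := fun t ht => by
    have : φ (Real.sqrt t • e₀) = 0 := by
      refine image_eq_zero_of_notMem_tsupport fun h => ?_
      have h1 := hφ.tsupport_subset h
      rw [mem_ball_zero_iff, norm_smul, he₀, mul_one, Real.norm_of_nonneg (Real.sqrt_nonneg _)] at h1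
      exact absurd (Real.one_le_sqrt.2 ht) (not_le.2 h1)
    simp [q, this]
  have hder : ∀ x : E m, HasFDerivAt (fun x : E m => ∫ t in (1 : ℝ)..‖x‖ ^ 2, q t)
      (φ x • innerSL ℝ x) x := fun x => by
    have h1 := (hq.integral_hasStrictDerivAt 1 (‖x‖ ^ 2)).hasDerivAt.comp_hasFDerivAt x
      (hasStrictFDerivAt_norm_sq x).hasFDerivAt
    refine h1.congr_fderiv ?_
    rw [hqφ]
    ext ξ
    simp
    ring
  refine ⟨fun x => ∫ t in (1 : ℝ)..‖x‖ ^ 2, q t, ?_, fun x hx => ?_, fun x ξ => ?_⟩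
  · rw [contDiff_one_iff_fderiv]
    refine ⟨fun x => (hder x).differentiableAt, ?_⟩
    rw [show fderiv ℝ (fun x : E m => ∫ t in (1 : ℝ)..‖x‖ ^ 2, q t) = fun x => φ x • innerSL ℝ x
      from funext fun x => (hder x).fderiv]
    exact hφ.smooth.continuous.smul (innerSL ℝ).continuous
  · have h1 : (1 : ℝ) ≤ ‖x‖ ^ 2 := by nlinarith
    refine intervalIntegral.integral_zero_ae (Filter.Eventually.of_forall fun t ht => ?_)
    rw [uIoc_of_le h1] at ht
    exact hq0 t ht.1.le
  · rw [(hder x).fderiv]; simp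

lemma integral_eq_pow_mul_integral_sub_smul (k : E m → ℝ) (y : E m) {r : ℝ} (hr : 0 < r) :
    ∫ w, k w = r ^ m * ∫ x, k (y - r • x) := by
  have h1 := Measure.integral_comp_smul volume (fun z => k (y - z)) r
  rw [integral_sub_left_eq_self (fun z => k z) volume y, finrank_euclideanSpace_fin,
    abs_of_pos (by positivity), smul_eq_mul] at h1
  rw [h1]
  field_simp

lemma IsMollifier.apply_eq_zero {φ : E m → ℝ} (hφ : IsMollifier φ) {x : E m} (hx : 1 ≤ ‖x‖) :
    φ x = 0 :=
  image_eq_zero_of_notMem_tsupport fun h => by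
    have := hφ.tsupport_subset h
    rw [mem_ball_zero_iff] at this
    linarith

lemma IsMollifier.hasCompactSupport {φ : E m → ℝ} (hφ : IsMollifier φ) : HasCompactSupport φ :=
  HasCompactSupport.intro (isCompact_closedBall 0 1) fun x hx =>
    hφ.apply_eq_zero (by simpa using (not_le.1 (fun h => hx (by simpa using h))).le)

lemma IsMollifier.integrable {φ : E m → ℝ} (hφ : IsMollifier φ) : Integrable φ :=
  hφ.smooth.continuous.integrable_of_hasCompactSupport hφ.hasCompactSupport

/-- The scale derivative of the mollification of an almost harmonic function. -/
lemma WeaklyHarmonicUpTo.abs_integral_mul_lineDeriv_le {h g : E m → ℝ} {D : Set (E m)} {L : ℝ≥0}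
    (hW : WeaklyHarmonicUpTo h g D) (hh : LipschitzWith L h) {φ θ : E m → ℝ}
    (hθ : ContDiff ℝ 1 θ) (hθ0 : ∀ x, 1 ≤ ‖x‖ → θ x = 0)
    (hθφ : ∀ x ξ, fderiv ℝ θ x ξ = φ x * ⟪x, ξ⟫) {y : E m} {r : ℝ} (hr : 0 < r)
    (hyD : closedBall y r ⊆ D) :
    |∫ x, φ x * lineDeriv ℝ h (y - r • x) (-x)| ≤ ∫ x, g (y - r • x) * ‖fderiv ℝ θ x‖ := by
  -- The potential θ rescaled to the ball of radius r about y. By the chain rule, pairing its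
  -- gradient with that of h gives r^(m-1) times the scale derivative.
  set η : E m → ℝ := fun w => θ (r⁻¹ • (y - w)) with hηdef
  have hη : ContDiff ℝ 1 η := by
    have : ContDiff ℝ 1 fun w : E m => r⁻¹ • (y - w) := by fun_prop
    exact hθ.comp this
  have hsub : Function.support η ⊆ closedBall y r := fun w hw => by
    by_contra hwr
    refine hw (hθ0 _ ?_)
    rw [norm_smul, norm_inv, Real.norm_of_nonneg hr.le, ← dist_eq_norm, dist_comm]
    rw [mem_closedBall, not_le] at hwr
    rw [le_inv_mul_iff₀ hr, mul_one]
    exact hwr.le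
  have hcpt : HasCompactSupport η :=
    HasCompactSupport.of_support_subset_isCompact (isCompact_closedBall y r) hsub
  have hsupp : tsupport η ⊆ D := (closure_minimal hsub isClosed_closedBall).trans hyD
  have hder : ∀ w, fderiv ℝ η w = -r⁻¹ • fderiv ℝ θ (r⁻¹ • (y - w)) := fun w => by
    have h1 : HasFDerivAt (fun w : E m => r⁻¹ • (y - w))
        (r⁻¹ • (-ContinuousLinearMap.id ℝ (E m))) w :=
      ((hasFDerivAt_id w).const_sub y).const_smul r⁻¹
    have h2 := ((hθ.differentiable one_ne_zero _).hasFDerivAt.comp w h1).fderiv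
    ext ξ
    have h3 := congrArg (fun T : E m →L[ℝ] ℝ => T ξ) h2
    refine h3.trans ?_
    simp
  have key := hW η hη hcpt hsupp
  have e1 : ∫ w, ∑ i, fderiv ℝ h w (basisVec i) * fderiv ℝ η w (basisVec i) =
      r ^ m * r⁻¹ * ∫ x, φ x * lineDeriv ℝ h (y - r • x) (-x) := by
    have e2 := integral_eq_pow_mul_integral_sub_smul
      (fun w => φ (r⁻¹ • (y - w)) * lineDeriv ℝ h w (-(r⁻¹ • (y - w)))) y hr
    have e3 : ∀ x : E m, r⁻¹ • (y - (y - r • x)) = x := fun x => by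
      rw [sub_sub_cancel, smul_smul, inv_mul_cancel₀ hr.ne', one_smul]
    simp only [e3] at e2
    rw [mul_comm (r ^ m), mul_assoc, ← e2, ← integral_const_mul]
    refine integral_congr_ae ?_
    filter_upwards [hh.ae_differentiableAt (μ := volume)] with w hw
    rw [hw.lineDeriv_eq_fderiv, map_neg]
    set z := r⁻¹ • (y - w) with hz
    have e4 : fderiv ℝ h w z = ∑ i, z i * fderiv ℝ h w (basisVec i) := by
      conv_lhs => rw [← sum_smul_basisVec z, map_sum]
      simp
    rw [e4, hder]
    simp only [← hz]
    rw [mul_neg, Finset.mul_sum, mul_neg, Finset.mul_sum, ← Finset.sum_neg_distrib]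
    refine Finset.sum_congr rfl fun i _ => ?_
    have e5 : (-r⁻¹ • fderiv ℝ θ z) (basisVec i) = -r⁻¹ * (φ z * z i) := by
      have : ⟪z, basisVec i⟫ = z i := by
        rw [basisVec, EuclideanSpace.inner_single_right]; simp
      rw [← this, ← hθφ]; rfl
    rw [e5]
    ring
  have e6 : ∫ w, g w * ‖fderiv ℝ η w‖ = r ^ m * r⁻¹ * ∫ x, g (y - r • x) * ‖fderiv ℝ θ x‖ := by
    rw [integral_eq_pow_mul_integral_sub_smul _ y hr, mul_assoc]
    congr 1
    rw [← integral_const_mul]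
    refine integral_congr_ae (Filter.Eventually.of_forall fun x => ?_)
    simp only
    rw [hder, sub_sub_cancel, smul_smul, inv_mul_cancel₀ hr.ne', one_smul, norm_smul, norm_neg,
      norm_inv, Real.norm_of_nonneg hr.le]
    ring
  rw [e1, e6, abs_mul, abs_of_pos (by positivity : 0 < r ^ m * r⁻¹)] at key
  exact le_of_mul_le_mul_left key (by positivity)

/-- The function r ↦ h(y - r x) is Lipschitz, hence absolutely continuous, so its increment is the
integral of its derivative; Fubini then exchanges the integrals in x and r. -/
lemma integral_mul_sub_eq_integral_lineDeriv {h : E m → ℝ} {L : ℝ≥0} (hh : LipschitzWith L h)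
    {φ : E m → ℝ} (hφ : IsMollifier φ) (y : E m) {ℓ : ℝ} (hℓ : 0 ≤ ℓ) :
    ∫ x, φ x * (h (y - ℓ • x) - h y) =
      ∫ r in Ioc 0 ℓ, ∫ x, φ x * lineDeriv ℝ h (y - r • x) (-x) := by
  have h1 : ∀ x, h (y - ℓ • x) - h y = ∫ r in Ioc 0 ℓ, lineDeriv ℝ h (y - r • x) (-x) := fun x => by
    have hlip : LipschitzWith (L * ‖x‖₊) fun r : ℝ => h (y - r • x) :=
      hh.comp (LipschitzWith.of_dist_le_mul fun r s => by
        rw [dist_eq_norm, sub_sub_sub_cancel_left, ← sub_smul, norm_smul, mul_comm, coe_nnnorm,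
          dist_comm, Real.dist_eq, Real.norm_eq_abs])
    have h2 := (hlip.lipschitzOnWith (s := uIcc 0 ℓ)).absolutelyContinuousOnInterval.integral_deriv_eq_sub
    rw [zero_smul, sub_zero] at h2
    rw [← h2, intervalIntegral.integral_of_le hℓ]
    refine integral_congr_ae (Filter.Eventually.of_forall fun r => ?_)
    simp only [lineDeriv]
    have h3 : (fun t : ℝ => h (y - r • x + t • -x)) = fun t => (fun s => h (y - s • x)) (r + t) := by
      funext t
      simp only [add_smul, smul_neg]
      congr 1
      abel
    rw [h3]
    have h4 := deriv_comp_const_add (f := fun s => h (y - s • x)) r 0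
    rw [add_zero] at h4
    exact h4.symm
  simp_rw [h1, ← integral_const_mul]
  refine integral_integral_swap ?_
  have hm : Measurable fun z : E m × ℝ => lineDeriv ℝ h (y - z.2 • z.1) (-z.1) :=
    (measurable_lineDeriv_uncurry hh.continuous).comp (f := fun z : E m × ℝ =>
      (y - z.2 • z.1, -z.1)) (by fun_prop)
  have hi : Integrable (fun z : E m × ℝ => (‖φ z.1‖ * ‖z.1‖) * (L : ℝ))
      (volume.prod (volume.restrict (Ioc 0 ℓ))) := by
    have a1 : Integrable fun x : E m => ‖φ x‖ * ‖x‖ :=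
      (hφ.smooth.continuous.norm.mul continuous_norm).integrable_of_hasCompactSupport
        (hφ.hasCompactSupport.norm.mul_right)
    have a2 : Integrable (fun _ : ℝ => (L : ℝ)) (volume.restrict (Ioc 0 ℓ)) :=
      integrableOn_const (by simp)
    exact a1.mul_prod a2
  refine hi.mono' ?_ (Filter.Eventually.of_forall fun z => ?_)
  · exact ((hφ.smooth.continuous.measurable.comp measurable_fst).mul hm).aestronglyMeasurable
  · simp only [Function.uncurry]
    rw [norm_mul, mul_assoc]
    gcongr
    refine (norm_lineDeriv_le_of_lipschitz ℝ hh).trans ?_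
    rw [norm_neg, mul_comm]

/-- The `L¹` distance of an almost harmonic function from its mollification. -/
theorem WeaklyHarmonicUpTo.lintegral_mollify_sub_le {h g : E m → ℝ} {D S : Set (E m)} {L : ℝ≥0}
    (hW : WeaklyHarmonicUpTo h g D) (hh : LipschitzWith L h) (hg : Measurable g)
    (hg0 : ∀ y, 0 ≤ g y) (hgi : Integrable g) {φ θ : E m → ℝ} (hφ : IsMollifier φ)
    (hθ : ContDiff ℝ 1 θ) (hθ0 : ∀ x, 1 ≤ ‖x‖ → θ x = 0)
    (hθφ : ∀ x ξ, fderiv ℝ θ x ξ = φ x * ⟪x, ξ⟫) {ℓ : ℝ} (hℓ : 0 ≤ ℓ)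
    (hS : MeasurableSet S) (hSD : ∀ y ∈ S, closedBall y ℓ ⊆ D) :
    ∫⁻ y in S, ‖∫ x, φ x * (h (y - ℓ • x) - h y)‖ₑ ≤
      ENNReal.ofReal (ℓ * ((∫ y, g y) * ∫ x, ‖fderiv ℝ θ x‖)) := by
  have hθc : HasCompactSupport θ :=
    HasCompactSupport.intro (isCompact_closedBall 0 1) fun x hx =>
      hθ0 x (by simpa using (not_le.1 (fun h => hx (by simpa using h))).le)
  have hθi : Integrable fun x => ‖fderiv ℝ θ x‖ :=
    (hθ.continuous_fderiv one_ne_zero).norm.integrable_of_hasCompactSupport (hθc.fderiv ℝ).norm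
  have hθm : Measurable fun x => ‖fderiv ℝ θ x‖ := (measurable_fderiv ℝ θ).norm
  set k : E m → ℝ → E m → ℝ≥0∞ := fun y r x =>
    ENNReal.ofReal (g (y - r • x)) * ENNReal.ofReal ‖fderiv ℝ θ x‖
  have hpt : ∀ y ∈ S, ‖∫ x, φ x * (h (y - ℓ • x) - h y)‖ₑ ≤ ∫⁻ r in Ioc 0 ℓ, ∫⁻ x, k y r x := by
    intro y hy
    rw [integral_mul_sub_eq_integral_lineDeriv hh hφ y hℓ]
    refine (enorm_integral_le_lintegral_enorm _).trans ?_
    refine setLIntegral_mono' measurableSet_Ioc fun r hr => ?_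
    have h1 := hW.abs_integral_mul_lineDeriv_le hh hθ hθ0 hθφ hr.1
      ((closedBall_subset_closedBall hr.2).trans (hSD y hy))
    rw [← ofReal_norm, Real.norm_eq_abs]
    refine (ENNReal.ofReal_le_ofReal h1).trans ?_
    by_cases hint : Integrable fun x => g (y - r • x) * ‖fderiv ℝ θ x‖
    · rw [ofReal_integral_eq_lintegral_ofReal hint
        (Filter.Eventually.of_forall fun x => mul_nonneg (hg0 _) (norm_nonneg _))]
      refine lintegral_mono fun x => ?_
      rw [ENNReal.ofReal_mul (hg0 _)]
    -- Without integrability the Bochner integral is 0, and the bound is trivial.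
    · rw [integral_undef hint]; simp
  have hkm : Measurable fun z : (E m × ℝ) × E m => k z.1.1 z.1.2 z.2 := by
    have h1 : Measurable fun z : (E m × ℝ) × E m => z.1.1 - z.1.2 • z.2 := by fun_prop
    exact (hg.comp h1).ennreal_ofReal.mul (hθm.comp measurable_snd).ennreal_ofReal
  have hkm2 : Measurable fun z : E m × ℝ => ∫⁻ x, k z.1 z.2 x := hkm.lintegral_prod_right'
  -- Integrating in y first and using translation invariance makes the bound independent of r, so
  -- the integral over r only contributes the factor ℓ.
  have hkr : ∀ r : ℝ, ∫⁻ y, ∫⁻ x, k y r x =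
      ENNReal.ofReal (∫ y, g y) * ENNReal.ofReal (∫ x, ‖fderiv ℝ θ x‖) := fun r => by
    rw [lintegral_lintegral_swap]
    · have h1 : ∀ x, ∫⁻ y, k y r x =
          ENNReal.ofReal (∫ y, g y) * ENNReal.ofReal ‖fderiv ℝ θ x‖ := fun x => by
        simp only [k]
        rw [lintegral_mul_const _ (by fun_prop),
          lintegral_sub_right_eq_self (fun y => ENNReal.ofReal (g y)) (r • x),
          ofReal_integral_eq_lintegral_ofReal hgi (Filter.Eventually.of_forall hg0)]
      simp_rw [h1]
      rw [lintegral_const_mul _ hθm.ennreal_ofReal, ofReal_integral_eq_lintegral_ofReal hθi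
        (Filter.Eventually.of_forall fun x => norm_nonneg _)]
    · exact (hkm.comp (f := fun z : E m × E m => ((z.1, r), z.2)) (by fun_prop)).aemeasurable
  calc ∫⁻ y in S, ‖∫ x, φ x * (h (y - ℓ • x) - h y)‖ₑ
      ≤ ∫⁻ y in S, ∫⁻ r in Ioc 0 ℓ, ∫⁻ x, k y r x := setLIntegral_mono' hS hpt
    _ ≤ ∫⁻ y, ∫⁻ r in Ioc 0 ℓ, ∫⁻ x, k y r x := setLIntegral_le_lintegral _ _
    _ = ∫⁻ r in Ioc 0 ℓ, ∫⁻ y, ∫⁻ x, k y r x := lintegral_lintegral_swap hkm2.aemeasurable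
    _ = _ := by
      simp_rw [hkr]
      rw [setLIntegral_const, Real.volume_Ioc, sub_zero, mul_comm, ENNReal.ofReal_mul hℓ,
        ENNReal.ofReal_mul (integral_nonneg hg0)]

/-! ### Derivatives of convolutions -/

open scoped Laplacian

lemma contDiff_infty_iteratedFDeriv {V : Type*} [NormedAddCommGroup V] [NormedSpace ℝ V]
    {z : E m → V} (hz : ContDiff ℝ ∞ z) (j : ℕ) : ContDiff ℝ ∞ (iteratedFDeriv ℝ j z) :=
  hz.iteratedFDeriv_right (by exact_mod_cast le_top)

lemma contDiff_iteratedFDeriv_apply {ψ : E m → ℝ} (hψ : ContDiff ℝ ∞ ψ) (j : ℕ)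
    (v : Fin j → E m) : ContDiff ℝ ∞ fun t => iteratedFDeriv ℝ j ψ t v :=
  (ContinuousMultilinearMap.apply ℝ (fun _ : Fin j => E m) ℝ v).contDiff.comp
    (contDiff_infty_iteratedFDeriv hψ j)

lemma hasCompactSupport_iteratedFDeriv_apply {ψ : E m → ℝ} (hψ : HasCompactSupport ψ) (j : ℕ)
    (v : Fin j → E m) : HasCompactSupport fun t => iteratedFDeriv ℝ j ψ t v :=
  (hψ.iteratedFDeriv (𝕜 := ℝ) j).comp_left
    (g := fun T : ContinuousMultilinearMap ℝ (fun _ : Fin j => E m) ℝ => T v) rfl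

lemma fderiv_iteratedFDeriv_apply {V : Type*} [NormedAddCommGroup V] [NormedSpace ℝ V]
    {z : E m → V} (hz : ContDiff ℝ ∞ z) (j : ℕ) (v : Fin (j + 1) → E m) (y : E m) :
    iteratedFDeriv ℝ (j + 1) z y v =
      fderiv ℝ (fun w => iteratedFDeriv ℝ j z w (Fin.tail v)) y (v 0) := by
  have h : DifferentiableAt ℝ (iteratedFDeriv ℝ j z) y :=
    (contDiff_infty_iteratedFDeriv hz j).differentiable (by simp) y
  exact h.iteratedFDeriv_succ_apply_left'

lemma contDiff_convolution {ψ : E m → ℝ} (hψ : ContDiff ℝ ∞ ψ) (hc : HasCompactSupport ψ)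
    {F : E m → E n} (hF : Continuous F) :
    ContDiff ℝ ∞ (convolution ψ F (ContinuousLinearMap.lsmul ℝ ℝ) volume) :=
  hc.contDiff_convolution_left (n := ⊤) _ hψ hF.locallyIntegrable

lemma fderiv_convolution_apply {ψ : E m → ℝ} (hψ : ContDiff ℝ ∞ ψ) (hc : HasCompactSupport ψ)
    {F : E m → E n} (hF : Continuous F) (y v : E m) :
    fderiv ℝ (convolution ψ F (ContinuousLinearMap.lsmul ℝ ℝ) volume) y v =
      convolution (fun t => fderiv ℝ ψ t v) F (ContinuousLinearMap.lsmul ℝ ℝ) volume y := by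
  rw [(hc.hasFDerivAt_convolution_left (ContinuousLinearMap.lsmul ℝ ℝ)
    (hψ.of_le (by exact_mod_cast le_top)) (hF.locallyIntegrable (μ := volume)) y).fderiv]
  have hi := (hc.fderiv ℝ).convolutionExists_left
    (ContinuousLinearMap.precompL (E m) (ContinuousLinearMap.lsmul ℝ ℝ : ℝ →L[ℝ] E n →L[ℝ] E n))
    (hψ.continuous_fderiv (by simp)) (hF.locallyIntegrable (μ := volume)) y
  simp only [convolution]
  rw [ContinuousLinearMap.integral_apply hi]
  rfl

lemma iteratedFDeriv_convolution_apply {ψ : E m → ℝ} (hψ : ContDiff ℝ ∞ ψ)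
    (hc : HasCompactSupport ψ) {F : E m → E n} (hF : Continuous F) (j : ℕ) (v : Fin j → E m)
    (y : E m) :
    iteratedFDeriv ℝ j (convolution ψ F (ContinuousLinearMap.lsmul ℝ ℝ) volume) y v =
      convolution (fun t => iteratedFDeriv ℝ j ψ t v) F (ContinuousLinearMap.lsmul ℝ ℝ) volume y := by
  induction j generalizing y with
  | zero => simp
  | succ j ih =>
    rw [fderiv_iteratedFDeriv_apply (contDiff_convolution hψ hc hF)]
    simp_rw [ih]
    rw [fderiv_convolution_apply (contDiff_iteratedFDeriv_apply hψ j _)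
      (hasCompactSupport_iteratedFDeriv_apply hc j _) hF]
    simp_rw [fderiv_iteratedFDeriv_apply hψ]

/-- Evaluation on v is continuous and linear, so it commutes with Δ; afterwards all derivatives fall
on the kernel. -/
lemma laplacian_iteratedFDeriv_convolution_apply {ψ : E m → ℝ} (hψ : ContDiff ℝ ∞ ψ)
    (hc : HasCompactSupport ψ) {F : E m → E n} (hF : Continuous F) (j : ℕ) (v : Fin j → E m)
    (y : E m) :
    Δ (iteratedFDeriv ℝ j (convolution ψ F (ContinuousLinearMap.lsmul ℝ ℝ) volume)) y v =
      ∫ t, (∑ i, fderiv ℝ (fun w => fderiv ℝ (fun s => iteratedFDeriv ℝ j ψ s v) w (basisVec i))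
        (y - t) (basisVec i)) • F t := by
  set z := convolution ψ F (ContinuousLinearMap.lsmul ℝ ℝ) volume
  have hz : ContDiff ℝ ∞ z := contDiff_convolution hψ hc hF
  set ψv : E m → ℝ := fun s => iteratedFDeriv ℝ j ψ s v
  have hψv : ContDiff ℝ ∞ ψv := contDiff_iteratedFDeriv_apply hψ j v
  have hcv : HasCompactSupport ψv := hasCompactSupport_iteratedFDeriv_apply hc j v
  have h1 := ((contDiff_infty.1 (contDiff_infty_iteratedFDeriv hz j) 2).contDiffAt (x := y)).laplacian_CLM_comp_left
    (l := ContinuousMultilinearMap.apply ℝ (fun _ : Fin j => E m) (E n) v)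
  have h2 : (ContinuousMultilinearMap.apply ℝ (fun _ : Fin j => E m) (E n) v) ∘
      iteratedFDeriv ℝ j z = convolution ψv F (ContinuousLinearMap.lsmul ℝ ℝ) volume :=
    funext fun w => iteratedFDeriv_convolution_apply hψ hc hF j v w
  rw [h2] at h1
  refine h1.symm.trans ?_
  rw [InnerProductSpace.laplacian_eq_iteratedFDeriv_orthonormalBasis _
    (EuclideanSpace.basisFun (Fin m) ℝ)]
  have hd : ∀ i : Fin m, ContDiff ℝ ∞ fun w => fderiv ℝ ψv w (basisVec i) := fun i =>
    (hψv.fderiv_right (m := ∞) (by simp)).clm_apply contDiff_const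
  have hdc : ∀ i : Fin m, HasCompactSupport fun w => fderiv ℝ ψv w (basisVec i) := fun i =>
    hcv.fderiv_apply ℝ _
  have h3 : ∀ i : Fin m, iteratedFDeriv ℝ 2
      (convolution ψv F (ContinuousLinearMap.lsmul ℝ ℝ) volume) y ![basisVec i, basisVec i] =
      ∫ t, fderiv ℝ (fun w => fderiv ℝ ψv w (basisVec i)) (y - t) (basisVec i) • F t := fun i => by
    rw [fderiv_iteratedFDeriv_apply (contDiff_convolution hψv hcv hF)]
    have h4 : (fun w => iteratedFDeriv ℝ 1
        (convolution ψv F (ContinuousLinearMap.lsmul ℝ ℝ) volume) w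
          (Fin.tail ![basisVec i, basisVec i])) =
        convolution (fun t => fderiv ℝ ψv t (basisVec i)) F (ContinuousLinearMap.lsmul ℝ ℝ)
          volume := by
      funext w
      rw [iteratedFDeriv_one_apply, ← fderiv_convolution_apply hψv hcv hF]
      rfl
    rw [h4, fderiv_convolution_apply (hd i) (hdc i) hF, convolution_eq_swap]
    rfl
  simp only [EuclideanSpace.basisFun_apply]
  refine (Finset.sum_congr rfl fun i _ => h3 i).trans ?_
  rw [← integral_finsetSum]
  · simp_rw [Finset.sum_smul]
  · intro i _
    have hcont : Continuous fun w => fderiv ℝ (fun w => fderiv ℝ ψv w (basisVec i)) w (basisVec i) :=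
      ((hd i).continuous_fderiv (by simp)).clm_apply continuous_const
    have := ((hdc i).fderiv_apply ℝ (basisVec i)).convolutionExists_left
      (ContinuousLinearMap.lsmul ℝ ℝ : ℝ →L[ℝ] E n →L[ℝ] E n) hcont
      (hF.locallyIntegrable (μ := volume)) y
    exact this.integrable_swap

/-! ### Bounds for the Laplacian of a mollification -/

lemma norm_le_of_forall_abs_apply_le {w : E n} {c : ℝ} (h : ∀ a, |w a| ≤ c) : ‖w‖ ≤ n * c := by
  calc ‖w‖ = ‖∑ a, w a • basisVec a‖ := by rw [sum_smul_basisVec]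
    _ ≤ ∑ a : Fin n, ‖w a • basisVec a‖ := norm_sum_le _ _
    _ ≤ ∑ _a : Fin n, c := Finset.sum_le_sum fun a _ => by
        rw [norm_smul, norm_basisVec, mul_one]; exact h a
    _ = n * c := by simp

lemma continuous_sum_fderiv_fderiv {η : E m → ℝ} (hη : ContDiff ℝ ∞ η)
    (hc : HasCompactSupport η) :
    Continuous (fun w => ∑ i, fderiv ℝ (fun w => fderiv ℝ η w (basisVec i)) w (basisVec i)) ∧
      HasCompactSupport
        fun w => ∑ i, fderiv ℝ (fun w => fderiv ℝ η w (basisVec i)) w (basisVec i) := by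
  have hd : ∀ i : Fin m, ContDiff ℝ ∞ fun w => fderiv ℝ η w (basisVec i) := fun i =>
    (hη.fderiv_right (m := ∞) (by simp)).clm_apply contDiff_const
  refine ⟨continuous_finsetSum _ fun i _ =>
    ((hd i).continuous_fderiv (by simp)).clm_apply continuous_const, ?_⟩
  refine HasCompactSupport.intro hc fun w hw => Finset.sum_eq_zero fun i _ => ?_
  have h1 : tsupport (fun w => fderiv ℝ η w (basisVec i)) ⊆ tsupport η :=
    tsupport_fderiv_apply_subset ℝ _
  have h2 : tsupport (fun w => fderiv ℝ (fun w => fderiv ℝ η w (basisVec i)) w (basisVec i)) ⊆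
      tsupport (fun w => fderiv ℝ η w (basisVec i)) := tsupport_fderiv_apply_subset ℝ _
  by_contra h0
  exact hw (h1 (h2 (subset_tsupport _ h0)))

/-- For fixed v the reflected kernel w ↦ D^jψ(y - w)(v) is an admissible test function. Weak
harmonicity trades the two derivatives in Δ for one derivative on it, so D^(j+1)ψ enters and not
D^(j+2)ψ. -/
lemma norm_laplacian_iteratedFDeriv_convolution_le {ψ : E m → ℝ} (hψ : ContDiff ℝ ∞ ψ)
    {F : E m → E n} {L : ℝ≥0} (hF : LipschitzWith L F) {g : E m → ℝ} {D : Set (E m)}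
    (hg0 : ∀ y, 0 ≤ g y) (hgi : Integrable g)
    (hW : ∀ a, WeaklyHarmonicUpTo (fun y => F y a) g D) {ℓ : ℝ}
    (hsupp : tsupport ψ ⊆ closedBall 0 ℓ) {y : E m} (hyD : closedBall y ℓ ⊆ D) (j : ℕ) {K : ℝ}
    (hK : ∀ t, ‖iteratedFDeriv ℝ (j + 1) ψ t‖ ≤ K) :
    ‖Δ (iteratedFDeriv ℝ j (convolution ψ F (ContinuousLinearMap.lsmul ℝ ℝ) volume)) y‖ ≤
      n * (K * ∫ w, g w) := by
  have hK0 : 0 ≤ K := (norm_nonneg _).trans (hK 0)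
  have hg1 : 0 ≤ ∫ w, g w := integral_nonneg hg0
  have hc : HasCompactSupport ψ :=
    (isCompact_closedBall 0 ℓ).of_isClosed_subset (isClosed_tsupport ψ) hsupp
  refine ContinuousMultilinearMap.opNorm_le_bound (by positivity) fun v => ?_
  rw [laplacian_iteratedFDeriv_convolution_apply hψ hc hF.continuous, mul_assoc]
  set ψv : E m → ℝ := fun s => iteratedFDeriv ℝ j ψ s v
  have hψv : ContDiff ℝ ∞ ψv := contDiff_iteratedFDeriv_apply hψ j v
  have hcv : HasCompactSupport ψv := hasCompactSupport_iteratedFDeriv_apply hc j v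
  have hsv : tsupport ψv ⊆ closedBall 0 ℓ := by
    refine (closure_mono fun s hs => ?_).trans ((tsupport_iteratedFDeriv_subset (𝕜 := ℝ) j).trans hsupp)
    intro h0
    exact hs (by simp only [ψv]; rw [h0]; rfl)
  have hψvn : ∀ t, ‖fderiv ℝ ψv t‖ ≤ K * ∏ i, ‖v i‖ := fun t => by
    refine ContinuousLinearMap.opNorm_le_bound _ (by positivity) fun ξ => ?_
    -- Placing the new direction ξ before v identifies the gradient of ψv with a slice of D^(j+1)ψ.
    have h1 := fderiv_iteratedFDeriv_apply hψ j (Fin.cons ξ v) t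
    rw [Fin.tail_cons, Fin.cons_zero] at h1
    have h2 : fderiv ℝ ψv t ξ = iteratedFDeriv ℝ (j + 1) ψ t (Fin.cons ξ v) := h1.symm
    rw [h2]
    refine ((iteratedFDeriv ℝ (j + 1) ψ t).le_opNorm _).trans ?_
    rw [Fin.prod_univ_succ]
    simp only [Fin.cons_zero, Fin.cons_succ]
    calc _ ≤ K * (‖ξ‖ * ∏ i, ‖v i‖) := by gcongr; exact hK t
      _ = _ := by ring
  set η : E m → ℝ := fun w => ψv (y - w) with hηdef
  have hη : ContDiff ℝ ∞ η := hψv.comp (contDiff_const.sub contDiff_id)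
  have hηf : ∀ {k : E m → ℝ} (_ : Differentiable ℝ k) w ξ,
      fderiv ℝ (fun w => k (y - w)) w ξ = -fderiv ℝ k (y - w) ξ := fun {k} hk w ξ => by
    have h1 : HasFDerivAt (fun w : E m => y - w) (-ContinuousLinearMap.id ℝ (E m)) w :=
      (hasFDerivAt_id w).const_sub y
    have h2 := ((hk (y - w)).hasFDerivAt.comp w h1).fderiv
    have h3 := congrArg (fun T : E m →L[ℝ] ℝ => T ξ) h2
    refine h3.trans ?_
    simp
  have hηs : Function.support η ⊆ closedBall y ℓ := fun w hw => by
    have := hsv (subset_tsupport _ hw)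
    rwa [mem_closedBall_zero_iff, ← dist_eq_norm, dist_comm] at this
  have hηc : HasCompactSupport η :=
    HasCompactSupport.of_support_subset_isCompact (isCompact_closedBall y ℓ) hηs
  have hηD : tsupport η ⊆ D := (closure_minimal hηs isClosed_closedBall).trans hyD
  have hd : ∀ i : Fin m, ContDiff ℝ ∞ fun w => fderiv ℝ ψv w (basisVec i) := fun i =>
    (hψv.fderiv_right (m := ∞) (by simp)).clm_apply contDiff_const
  have h2η : ∀ (i : Fin m) w, fderiv ℝ (fun w => fderiv ℝ η w (basisVec i)) w (basisVec i) =
      fderiv ℝ (fun w => fderiv ℝ ψv w (basisVec i)) (y - w) (basisVec i) := fun i w => by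
    have h1 : (fun w => fderiv ℝ η w (basisVec i)) =
        fun w => -(fun s => fderiv ℝ ψv s (basisVec i)) (y - w) :=
      funext fun w => hηf (hψv.differentiable (by simp)) w _
    rw [h1, fderiv_fun_neg]
    have h2 := hηf ((hd i).differentiable (by simp)) w (basisVec i)
    refine (congrArg Neg.neg h2).trans (neg_neg _)
  have hηn : ∀ w, ‖fderiv ℝ η w‖ ≤ K * ∏ i, ‖v i‖ := fun w => by
    refine ContinuousLinearMap.opNorm_le_bound _ (by positivity) fun ξ => ?_
    rw [hηf (hψv.differentiable (by simp)), norm_neg]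
    exact ((fderiv ℝ ψv (y - w)).le_opNorm _).trans (by gcongr; exact hψvn _)
  have hint : Integrable fun t => (∑ i, fderiv ℝ (fun w => fderiv ℝ ψv w (basisVec i))
      (y - t) (basisVec i)) • F t := by
    simp_rw [← h2η]
    obtain ⟨hsum, hcs⟩ := continuous_sum_fderiv_fderiv hη hηc
    have hprod := hsum.smul hF.continuous
    exact hprod.integrable_of_hasCompactSupport (HasCompactSupport.smul_right hcs)
  refine (norm_le_of_forall_abs_apply_le (c := K * (∫ w, g w) * ∏ i, ‖v i‖) fun a => ?_).trans
    (le_of_eq (by ring))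
  have e1 : (∫ t, (∑ i, fderiv ℝ (fun w => fderiv ℝ ψv w (basisVec i))
      (y - t) (basisVec i)) • F t) a =
      ∫ w, F w a * ∑ i, fderiv ℝ (fun w => fderiv ℝ η w (basisVec i)) w (basisVec i) := by
    have h1 := (EuclideanSpace.proj (𝕜 := ℝ) a : E n →L[ℝ] ℝ).integral_comp_comm hint
    refine h1.symm.trans (integral_congr_ae (Filter.Eventually.of_forall fun w => ?_))
    simp only [h2η]
    exact mul_comm _ _
  rw [e1]
  have hFa : LipschitzWith L fun y => F y a := LipschitzWith.of_dist_le_mul fun p q => by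
    refine le_trans ?_ (hF.dist_le_mul p q)
    rw [dist_eq_norm, dist_eq_norm]
    exact PiLp.norm_apply_le (F p - F q) a
  refine ((hW a).abs_integral_mul_laplacian_le hFa hη hηc hηD).trans ?_
  calc ∫ w, g w * ‖fderiv ℝ η w‖ ≤ ∫ w, g w * (K * ∏ i, ‖v i‖) := by
        refine integral_mono (hgi.mul_bdd (c := K * ∏ i, ‖v i‖)
          (hη.continuous_fderiv (by simp)).norm.aestronglyMeasurable
          (Filter.Eventually.of_forall fun y => by rw [norm_norm]; exact hηn y))
          (hgi.mul_const _) fun w => ?_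
        exact mul_le_mul_of_nonneg_left (hηn w) (hg0 w)
    _ = _ := by rw [integral_mul_const]; ring

/-! ### The mollification -/

lemma IsMollifier.contDiff_scaled {φ : E m → ℝ} (hφ : IsMollifier φ) (ℓ : ℝ) :
    ContDiff ℝ ∞ (scaled φ ℓ) := by
  have h : ContDiff ℝ ∞ fun x : E m => ℓ⁻¹ • x := by fun_prop
  exact contDiff_const.mul (hφ.smooth.comp h)

lemma IsMollifier.scaled_eq_zero {φ : E m → ℝ} (hφ : IsMollifier φ) {ℓ : ℝ} (hℓ : 0 < ℓ) {x : E m}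
    (hx : ℓ ≤ ‖x‖) : scaled φ ℓ x = 0 := by
  rw [scaled, hφ.apply_eq_zero, mul_zero]
  rw [norm_smul, norm_inv, Real.norm_of_nonneg hℓ.le, le_inv_mul_iff₀ hℓ, mul_one]
  exact hx

lemma IsMollifier.tsupport_scaled_subset {φ : E m → ℝ} (hφ : IsMollifier φ) {ℓ : ℝ} (hℓ : 0 < ℓ) :
    tsupport (scaled φ ℓ) ⊆ closedBall 0 ℓ := by
  refine closure_minimal (fun x hx => ?_) isClosed_closedBall
  by_contra h
  rw [mem_closedBall_zero_iff, not_le] at h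
  exact hx (hφ.scaled_eq_zero hℓ h.le)

lemma IsMollifier.hasCompactSupport_scaled {φ : E m → ℝ} (hφ : IsMollifier φ) {ℓ : ℝ}
    (hℓ : 0 < ℓ) : HasCompactSupport (scaled φ ℓ) :=
  (isCompact_closedBall 0 ℓ).of_isClosed_subset (isClosed_tsupport _) (hφ.tsupport_scaled_subset hℓ)

lemma IsMollifier.exists_norm_iteratedFDeriv_le {φ : E m → ℝ} (hφ : IsMollifier φ) (j : ℕ) :
    ∃ M, ∀ x, ‖iteratedFDeriv ℝ j φ x‖ ≤ M :=
  (hφ.hasCompactSupport.iteratedFDeriv (𝕜 := ℝ) j).exists_bound_of_continuous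
    (contDiff_infty_iteratedFDeriv hφ.smooth j).continuous

lemma IsMollifier.norm_iteratedFDeriv_scaled_le {φ : E m → ℝ} (hφ : IsMollifier φ) {ℓ : ℝ}
    (hℓ : 0 < ℓ) {j : ℕ} {M : ℝ} (hM : ∀ x, ‖iteratedFDeriv ℝ j φ x‖ ≤ M) (x : E m) :
    ‖iteratedFDeriv ℝ j (scaled φ ℓ) x‖ ≤ (ℓ ^ m)⁻¹ * ((ℓ ^ j)⁻¹ * M) := by
  have h : ContDiff ℝ ∞ fun x : E m => ℓ⁻¹ • x := by fun_prop
  have hc : ContDiff ℝ ∞ fun x => φ (ℓ⁻¹ • x) := hφ.smooth.comp h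
  have h1 : iteratedFDeriv ℝ j (scaled φ ℓ) x =
      (ℓ ^ m)⁻¹ • iteratedFDeriv ℝ j (fun x => φ (ℓ⁻¹ • x)) x :=
    iteratedFDeriv_const_smul_apply' (a := (ℓ ^ m)⁻¹) ((contDiff_infty.1 hc j).contDiffAt)
  rw [h1, iteratedFDeriv_comp_const_smul _ (contDiff_infty.1 hφ.smooth j), norm_smul, norm_smul,
    norm_inv, norm_pow, norm_pow, norm_inv, Real.norm_of_nonneg hℓ.le, inv_pow]
  gcongr
  exact hM _

lemma IsMollifier.mollify_congr {φ : E m → ℝ} (hφ : IsMollifier φ) {ℓ : ℝ} (hℓ : 0 < ℓ)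
    {f F : E m → E n} {y : E m} (h : EqOn f F (ball y ℓ)) : mollify φ ℓ f y = mollify φ ℓ F y := by
  refine integral_congr_ae (Filter.Eventually.of_forall fun t => ?_)
  simp only [ContinuousLinearMap.lsmul_apply]
  rcases le_or_gt ℓ ‖t‖ with ht | ht
  · rw [hφ.scaled_eq_zero hℓ ht, zero_smul, zero_smul]
  · rw [h (by rw [mem_ball, dist_eq_norm, sub_sub_cancel_left, norm_neg]; exact ht)]

/-- The substitution t = ℓ x removes the scaling of the kernel, and ∫ φ = 1 absorbs the constant
F(y). -/
lemma IsMollifier.mollify_sub_eq_integral {φ : E m → ℝ} (hφ : IsMollifier φ) {ℓ : ℝ} (hℓ : 0 < ℓ)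
    {F : E m → E n} (hF : Continuous F) (y : E m) :
    mollify φ ℓ F y - F y = ∫ x, φ x • (F (y - ℓ • x) - F y) := by
  have h1 := Measure.integral_comp_smul volume (fun t => scaled φ ℓ t • F (y - t)) ℓ
  rw [finrank_euclideanSpace_fin, abs_of_pos (by positivity)] at h1
  have h2 : mollify φ ℓ F y = ∫ x, φ x • F (y - ℓ • x) := by
    have h3 : mollify φ ℓ F y = ∫ t, scaled φ ℓ t • F (y - t) := rfl
    rw [h3, ← inv_smul_smul₀ (pow_ne_zero m hℓ.ne') (∫ t, scaled φ ℓ t • F (y - t)), smul_comm,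
      ← h1, ← integral_smul]
    refine integral_congr_ae (Filter.Eventually.of_forall fun x => ?_)
    simp only [scaled]
    rw [smul_smul ℓ⁻¹, inv_mul_cancel₀ hℓ.ne', one_smul, smul_smul, ← mul_assoc,
      mul_inv_cancel₀ (pow_ne_zero m hℓ.ne'), one_mul]
  have hc : Continuous fun x => F (y - ℓ • x) := by fun_prop
  have i1 : Integrable fun x => φ x • F (y - ℓ • x) :=
    (hφ.smooth.continuous.smul hc).integrable_of_hasCompactSupport hφ.hasCompactSupport.smul_right
  simp_rw [smul_sub]
  rw [integral_sub i1 (hφ.integrable.smul_const _), integral_smul_const, hφ.integral_eq_one,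
    one_smul, h2]

theorem IsMollifier.setIntegral_norm_mollify_sub_le {φ θ : E m → ℝ} (hφ : IsMollifier φ)
    (hθ : ContDiff ℝ 1 θ) (hθ0 : ∀ x, 1 ≤ ‖x‖ → θ x = 0)
    (hθφ : ∀ x ξ, fderiv ℝ θ x ξ = φ x * ⟪x, ξ⟫) {F : E m → E n} {L : ℝ≥0}
    (hF : LipschitzWith L F) {g : E m → ℝ} {D : Set (E m)} (hg : Measurable g)
    (hg0 : ∀ y, 0 ≤ g y) (hgi : Integrable g)
    (hW : ∀ a, WeaklyHarmonicUpTo (fun y => F y a) g D) {ℓ : ℝ} (hℓ : 0 < ℓ) {x : E m} {s : ℝ}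
    (hD : ∀ y ∈ ball x s, closedBall y ℓ ⊆ D) :
    IntegrableOn (fun y => mollify φ ℓ F y - F y) (ball x s) ∧
      ∫ y in ball x s, ‖mollify φ ℓ F y - F y‖ ≤
        n * (ℓ * ((∫ y, g y) * ∫ x, ‖fderiv ℝ θ x‖)) := by
  have hcont : Continuous fun y => mollify φ ℓ F y - F y :=
    (contDiff_convolution (hφ.contDiff_scaled ℓ) (hφ.hasCompactSupport_scaled hℓ)
      hF.continuous).continuous.sub hF.continuous
  have hon : ∀ {V : Type} [NormedAddCommGroup V] {k : E m → V}, Continuous k →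
      IntegrableOn k (ball x s) := fun hk =>
    (hk.continuousOn.integrableOn_compact (isCompact_closedBall x s)).mono_set ball_subset_closedBall
  refine ⟨hon hcont, ?_⟩
  have hca : ∀ a : Fin n, Continuous fun y => (mollify φ ℓ F y - F y) a := fun a =>
    (EuclideanSpace.proj (𝕜 := ℝ) a : E n →L[ℝ] ℝ).continuous.comp hcont
  have hFa : ∀ a, LipschitzWith L fun y => F y a := fun a =>
    LipschitzWith.of_dist_le_mul fun p q => by
      refine le_trans ?_ (hF.dist_le_mul p q)
      rw [dist_eq_norm, dist_eq_norm]
      exact PiLp.norm_apply_le (F p - F q) a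
  have hb : 0 ≤ ℓ * ((∫ y, g y) * ∫ x, ‖fderiv ℝ θ x‖) :=
    mul_nonneg hℓ.le (mul_nonneg (integral_nonneg hg0) (integral_nonneg fun x => norm_nonneg _))
  have key : ∀ a, ∫ y in ball x s, |(mollify φ ℓ F y - F y) a| ≤
      ℓ * ((∫ y, g y) * ∫ x, ‖fderiv ℝ θ x‖) := fun a => by
    have h1 := (hW a).lintegral_mollify_sub_le (hFa a) hg hg0 hgi hφ hθ hθ0 hθφ hℓ.le
      (S := ball x s) measurableSet_ball hD
    have h2 : ∀ y, ∫ x, φ x * (F (y - ℓ • x) a - F y a) = (mollify φ ℓ F y - F y) a := fun y => by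
      have hc : Continuous fun x => F (y - ℓ • x) - F y :=
        (hF.continuous.comp (by fun_prop)).sub continuous_const
      have hi : Integrable fun x => φ x • (F (y - ℓ • x) - F y) :=
        (hφ.smooth.continuous.smul hc).integrable_of_hasCompactSupport
          hφ.hasCompactSupport.smul_right
      rw [hφ.mollify_sub_eq_integral hℓ hF.continuous]
      exact (EuclideanSpace.proj (𝕜 := ℝ) a : E n →L[ℝ] ℝ).integral_comp_comm hi
    simp_rw [h2] at h1
    have h3 := integral_norm_eq_lintegral_enorm
      (hca a).aestronglyMeasurable (μ := volume.restrict (ball x s))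
    simp only [Real.norm_eq_abs] at h3
    rw [h3]
    exact ENNReal.toReal_le_of_le_ofReal hb h1
  calc ∫ y in ball x s, ‖mollify φ ℓ F y - F y‖
      ≤ ∫ y in ball x s, ∑ a, |(mollify φ ℓ F y - F y) a| := by
        refine integral_mono (hon hcont.norm) (integrable_finsetSum _ fun a _ => hon (hca a).abs)
          fun y => ?_
        calc ‖mollify φ ℓ F y - F y‖
            = ‖∑ a, (mollify φ ℓ F y - F y) a • basisVec a‖ := by rw [sum_smul_basisVec]
          _ ≤ ∑ a, ‖(mollify φ ℓ F y - F y) a • basisVec a‖ := norm_sum_le _ _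
          _ = ∑ a, |(mollify φ ℓ F y - F y) a| := by
            refine Finset.sum_congr rfl fun a _ => ?_
            rw [norm_smul, norm_basisVec, mul_one, Real.norm_eq_abs]
    _ = ∑ a, ∫ y in ball x s, |(mollify φ ℓ F y - F y) a| :=
        integral_finsetSum _ fun a _ => hon (hca a).abs
    _ ≤ ∑ _a : Fin n, ℓ * ((∫ y, g y) * ∫ x, ‖fderiv ℝ θ x‖) := Finset.sum_le_sum fun a _ => key a
    _ = _ := by simp

open scoped Laplacian in
/-- Mollification estimates for a Lipschitz map on a disk that is almost harmonic there. -/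
theorem IsMollifier.mollify_estimates {φ θ : E m → ℝ} (hφ : IsMollifier φ)
    (hθ : ContDiff ℝ 1 θ) (hθ0 : ∀ x, 1 ≤ ‖x‖ → θ x = 0)
    (hθφ : ∀ x ξ, fderiv ℝ θ x ξ = φ x * ⟪x, ξ⟫) {M : ℕ → ℝ}
    (hM : ∀ j x, ‖iteratedFDeriv ℝ j φ x‖ ≤ M j) {v f : E m → E n} {l : ℝ≥0} {x : E m}
    {r ρ s ℓ : ℝ} (hℓ : 0 < ℓ) (hsρ : s + ℓ ≤ ρ) (hρr : ρ ≤ r)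
    (hv : LipschitzOnWith 2 v (ball x r)) (hmin : VerticallyMinimizing v (ball x r))
    (hf : LipschitzOnWith l f (ball x ρ)) {I : ℝ}
    (hI : ∫ y, harmonicDefect v f (ball x ρ) y ≤ I) :
    (IntegrableOn (fun y => mollify φ ℓ f y - f y) (ball x s) ∧
      ∫ y in ball x s, ‖mollify φ ℓ f y - f y‖ ≤ n * (ℓ * (I * ∫ x, ‖fderiv ℝ θ x‖))) ∧
    (ContDiffOn ℝ ∞ (mollify φ ℓ f) (ball x s) ∧
      ∀ j : ℕ, ∀ y ∈ ball x s, ‖Δ (iteratedFDeriv ℝ j (mollify φ ℓ f)) y‖ ≤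
        n * ((ℓ ^ m)⁻¹ * ((ℓ ^ (j + 1))⁻¹ * M (j + 1)) * I)) := by
  -- A global Lipschitz extension. Mollification at scale ℓ on the ball of radius s sees f only
  -- within radius s + ℓ ≤ ρ, so passing to F changes nothing there, and the defect density on the
  -- ball of radius ρ is unchanged as well.
  obtain ⟨F, hF, hfF⟩ := hf.extend_finite_dimension
  have hFD : LipschitzOnWith l F (ball x ρ) := fun p hp q hq => by
    rw [← hfF hp, ← hfF hq]; exact hf hp hq
  have hDr : ball x ρ ⊆ ball x r := ball_subset_ball hρr
  have hdef : harmonicDefect v F (ball x ρ) = harmonicDefect v f (ball x ρ) := by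
    funext y
    by_cases hy : y ∈ ball x ρ
    · have : fderiv ℝ F y = fderiv ℝ f y :=
        ((hfF.eventuallyEq_of_mem (isOpen_ball.mem_nhds hy)).fderiv_eq).symm
      simp only [harmonicDefect, indicator_of_mem hy, this]
    · simp only [harmonicDefect, indicator_of_notMem hy]
  set g := harmonicDefect v F (ball x ρ)
  rw [← hdef] at hI
  have hg0 : ∀ y, 0 ≤ g y := harmonicDefect_nonneg v F _
  have hgm : Measurable g := measurable_harmonicDefect v F isOpen_ball.measurableSet
  have hgi : Integrable g :=
    integrable_harmonicDefect isOpen_ball measure_ball_lt_top.ne (hv.mono hDr) hFD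
  have hW : ∀ a, WeaklyHarmonicUpTo (fun y => F y a) g (ball x ρ) :=
    weaklyHarmonicUpTo_coord hF hg0 hgi fun κ hκ hc hs =>
      hmin.abs_integral_hsInner_approx_le isOpen_ball measure_ball_lt_top.ne isOpen_ball hDr hv hFD
        hκ hc hs
  have hcb : ∀ y ∈ ball x s, closedBall y ℓ ⊆ ball x ρ := fun y hy =>
    closedBall_subset_ball' (by rw [mem_ball] at hy; linarith)
  have hmol : EqOn (mollify φ ℓ f) (mollify φ ℓ F) (ball x s) := fun y hy =>
    hφ.mollify_congr hℓ (hfF.mono (ball_subset_closedBall.trans (hcb y hy)))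
  have hsF : EqOn f F (ball x s) := hfF.mono (ball_subset_ball (by linarith))
  have hsub : EqOn (fun y => mollify φ ℓ f y - f y) (fun y => mollify φ ℓ F y - F y) (ball x s) :=
    fun y hy => by simp only [hmol hy, hsF hy]
  obtain ⟨h1, h2⟩ := hφ.setIntegral_norm_mollify_sub_le hθ hθ0 hθφ hF hgm hg0 hgi hW hℓ hcb
  refine ⟨⟨h1.congr_fun hsub.symm measurableSet_ball, ?_⟩, ?_, fun j y hy => ?_⟩
  · rw [setIntegral_congr_fun measurableSet_ball fun y hy => congrArg norm (hsub hy)]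
    refine h2.trans ?_
    have : 0 ≤ ∫ x, ‖fderiv ℝ θ x‖ := integral_nonneg fun x => norm_nonneg _
    gcongr
  · exact (contDiff_convolution (hφ.contDiff_scaled ℓ) (hφ.hasCompactSupport_scaled hℓ)
      hF.continuous).contDiffOn.congr hmol
  · have h3 := (hmol.eventuallyEq_of_mem (isOpen_ball.mem_nhds hy)).iteratedFDeriv (𝕜 := ℝ) j
    rw [(InnerProductSpace.laplacian_congr_nhds h3).eq_of_nhds]
    have hMj : 0 ≤ M (j + 1) := (norm_nonneg _).trans (hM (j + 1) 0)
    refine (norm_laplacian_iteratedFDeriv_convolution_le (hφ.contDiff_scaled ℓ) hF hg0 hgi hW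
      (hφ.tsupport_scaled_subset hℓ) (hcb y hy) j
      (hφ.norm_iteratedFDeriv_scaled_le hℓ (hM (j + 1)))).trans ?_
    gcongr

/-! ### Excess decay and the final estimates -/

lemma cylExcess_nonneg (u : E m → E n) (A : Mat m n) (p : Amb m n) (r : ℝ) :
    0 ≤ cylExcess u A p r :=
  mul_nonneg (by norm_num) (integral_nonneg fun q => by positivity)

lemma side_pos (hm : 1 ≤ m) (k : ℕ) : 0 < side m k := by
  have : (0 : ℝ) < m := by exact_mod_cast hm
  unfold side sigma
  positivity

lemma side_le_one (hm : 1 ≤ m) (k : ℕ) : side m k ≤ 1 := by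
  have h1 : (1 : ℝ) ≤ Real.sqrt m := Real.one_le_sqrt.2 (by exact_mod_cast hm)
  have h2 : (1 : ℝ) ≤ 2 ^ k := one_le_pow₀ (by norm_num)
  have h3 : 2 * sigma m = (Real.sqrt m)⁻¹ := by
    unfold sigma
    field_simp
  rw [side, h3, div_le_one (by positivity)]
  exact (inv_le_one_of_one_le₀ h1).trans h2

/-- The exponent is (2 - 2δ)(1 + γ) = 2 + 2(γ - δ(1 + γ)). The surplus power of T is dropped because
T ≤ 1. -/
lemma excess_rpow_le {γ δ C₀ e T ℓ : ℝ} (hγ : 0 < γ) (hC₀ : 0 ≤ C₀) (he : 0 ≤ e) (hT0 : 0 ≤ T)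
    (hT1 : T ≤ 1) (hℓ : 0 < ℓ) (h : e ≤ C₀ * T * ℓ ^ (2 - 2 * δ)) :
    e ^ (1 + γ) ≤ C₀ ^ (1 + γ) * T * ℓ ^ (2 + 2 * (γ - δ * (1 + γ))) := by
  calc e ^ (1 + γ) ≤ (C₀ * T * ℓ ^ (2 - 2 * δ)) ^ (1 + γ) :=
        Real.rpow_le_rpow he h (by linarith)
    _ = C₀ ^ (1 + γ) * T ^ (1 + γ) * ℓ ^ (2 + 2 * (γ - δ * (1 + γ))) := by
        rw [Real.mul_rpow (by positivity) (by positivity), Real.mul_rpow hC₀ hT0,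
          ← Real.rpow_mul hℓ.le]
        congr 2
        ring
    _ ≤ _ := by
        gcongr
        calc T ^ (1 + γ) ≤ T ^ (1 : ℝ) :=
              Real.rpow_le_rpow_of_exponent_ge' hT0 hT1 zero_le_one (by linarith)
          _ = T := Real.rpow_one T

/-- The `L¹` norm of the defect of a Lipschitz approximation is superlinear in the excess. -/
lemma exists_integral_harmonicDefect_le (m n : ℕ) {Λ : ℝ} (hΛ : 1 ≤ Λ) {M₀ : ℝ} (hM₀ : 1 ≤ M₀) :
    ∃ C₁ : ℝ, 0 ≤ C₁ ∧ ∀ (γ : ℝ), 0 < γ → ∀ (u v f : E m → E n) (A : Mat m n) (p : Amb m n)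
      (ℓ e : ℝ), A ∈ SO m n → LipschitzOnWith 1 u (ball 0 1) → 0 < ℓ → 0 ≤ e → e ^ γ ≤ 1 →
      e = (ℓ ^ m)⁻¹ * cylExcess u A p (16 * M₀ * ℓ) →
      LipschitzOnWith 2 v (ball (hor (rot A p)) (16 * M₀ * ℓ)) →
      rot A '' (graph u (ball 0 1) ∩ cyl A p (16 * M₀ * ℓ)) =
        graph v (ball (hor (rot A p)) (16 * M₀ * ℓ)) →
      IsLipApprox γ Λ e v (hor (rot A p)) (16 * M₀ * ℓ) f →
      ∫ y, harmonicDefect v f (ball (hor (rot A p)) (16 * M₀ * ℓ * (1 - e ^ γ))) y ≤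
        C₁ * e ^ (1 + γ) * ℓ ^ m := by
  obtain ⟨C, hC, hCe⟩ := exists_integral_norm_fderiv_sq_le m n
  have hV := variationConst_nonneg m n
  -- The first summand comes from the good set through the Dirichlet energy, the second from its
  -- complement, whose measure is at most (16 M₀ ℓ)^m e^(1+γ).
  refine ⟨variationConst m n * C + (variationConst m n * 8 + m * (Λ + 2)) * (16 * M₀) ^ m,
    by positivity, ?_⟩
  intro γ hγ u v f A p ℓ e hA hu hℓ he0 he1 he hv hgr ⟨K, hK, hKvol, hvK, hfv, hf⟩
  have heγ : 0 ≤ e ^ γ := Real.rpow_nonneg he0 γ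
  have heγ' : 0 ≤ e ^ (1 + γ) := Real.rpow_nonneg he0 _
  have hW := hCe u v A p _ hA hu hv hgr
  have hcyl : cylExcess u A p (16 * M₀ * ℓ) = e * ℓ ^ m := by
    rw [he]; field_simp
  have hr : 16 * M₀ * ℓ * (1 - e ^ γ) ≤ 16 * M₀ * ℓ :=
    mul_le_of_le_one_right (by positivity) (by linarith)
  refine (integral_harmonicDefect_le isOpen_ball measure_ball_lt_top.ne isOpen_ball
    (ball_subset_ball hr) hv hf hK hvK hfv hW (by positivity) hKvol).trans ?_
  rw [hcyl, Real.coe_toNNReal _ heγ, Real.coe_toNNReal _ (by positivity), mul_pow (16 * M₀)]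
  have hee : e ^ γ * e = e ^ (1 + γ) := by
    rw [add_comm, Real.rpow_add_one' he0 (by linarith)]
  have hl : Λ * e ^ γ ≤ Λ := mul_le_of_le_one_right (by linarith) he1
  calc variationConst m n * e ^ γ * (C * (e * ℓ ^ m)) +
        (variationConst m n * 8 + m * (Λ * e ^ γ + 2)) * ((16 * M₀) ^ m * ℓ ^ m * e ^ (1 + γ))
      ≤ variationConst m n * e ^ γ * (C * (e * ℓ ^ m)) +
        (variationConst m n * 8 + m * (Λ + 2)) * ((16 * M₀) ^ m * ℓ ^ m * e ^ (1 + γ)) := by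
        gcongr
    _ = (variationConst m n * C + (variationConst m n * 8 + m * (Λ + 2)) * (16 * M₀) ^ m) *
        e ^ (1 + γ) * ℓ ^ m := by
        rw [← hee]; ring

end CenterManifold

end


/-! ### The proposition: choice of exponents and constants -/

open CenterManifold in
open scoped Laplacian in
theorem proposition5p1 (m n : ℕ) (hm : 1 ≤ m) (hn : 1 ≤ n) (c₀ : ℝ) (hc₀ : 0 < c₀)
    (γ : ℝ) (hγ : 0 < γ) :
    ∃ δ₀ > 0, ∀ δ : ℝ, 0 < δ → δ < δ₀ → ∃ β : ℝ, 0 < β ∧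
      ∀ (φ : E m → ℝ), IsMollifier φ → ∀ Λ : ℝ, 1 ≤ Λ →
      ∀ (M₀ : ℝ) (N₀ : ℕ), Admissible m M₀ N₀ → ∀ C₀ : ℝ, 0 < C₀ →
      ∃ ε₀ > 0, ∃ (C : ℝ) (C' : ℕ → ℝ),
      ∀ u : E m → E n, LipschitzOnWith 1 u (ball 0 1) → AreaMinimizing c₀ u (ball 0 1) →
      totalExcess u < ε₀ →
      ∀ k ≥ N₀, ∀ i : Fin m → Fin (2 ^ k), ∀ A ∈ SO m n,
      ∀ (ℓ : ℝ) (p : Amb m n) (x : E m) (e : ℝ),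
      ℓ = side m k → p = pt (cubeCenter k i) (u (cubeCenter k i)) → x = hor (rot A p) →
      e = (ℓ ^ m)⁻¹ * cylExcess u A p (16 * M₀ * ℓ) →
      e ≤ C₀ * totalExcess u * ℓ ^ (2 - 2 * δ) →
      ∀ v : E m → E n, LipschitzOnWith 2 v (ball x (16 * M₀ * ℓ)) →
      rot A '' (graph u (ball 0 1) ∩ cyl A p (16 * M₀ * ℓ)) = graph v (ball x (16 * M₀ * ℓ)) →
      ∀ f : E m → E n, IsLipApprox γ Λ e v x (16 * M₀ * ℓ) f →
      (IntegrableOn (fun y => mollify φ ℓ f y - f y) (ball x (4 * M₀ * ℓ)) ∧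
        ∫ y in ball x (4 * M₀ * ℓ), ‖mollify φ ℓ f y - f y‖
          ≤ C * totalExcess u * ℓ ^ ((m : ℝ) + 3 + 2 * β)) ∧
      (ContDiffOn ℝ ∞ (mollify φ ℓ f) (ball x (4 * M₀ * ℓ)) ∧
        ∀ j : ℕ, ∀ y ∈ ball x (4 * M₀ * ℓ),
          ‖Δ (iteratedFDeriv ℝ j (mollify φ ℓ f)) y‖
            ≤ C' j * totalExcess u * ℓ ^ (1 - (j : ℝ) + 2 * β)) := by
  -- β is half the excess over 2 of the exponent (2 - 2δ)(1 + γ), and δ₀ is the value of δ at which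
  -- it vanishes.
  refine ⟨γ / (1 + γ), by positivity, fun δ hδ hδ₀ => ⟨γ - δ * (1 + γ), ?_, ?_⟩⟩
  · rw [lt_div_iff₀ (by positivity)] at hδ₀
    linarith
  intro φ hφ Λ hΛ M₀ N₀ hM C₀ hC₀
  set β := γ - δ * (1 + γ)
  have hδ1 : δ < 1 := hδ₀.trans (by rw [div_lt_one (by positivity)]; linarith)
  obtain ⟨θ, hθ, hθ0, hθφ⟩ := hφ.exists_potential hm
  choose M hMφ using hφ.exists_norm_iteratedFDeriv_le
  obtain ⟨C₁, hC₁, hdef⟩ := exists_integral_harmonicDefect_le m n hΛ hM.1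
  -- The bound 1 allows powers of E to be dropped; the other one gives e ≤ (1/2)^(1/γ), so that the
  -- approximation keeps at least half of the radius.
  set ε₀ : ℝ := min 1 ((1 / 2) ^ γ⁻¹ / C₀)
  refine ⟨ε₀, by positivity, n * (C₁ * C₀ ^ (1 + γ) * ∫ x, ‖fderiv ℝ θ x‖),
    fun j => n * (M (j + 1) * (C₁ * C₀ ^ (1 + γ))), ?_⟩
  intro u hu hmin hE k hk i A hA ℓ p x e hℓ hp hx he heE v hv hgr f hf
  subst hx
  have hM₀ : 1 ≤ M₀ := hM.1
  have hℓ0 : 0 < ℓ := hℓ ▸ side_pos hm k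
  have hℓ1 : ℓ ≤ 1 := hℓ ▸ side_le_one hm k
  set T := totalExcess u
  have he0 : 0 ≤ e := he ▸ mul_nonneg (by positivity) (cylExcess_nonneg u A p _)
  have hℓp : 0 < ℓ ^ (2 - 2 * δ) := Real.rpow_pos_of_pos hℓ0 _
  -- The nonnegative cylindrical excess is bounded by a positive multiple of T, which fixes the sign
  -- of T.
  have hT0 : 0 ≤ T := by
    have h1 := he0.trans heE
    rw [mul_assoc] at h1
    exact nonneg_of_mul_nonneg_left (nonneg_of_mul_nonneg_right h1 hC₀) hℓp
  have hT1 : T ≤ 1 := hE.le.trans (min_le_left _ _)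
  have heγ : e ^ γ ≤ 1 / 2 := by
    have h1 : e ≤ (1 / 2) ^ γ⁻¹ := by
      calc e ≤ C₀ * T * ℓ ^ (2 - 2 * δ) := heE
        _ ≤ C₀ * T * 1 := by
            gcongr
            exact Real.rpow_le_one hℓ0.le hℓ1 (by linarith)
        _ ≤ C₀ * ((1 / 2) ^ γ⁻¹ / C₀) * 1 := by
            gcongr
            exact hE.le.trans (min_le_right _ _)
        _ = (1 / 2) ^ γ⁻¹ := by field_simp
    calc e ^ γ ≤ ((1 / 2) ^ γ⁻¹) ^ γ := Real.rpow_le_rpow he0 h1 hγ.le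
      _ = 1 / 2 := Real.rpow_inv_rpow (by norm_num) hγ.ne'
  have heγ0 : 0 ≤ e ^ γ := Real.rpow_nonneg he0 γ
  set ρ := 16 * M₀ * ℓ * (1 - e ^ γ)
  have hMℓ : ℓ ≤ M₀ * ℓ := le_mul_of_one_le_left hℓ0.le hM₀
  -- Since e^γ ≤ 1/2, the radius ρ is at least 8 M₀ ℓ, and M₀ ≥ 1 leaves room for the mollification
  -- scale ℓ.
  have hρ : 4 * M₀ * ℓ + ℓ ≤ ρ := by
    have : 16 * M₀ * ℓ * (1 / 2) ≤ ρ :=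
      mul_le_mul_of_nonneg_left (by linarith) (by positivity)
    linarith
  have hρr : ρ ≤ 16 * M₀ * ℓ := mul_le_of_le_one_right (by positivity) (by linarith)
  set I := C₁ * C₀ ^ (1 + γ) * T * ℓ ^ (2 + 2 * β) * ℓ ^ m
  have hI : ∫ y, harmonicDefect v f (ball (hor (rot A p)) ρ) y ≤ I := by
    refine (hdef γ hγ u v f A p ℓ e hA hu hℓ0 he0 (by linarith) he hv hgr hf).trans ?_
    calc C₁ * e ^ (1 + γ) * ℓ ^ m ≤ C₁ * (C₀ ^ (1 + γ) * T * ℓ ^ (2 + 2 * β)) * ℓ ^ m := by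
          gcongr
          exact excess_rpow_le hγ hC₀.le he0 hT0 hT1 hℓ0 heE
      _ = I := by ring
  have hfl := hf.choose_spec.2.2.2.2
  obtain ⟨⟨h1, h2⟩, h3, h4⟩ := hφ.mollify_estimates hθ hθ0 hθφ hMφ hℓ0 hρ hρr hv
    (hmin.verticallyMinimizing hc₀ hu hA hv hgr) hfl hI
  refine ⟨⟨h1, h2.trans (le_of_eq ?_)⟩, h3, fun j y hy => (h4 j y hy).trans (le_of_eq ?_)⟩
  -- One factor ℓ from the scale integral times ℓ^(2+2β) ℓ^m from the total defect.
  · have : ℓ ^ ((m : ℝ) + 3 + 2 * β) = ℓ * (ℓ ^ (2 + 2 * β) * ℓ ^ m) := by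
      rw [← Real.rpow_natCast ℓ m, ← Real.rpow_add hℓ0]
      nth_rewrite 2 [← Real.rpow_one ℓ]
      rw [← Real.rpow_add hℓ0]
      congr 1
      ring
    rw [this]
    ring
  -- The kernel contributes ℓ^(-m-j-1); its ℓ^(-m) cancels the ℓ^m of the total defect.
  · have : ℓ ^ (1 - (j : ℝ) + 2 * β) = (ℓ ^ (j + 1))⁻¹ * ℓ ^ (2 + 2 * β) := by
      rw [← Real.rpow_natCast ℓ (j + 1), ← Real.rpow_neg hℓ0.le, ← Real.rpow_add hℓ0]
      congr 1
      push_cast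
      ring
    have hcancel : (ℓ ^ m)⁻¹ * ℓ ^ m = 1 := inv_mul_cancel₀ (by positivity)
    rw [this]
    simp only [I]
    linear_combination (n * (ℓ ^ (j + 1))⁻¹ * M (j + 1) * (C₁ * C₀ ^ (1 + γ) * T) *
      ℓ ^ (2 + 2 * β)) * hcancel
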